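/- An abstract tropical curve is a finite connected graph $\Gamma$ (loops and multiple edges allowed) with a length in $(0,\infty]$ on each edge, such that each edge of infinite length ends in a vertex of degree $1$, called an infinite vertex. Its genus is $g=\dim_{\mathbb Q}H_1(\Gamma,\mathbb Q)$. A tropical modification of $\Gamma$ is an abstract tropical curve obtained from it by a finite sequence of subdivisions of edges (lengths adding up), reverse subdivisions, and additions of an infinite edge at a finite vertex. A nodal tropical curve is a set $C\subset\mathbb R^2$ that is a union of finitely many segments and rays and that near each of its points is, up to a translation and the action of $GL_2(\mathbb Z)$, one of the following: the line $\mathbb R e_1$; the union of the three rays from the origin generated by $e_1$, $e_2$, $-e_1-e_2$; or the union of two distinct lines of rational slope through the origin. In the last case the point is a node, and its multiplicity is $|\det(u,v)|$, where $u,v\in\mathbb Z^2$ are primitive vectors along the two lines. Such a $C$ defines an abstract tropical curve when it is connected after resolution of the nodes: add an infinite vertex to each unbounded ray, replace each node by two vertices, one for each of the two lines, and give a segment with endpoints $p_1,p_2$ the length $\alpha>0$ for which $p_1-p_2=\alpha v$ with $v\in\mathbb Z^2$ primitive. The curve $C$ is an immersion of $\Gamma$ if this abstract tropical curve is isometric to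 a tropical modification of $\Gamma$. A concave piecewise-linear function $F(x)=\min_{a\in A}(c_a+\langle a,x\rangle)$, with $A\subset\mathbb Z^2$ finite and non-empty and $c_a\in\mathbb R$, is called dual to $C$ if $C$ is the set of points at which $F$ is not differentiable and the slopes of $F$ on the two sides of each edge of $C$ differ by a primitive vector. Its Newton polygon is the convex hull of $A$. Proposition. Let $\Gamma$ be an abstract tropical curve of genus $g$ and let $C\subset\mathbb R^2$ be an immersion of $\Gamma$. Then $C$ has finitely many nodes; let $n$ be their number, counted with multiplicities. There exists a function dual to $C$, and for every function $F$ dual to $C$, the number $i$ of points of $\mathbb Z^2$ in the interior (in $\mathbb R^2$) of the Newton polygon $\Delta$ of $F$ (the dual polygon of $C$) is $$ i = g + n . $$ -/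

import Mathlib

open scoped ENNReal Topology Matrix

universe u

namespace TropicalPlane

/-! ### Abstract tropical curves -/

/-- An abstract tropical curve: a finite connected graph, possibly with loops and multiple edges,
with a length in `(0, ∞]` on each edge. Every edge of infinite length ends in an infinite vertex,
and infinite vertices have degree one. -/
structure TropicalCurve where
  /-- vertices, the infinite ones included -/
  V : Type u
  /-- edges -/
  E : Type u
  finite_V : Finite V
  finite_E : Finite E
  /-- the unordered pair of endpoints of an edge (a diagonal pair for a loop) -/
  ends : E → Sym2 V
  length : E → ℝ≥0∞
  /-- the vertices that are infinite -/
  IsInf : V → Prop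
  nonempty : Nonempty V
  connected : ∀ v w : V, Relation.ReflTransGen (fun a b => ∃ e, ends e = s(a, b)) v w
  length_pos : ∀ e, 0 < length e
  length_eq_top_iff : ∀ e, length e = ⊤ ↔ ∃ v ∈ ends e, IsInf v
  /-- an infinite vertex has degree one, a loop contributing two to the degree -/
  degree_of_isInf : ∀ v, IsInf v →
    {e | v ∈ ends e}.ncard + {e | ends e = s(v, v)}.ncard = 1

namespace TropicalCurve

/-- The boundary map `C₁(Γ, ℚ) → C₀(Γ, ℚ)` of the underlying graph, each edge being given an
arbitrary orientation. -/
noncomputable def boundary (Γ : TropicalCurve.{u}) : (Γ.E →₀ ℚ) →ₗ[ℚ] (Γ.V →₀ ℚ) :=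
  Finsupp.linearCombination ℚ fun e =>
    Finsupp.single (Quot.out (Γ.ends e)).2 (1 : ℚ) - Finsupp.single (Quot.out (Γ.ends e)).1 (1 : ℚ)

/-- The genus: the dimension of the first homology `H₁(Γ, ℚ)` of the underlying graph. A graph has
no cells of dimension two, so that `H₁` is the kernel of the boundary map. -/
noncomputable def genus (Γ : TropicalCurve.{u}) : ℕ :=
  Module.finrank ℚ (LinearMap.ker Γ.boundary)

/-- `Γ'` is (up to isomorphism) obtained from `Γ` by replacing an edge `e₀` with endpoints `a`, `b`
by two consecutive edges, from `a` to a new finite vertex and from there to `b`, whose lengths add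
up to the length of `e₀`. In the identifications `ν`, `ε`, the new vertex is `none`, and the two new
edges are `some e₀` and `none`. That a new edge incident to an infinite vertex is infinite (and no
other one is) is part of `Γ'` being a tropical curve. -/
def IsSubdivision (Γ Γ' : TropicalCurve.{u}) : Prop :=
  ∃ (ν : Option Γ.V ≃ Γ'.V) (ε : Option Γ.E ≃ Γ'.E) (e₀ : Γ.E) (a b : Γ.V),
    Γ.ends e₀ = s(a, b) ∧
    Γ'.ends (ε (some e₀)) = s(ν (some a), ν none) ∧
    Γ'.ends (ε none) = s(ν none, ν (some b)) ∧
    Γ'.length (ε (some e₀)) + Γ'.length (ε none) = Γ.length e₀ ∧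
    (∀ e, e ≠ e₀ → Γ'.ends (ε (some e)) = (Γ.ends e).map fun v => ν (some v)) ∧
    (∀ e, e ≠ e₀ → Γ'.length (ε (some e)) = Γ.length e) ∧
    (∀ v, Γ'.IsInf (ν (some v)) ↔ Γ.IsInf v) ∧
    ¬ Γ'.IsInf (ν none)

/-- `Γ'` is (up to isomorphism) obtained from `Γ` by adding an infinite edge (`none`), with a new
infinite vertex (`none`) as its other end, at a finite vertex `v₀`. -/
def IsElementaryModification (Γ Γ' : TropicalCurve.{u}) : Prop :=
  ∃ (ν : Option Γ.V ≃ Γ'.V) (ε : Option Γ.E ≃ Γ'.E) (v₀ : Γ.V),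
    ¬ Γ.IsInf v₀ ∧
    Γ'.ends (ε none) = s(ν (some v₀), ν none) ∧
    (∀ e, Γ'.ends (ε (some e)) = (Γ.ends e).map fun v => ν (some v)) ∧
    (∀ e, Γ'.length (ε (some e)) = Γ.length e) ∧
    (∀ v, Γ'.IsInf (ν (some v)) ↔ Γ.IsInf v) ∧
    Γ'.IsInf (ν none)

/-- `Γ'` is a tropical modification of `Γ`: it is reached from `Γ` by a sequence of elementary
modifications, subdivisions and reverse subdivisions. -/
def IsModification (Γ Γ' : TropicalCurve.{u}) : Prop :=
  Relation.ReflTransGen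
    (fun A B => IsElementaryModification A B ∨ IsSubdivision A B ∨ IsSubdivision B A) Γ Γ'

end TropicalCurve

/-! ### Nodal tropical curves in the plane -/

/-- The plane `ℝ²`. -/
abbrev Plane := Fin 2 → ℝ

/-- The lattice `ℤ²`. -/
abbrev Lattice := Fin 2 → ℤ

/-- The inclusion of `ℤ²` in `ℝ²`. -/
def toPlane (z : Lattice) : Plane := fun i => (z i : ℝ)

/-- A primitive integral vector: its entries have no common divisor. -/
def IsPrimitive (z : Lattice) : Prop := IsCoprime (z 0) (z 1)

/-- The determinant of the matrix with columns `z`, `w`. -/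
def det₂ (z w : Lattice) : ℤ := z 0 * w 1 - z 1 * w 0

/-- The closed ray from `p` in the direction `d`. -/
def ray (p d : Plane) : Set Plane := {x | ∃ t : ℝ, 0 ≤ t ∧ x = p + t • d}

/-- The line through `p` in the direction `d`. -/
def line (p d : Plane) : Set Plane := {x | ∃ t : ℝ, x = p + t • d}

/-- The sets `C` and `S` agree in a neighbourhood of `p`. -/
def LocallyEq (C S : Set Plane) (p : Plane) : Prop := ∀ᶠ x in 𝓝 p, x ∈ C ↔ x ∈ S

/-- The standard smooth model of valence two: the rays generated by `e₁` and `-e₁`. -/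
def smoothModel₂ : Set Plane := ray 0 ![1, 0] ∪ ray 0 ![-1, 0]

/-- The standard smooth model of valence three: the rays generated by `e₁`, `e₂`, `-e₁ - e₂`. -/
def smoothModel₃ : Set Plane := ray 0 ![1, 0] ∪ ray 0 ![0, 1] ∪ ray 0 ![-1, -1]

/-- Near `p`, the set `C` is a standard smooth model, after a translation and a change of
coordinates in `GL₂(ℤ)`. -/
def IsSmoothAt (C : Set Plane) (p : Plane) : Prop :=
  ∃ M : GL (Fin 2) ℤ, ∃ S : Set Plane, (S = smoothModel₂ ∨ S = smoothModel₃) ∧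
    LocallyEq C ((fun x => p + ((M : Matrix (Fin 2) (Fin 2) ℤ).map (Int.cast : ℤ → ℝ)) *ᵥ x) '' S) p

/-- Near `p`, the set `C` is the union of the two distinct lines through `p` in the directions of
the primitive integral vectors `z` and `w`. -/
def IsNodeWith (C : Set Plane) (p : Plane) (z w : Lattice) : Prop :=
  IsPrimitive z ∧ IsPrimitive w ∧ det₂ z w ≠ 0 ∧
    LocallyEq C (line p (toPlane z) ∪ line p (toPlane w)) p

/-- The nodes of `C`. -/
def nodes (C : Set Plane) : Set Plane := {p | ∃ z w, IsNodeWith C p z w}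

/-- The multiplicity `|det (z, w)|` of a node, where `z` and `w` are primitive vectors along the two
lines. They are unique up to order and sign, so that at a node the set below has one element. -/
noncomputable def nodeMultiplicity (C : Set Plane) (p : Plane) : ℕ :=
  sInf {m | ∃ z w, IsNodeWith C p z w ∧ m = (det₂ z w).natAbs}

/-- The number of nodes of `C`, counted with multiplicities. -/
noncomputable def nodeCount (C : Set Plane) : ℕ := ∑ᶠ p ∈ nodes C, nodeMultiplicity C p

/-- A nodal tropical curve in the plane: a union of finitely many segments and rays that is locally
a standard smooth model or a node. -/
def IsNodalCurve (C : Set Plane) : Prop :=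
  (∃ S : Set (Set Plane), S.Finite ∧
    (∀ s ∈ S, (∃ a b, a ≠ b ∧ s = segment ℝ a b) ∨ (∃ a d, d ≠ 0 ∧ s = ray a d)) ∧ C = ⋃₀ S) ∧
  ∀ p ∈ C, IsSmoothAt C p ∨ p ∈ nodes C

/-! ### Immersions -/

/-- The image in the plane of the interior of the edge `e`, where the finite vertices are placed by
`pos` and the infinite edge ending in an infinite vertex `w` runs in the direction `dir w`. -/
def openEdge (Γ : TropicalCurve.{u}) (pos : Γ.V → Plane) (dir : Γ.V → Lattice) (e : Γ.E) :
    Set Plane :=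
  {x | ∃ v w, Γ.ends e = s(v, w) ∧ ¬ Γ.IsInf v ∧
    ((¬ Γ.IsInf w ∧ x ∈ openSegment ℝ (pos v) (pos w)) ∨
      (Γ.IsInf w ∧ ∃ t : ℝ, 0 < t ∧ x = pos v + t • toPlane (dir w)))}

/-- An identification of `Γ` with the abstract tropical curve given by the nodal tropical curve `C`,
that is, with the graph into which `C` is divided by vertices and, for each unbounded ray, an
infinite vertex, whose nodes are resolved: over a node there are two vertices, one for each of the
two lines. The length of a segment from `p` to `q` is the positive `α` such that `q - p = α z` with
`z` primitive integral. The values of `pos` at infinite vertices and of `dir` at finite vertices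
are irrelevant. -/
structure Resolution (Γ : TropicalCurve.{u}) (C : Set Plane) where
  /-- the images of the finite vertices -/
  pos : Γ.V → Plane
  /-- the primitive directions of the rays that end in the infinite vertices -/
  dir : Γ.V → Lattice
  /-- an infinite edge is a ray, so that it starts at a finite vertex -/
  exists_finite_end : ∀ e, ∃ v ∈ Γ.ends e, ¬ Γ.IsInf v
  primitive_dir : ∀ v, Γ.IsInf v → IsPrimitive (dir v)
  length_eq : ∀ e v w, Γ.ends e = s(v, w) → ¬ Γ.IsInf v → ¬ Γ.IsInf w →
    ∃ z, IsPrimitive z ∧ pos w - pos v = (Γ.length e).toReal • toPlane z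
  image_eq : C = pos '' {v | ¬ Γ.IsInf v} ∪ ⋃ e, openEdge Γ pos dir e
  disjoint_edges : ∀ e f, e ≠ f → Disjoint (openEdge Γ pos dir e) (openEdge Γ pos dir f)
  vertex_notMem_edge : ∀ v e, ¬ Γ.IsInf v → pos v ∉ openEdge Γ pos dir e
  /-- there is at most one vertex over a point that is not a node -/
  vertex_unique : ∀ v w, ¬ Γ.IsInf v → ¬ Γ.IsInf w → pos v = pos w → pos v ∉ nodes C → v = w
  /-- over a node there are exactly two vertices, one for each line -/
  resolves_nodes : ∀ p ∈ nodes C, ∃ z w, IsNodeWith C p z w ∧ ∃ a b, a ≠ b ∧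
    {v | ¬ Γ.IsInf v ∧ pos v = p} = {a, b} ∧
    (∀ e, a ∈ Γ.ends e → openEdge Γ pos dir e ⊆ line p (toPlane z)) ∧
    (∀ e, b ∈ Γ.ends e → openEdge Γ pos dir e ⊆ line p (toPlane w))

/-- `C` is a (planar) immersion of `Γ`: a nodal tropical curve whose abstract tropical curve is a
tropical modification of `Γ`. -/
def IsImmersion (Γ : TropicalCurve.{u}) (C : Set Plane) : Prop :=
  IsNodalCurve C ∧ ∃ Γ' : TropicalCurve.{u}, Γ.IsModification Γ' ∧ Nonempty (Resolution Γ' C)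

/-! ### The dual polygon -/

/-- A concave piecewise-linear function with integral slopes, as the minimum of finitely many
affine functions `x ↦ coeff a + ⟨a, x⟩` with `a ∈ ℤ²`. -/
structure TropicalPolynomial where
  support : Finset Lattice
  nonempty : support.Nonempty
  coeff : Lattice → ℝ

namespace TropicalPolynomial

/-- The affine function of slope `a`. -/
noncomputable def term (F : TropicalPolynomial) (a : Lattice) (x : Plane) : ℝ :=
  F.coeff a + toPlane a ⬝ᵥ x

/-- The concave piecewise-linear function. -/
noncomputable def eval (F : TropicalPolynomial) (x : Plane) : ℝ :=
  F.support.inf' F.nonempty fun a => F.term a x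

/-- The closed region in which the function is affine of slope `a`. -/
def region (F : TropicalPolynomial) (a : Lattice) : Set Plane := {x | F.eval x = F.term a x}

/-- The curve `C` is dual to `F`: it is the locus where `F` is not differentiable, and the slopes
of `F` on the two sides of an edge (that is, on two full-dimensional regions that meet in more
than one point) differ by a primitive vector. -/
def IsDualTo (F : TropicalPolynomial) (C : Set Plane) : Prop :=
  C = {x | ¬ DifferentiableAt ℝ F.eval x} ∧
  ∀ a ∈ F.support, ∀ b ∈ F.support, a ≠ b →
    (interior (F.region a)).Nonempty → (interior (F.region b)).Nonempty →
    (F.region a ∩ F.region b).Nontrivial → IsPrimitive (a - b)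

/-- The Newton polygon: the convex hull of the slopes. (A slope that is attained in no open region
is in the convex hull of the other ones, so that it does not change the polygon.) -/
def newtonPolygon (F : TropicalPolynomial) : Set Plane :=
  convexHull ℝ (toPlane '' (F.support : Set Lattice))

end TropicalPolynomial

end TropicalPlane

/-! The plane is swept by the linear form `lam`, which vanishes at no non-zero lattice vector: no
edge of the curve is level, so every edge can be oriented upwards. A resolution becomes a `Net`,
whose vertices are the finite ones and whose edges lack an end where they are unbounded. Let V and E
be the numbers of its vertices and edges, and r₋, r₊ the numbers of edges without a lower,
respectively upper, end. Modifications preserve the Euler characteristic of the graph, hence g + V +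
r₋ + r₊ = E + 1 (`Resolution.genus_add_card_net`).

A dual function. Call `kerVec`, which spans the kernel of `lam`, the direction to the right. Each
edge has an integral affine function that vanishes on it and is positive to its right. The potential
`pot` is minus the sum of these functions over the edges that cross the level line of x to the left
of x. The balancing condition (`balanced`) makes this compatible with the passage through a vertex,
so that near every point `pot` is an affine function minus the kink prescribed by the edges there
(`hasForm_pot`). Such a function is concave (`concaveOn_of_local`), and it is the minimum of its
finitely many tangents, which is the required tropical polynomial. Conversely, duality forces the
same kinks away from the vertices. The complement of a finite set is connected, so every dual F
differs from `pot` by an integral affine function (`exists_eval_eq_pot_add`). Thus every dual F has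
the local form `HasForm` at all points.

The count. For a lattice point z, the maxima of the concave function F - z form a convex set, with
at most one lowest point in the sense of `IsLowest`. Let S be the set of those z for which it
exists. The number of z with lowest point p depends only on C near p: it is 0 on a line and where
two edges merge upwards into one, 1 where one edge splits into two, and the multiplicity at a node,
where it counts the lattice points of a half-open parallelogram. In all cases it is the number of
edges going up from p, minus the number of vertices over p, plus the multiplicity if p is a node
(`ncard_lowVectors`). Summation gives |S| = (E - r₋) - V + n = g + r₊ - 1 + n.

Interior lattice points of the Newton polygon belong to S, because F - z then tends to -∞ in all
directions. The other elements of S are the slopes of the regions between two consecutive rays going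
up. A level line above all vertices meets r₊ - 1 of these (`ncard_isLowest_boundary`), which leaves
g + n interior points. -/

namespace TropicalPlane

/-! ### A linear form that is irrational on the lattice -/

/-- A linear form that vanishes at no non-zero lattice vector. -/
noncomputable def lam (x : Plane) : ℝ := x 0 + √2 * x 1

/-- A generator of the kernel of `lam`. -/
noncomputable def kerVec : Plane := ![√2, -1]

/-- The determinant of two vectors of the plane. -/
def dt (x y : Plane) : ℝ := x 0 * y 1 - x 1 * y 0

/-- The slope of the linear form `v ↦ dt v d`. -/
def nrm (d : Lattice) : Lattice := ![d 1, -d 0]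

@[simp] lemma toPlane_apply (z : Lattice) (i : Fin 2) : toPlane z i = z i := rfl
@[simp] lemma toPlane_zero : toPlane 0 = 0 := by ext i; simp
@[simp] lemma toPlane_neg (a : Lattice) : toPlane (-a) = -toPlane a := by ext i; simp
@[simp] lemma toPlane_add (a b : Lattice) : toPlane (a + b) = toPlane a + toPlane b := by
  ext i; simp
@[simp] lemma toPlane_sub (a b : Lattice) : toPlane (a - b) = toPlane a - toPlane b := by
  ext i; simp
@[simp] lemma toPlane_zsmul (k : ℤ) (b : Lattice) : toPlane (k • b) = (k : ℝ) • toPlane b := by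
  ext i; simp

lemma toPlane_injective : Function.Injective toPlane := fun a b h => by
  ext i; exact Int.cast_injective (congrFun h i)

@[simp] lemma toPlane_eq_zero {a : Lattice} : toPlane a = 0 ↔ a = 0 := by
  rw [← toPlane_zero, toPlane_injective.eq_iff]

@[simp] lemma lam_zero : lam 0 = 0 := by simp [lam]
@[simp] lemma lam_add (x y : Plane) : lam (x + y) = lam x + lam y := by simp [lam]; ring
@[simp] lemma lam_sub (x y : Plane) : lam (x - y) = lam x - lam y := by simp [lam]; ring
@[simp] lemma lam_neg (x : Plane) : lam (-x) = -lam x := by simp [lam]; ring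
@[simp] lemma lam_smul (t : ℝ) (x : Plane) : lam (t • x) = t * lam x := by simp [lam]; ring
@[simp] lemma lam_kerVec : lam kerVec = 0 := by simp [lam, kerVec]
@[simp] lemma dt_zero_left (y : Plane) : dt 0 y = 0 := by simp [dt]
@[simp] lemma dt_zero_right (y : Plane) : dt y 0 = 0 := by simp [dt]
@[simp] lemma dt_self (y : Plane) : dt y y = 0 := by simp [dt]; ring
@[simp] lemma dt_add_left (x y z : Plane) : dt (x + y) z = dt x z + dt y z := by simp [dt]; ring
@[simp] lemma dt_sub_left (x y z : Plane) : dt (x - y) z = dt x z - dt y z := by simp [dt]; ring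
@[simp] lemma dt_neg_left (x z : Plane) : dt (-x) z = -dt x z := by simp [dt]; ring
@[simp] lemma dt_smul_left (t : ℝ) (x z : Plane) : dt (t • x) z = t * dt x z := by
  simp [dt]; ring
@[simp] lemma dt_add_right (x y z : Plane) : dt z (x + y) = dt z x + dt z y := by simp [dt]; ring
@[simp] lemma dt_sub_right (x y z : Plane) : dt z (x - y) = dt z x - dt z y := by simp [dt]; ring
@[simp] lemma dt_neg_right (x z : Plane) : dt z (-x) = -dt z x := by simp [dt]; ring
@[simp] lemma dt_smul_right (t : ℝ) (x z : Plane) : dt z (t • x) = t * dt z x := by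
  simp [dt]; ring

lemma dt_swap (x y : Plane) : dt x y = -dt y x := by simp [dt]; ring

@[simp] lemma dt_kerVec (x : Plane) : dt kerVec x = lam x := by simp [dt, kerVec, lam]; ring

@[fun_prop] lemma continuous_lam : Continuous lam := by unfold lam; fun_prop
@[fun_prop] lemma continuous_dt (y : Plane) : Continuous fun x => dt x y := by unfold dt; fun_prop

lemma det₂_cast (a b : Lattice) : ((det₂ a b : ℤ) : ℝ) = dt (toPlane a) (toPlane b) := by
  simp [det₂, dt]

lemma toPlane_nrm_dotProduct (d : Lattice) (v : Plane) :
    toPlane (nrm d) ⬝ᵥ v = dt v (toPlane d) := by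
  simp [nrm, dt, dotProduct, Fin.sum_univ_two]; ring

/-- The three-term Plücker relation for `v`, `x`, `y` and `kerVec`, as `lam` is the determinant with
`kerVec`. For two upward vectors it ties the sides of their lines on which `v` lies to the sign of
`lam v`. -/
lemma plucker (v x y : Plane) : dt v x * lam y - dt v y * lam x = -lam v * dt x y := by
  simp [dt, lam]; ring

/-- Irrationality of √2. This genericity orients every edge upwards and excludes level edges. -/
lemma lam_toPlane_ne_zero {z : Lattice} (hz : z ≠ 0) : lam (toPlane z) ≠ 0 := by
  intro h
  simp only [lam, toPlane_apply] at h
  by_cases h1 : z 1 = 0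
  · apply hz
    ext i
    fin_cases i
    · simpa [h1] using h
    · simpa using h1
  · have hirr : Irrational (√2 * (z 1 : ℤ)) := irrational_sqrt_two.mul_intCast h1
    apply hirr.ne_int (-(z 0))
    push_cast
    linarith

lemma eq_smul_kerVec {v : Plane} (hv : lam v = 0) : v = (-v 1) • kerVec := by
  simp only [lam] at hv
  ext i
  fin_cases i
  · simp [kerVec]; linarith
  · simp [kerVec]

lemma kerVec_ne_zero : kerVec ≠ 0 := fun h => by
  have := congrFun h 1
  simp [kerVec] at this

lemma toPlane_dotProduct_kerVec (z : Lattice) :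
    toPlane z ⬝ᵥ kerVec = lam (toPlane ![-z 1, z 0]) := by
  simp [dotProduct, Fin.sum_univ_two, kerVec, lam]; ring

/-- Pairing with `kerVec` is `lam` after a quarter turn of the lattice. Integral slopes are
therefore determined by the derivative along a level line. -/
lemma eq_zero_of_dotProduct_kerVec {z : Lattice} (h : toPlane z ⬝ᵥ kerVec = 0) : z = 0 := by
  by_contra hz
  rw [toPlane_dotProduct_kerVec] at h
  refine lam_toPlane_ne_zero (fun h0 => hz ?_) h
  have h1 := congrFun h0 0
  have h2 := congrFun h0 1
  ext i; fin_cases i <;> simp_all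

/-- Two vectors that annihilate two independent vectors vanish. -/
lemma eq_zero_of_dt {x y v : Plane} (hxy : dt x y ≠ 0) (h1 : dt v x = 0) (h2 : dt v y = 0) :
    v = 0 := by
  simp only [dt] at *
  ext i
  fin_cases i
  · have : v 0 * (x 0 * y 1 - x 1 * y 0) = 0 := by
      linear_combination x 0 * h2 - y 0 * h1
    simpa [hxy] using this
  · have : v 1 * (x 0 * y 1 - x 1 * y 0) = 0 := by
      linear_combination x 1 * h2 - y 1 * h1
    simpa [hxy] using this

/-! ### Primitive vectors -/

lemma IsPrimitive.ne_zero {d : Lattice} (hd : IsPrimitive d) : d ≠ 0 := by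
  rintro rfl
  obtain ⟨a, b, h⟩ := hd
  simp at h

lemma IsPrimitive.neg {d : Lattice} (hd : IsPrimitive d) : IsPrimitive (-d) := by
  obtain ⟨a, b, h⟩ := hd
  exact ⟨-a, -b, by simpa using h⟩

lemma IsPrimitive.nrm {d : Lattice} (hd : IsPrimitive d) : IsPrimitive (nrm d) := by
  obtain ⟨a, b, h⟩ := hd
  exact ⟨b, -a, by simp [TropicalPlane.nrm]; linarith⟩

lemma IsPrimitive.exists_smul_eq {d e : Lattice} (hd : IsPrimitive d) (h : det₂ d e = 0) :
    ∃ k : ℤ, e = k • d := by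
  obtain ⟨a, b, hab⟩ := hd
  simp only [det₂] at h
  refine ⟨a * e 0 + b * e 1, ?_⟩
  ext i
  fin_cases i
  · simp; linear_combination (-e 0) * hab - b * h
  · simp; linear_combination (-e 1) * hab + a * h

lemma IsPrimitive.exists_det₂_eq {d : Lattice} (hd : IsPrimitive d) (k : ℤ) :
    ∃ e, det₂ d e = k := by
  obtain ⟨a, b, hab⟩ := hd
  refine ⟨![-b * k, a * k], ?_⟩
  simp [det₂]; linear_combination k * hab

lemma isPrimitive_of_det₂ {d e : Lattice} (h : IsUnit (det₂ d e)) : IsPrimitive d := by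
  obtain ⟨v, hv⟩ := h.exists_left_inv
  refine ⟨v * e 1, -v * e 0, ?_⟩
  rw [← hv]; simp [det₂]; ring

lemma IsPrimitive.eq_of_smul_eq {d e : Lattice} (hd : IsPrimitive d) (he : IsPrimitive e)
    {s t : ℝ} (hs : 0 < s) (ht : 0 ≤ t) (h : s • toPlane d = t • toPlane e) : d = e := by
  have hdet : det₂ d e = 0 := by
    have h1 : s * dt (toPlane d) (toPlane e) = 0 := by
      rw [← dt_smul_left, h]; simp
    have h2 : dt (toPlane d) (toPlane e) = 0 := by simpa [hs.ne'] using h1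
    rw [← det₂_cast] at h2
    exact_mod_cast h2
  obtain ⟨k, rfl⟩ := hd.exists_smul_eq hdet
  have hk : IsUnit k := by
    obtain ⟨a, b, hab⟩ := he
    refine IsUnit.of_mul_eq_one (a * d 0 + b * d 1) ?_
    simp at hab; linear_combination hab
  rcases Int.isUnit_iff.mp hk with rfl | rfl
  · simp
  · exfalso
    have h3 : (s + t) • toPlane d = 0 := by
      rw [add_smul, h]; simp
    rcases smul_eq_zero.mp h3 with h4 | h4
    · linarith
    · exact hd.ne_zero (toPlane_eq_zero.mp h4)

/-! ### Local directions of a plane set -/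

/-- The primitive directions in which `C` leaves `p`. -/
def dirs (C : Set Plane) (p : Plane) : Set Lattice :=
  {d | IsPrimitive d ∧ ∀ᶠ t in 𝓝[>] (0 : ℝ), p + t • toPlane d ∈ C}

/-- The directions with positive value of `lam` in which `C` leaves `p`. -/
def upDirs (C : Set Plane) (p : Plane) : Set Lattice := {d | 0 < lam (toPlane d) ∧ d ∈ dirs C p}

/-- The opposites of the directions with negative value of `lam` in which `C` leaves `p`. -/
def downDirs (C : Set Plane) (p : Plane) : Set Lattice :=
  {d | 0 < lam (toPlane d) ∧ -d ∈ dirs C p}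

/-- The union of the rays from `p` in the directions `A`. -/
def star (p : Plane) (A : Set Lattice) : Set Plane :=
  {x | ∃ d ∈ A, ∃ t : ℝ, 0 ≤ t ∧ x = p + t • toPlane d}

lemma tendsto_add_smul (p v : Plane) :
    Filter.Tendsto (fun t : ℝ => p + t • v) (𝓝[>] (0 : ℝ)) (𝓝 p) := by
  have : Continuous fun t : ℝ => p + t • v := by fun_prop
  simpa using (this.tendsto 0).mono_left nhdsWithin_le_nhds

/-- Distinct primitive vectors span distinct rays, so the germ of a star determines its rays. This
makes all local data of the curve independent of the chosen model. -/
lemma dirs_eq_of_star {C : Set Plane} {p : Plane} {A : Set Lattice}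
    (hA : ∀ d ∈ A, IsPrimitive d) (h : LocallyEq C (star p A) p) : dirs C p = A := by
  ext d
  constructor
  · rintro ⟨hd, hev⟩
    have h1 := (tendsto_add_smul p (toPlane d)).eventually h
    have h0 : ∀ᶠ t in 𝓝[>] (0 : ℝ), 0 < t := self_mem_nhdsWithin
    obtain ⟨t, ht, h2, h3⟩ := (h0.and (hev.and h1)).exists
    obtain ⟨e, he, s, hs, hse⟩ := h3.mp h2
    rw [hd.eq_of_smul_eq (hA e he) ht hs (add_left_cancel hse)]
    exact he
  · intro hd
    refine ⟨hA d hd, ?_⟩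
    have h1 := (tendsto_add_smul p (toPlane d)).eventually h
    filter_upwards [h1, self_mem_nhdsWithin] with t h2 h3
    exact h2.mpr ⟨d, hd, t, le_of_lt h3, rfl⟩

lemma line_eq_star (p : Plane) (z : Lattice) : line p (toPlane z) = star p {z, -z} := by
  ext x
  constructor
  · rintro ⟨t, rfl⟩
    rcases le_total 0 t with h | h
    · exact ⟨z, by simp, t, h, rfl⟩
    · exact ⟨-z, by simp, -t, by linarith, by simp⟩
  · rintro ⟨d, hd, t, -, rfl⟩
    rcases hd with rfl | rfl
    · exact ⟨t, rfl⟩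
    · exact ⟨-t, by simp⟩

lemma star_union (p : Plane) (A B : Set Lattice) : star p (A ∪ B) = star p A ∪ star p B := by
  ext x
  simp only [star, Set.mem_ofPred_eq, Set.mem_union]
  constructor
  · rintro ⟨d, hd | hd, h⟩
    exacts [Or.inl ⟨d, hd, h⟩, Or.inr ⟨d, hd, h⟩]
  · rintro (⟨d, hd, h⟩ | ⟨d, hd, h⟩)
    exacts [⟨d, Or.inl hd, h⟩, ⟨d, Or.inr hd, h⟩]

lemma IsNodeWith.dirs_eq {C : Set Plane} {p : Plane} {z w : Lattice} (h : IsNodeWith C p z w) :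
    dirs C p = {z, -z, w, -w} := by
  obtain ⟨hz, hw, -, h⟩ := h
  rw [line_eq_star, line_eq_star, ← star_union] at h
  rw [dirs_eq_of_star _ h]
  · ext; simp; tauto
  · rintro d ((rfl | rfl) | (rfl | rfl))
    exacts [hz, hz.neg, hw, hw.neg]

lemma det₂_self (z : Lattice) : det₂ z z = 0 := by simp [det₂]; ring
lemma det₂_neg_left (z w : Lattice) : det₂ (-z) w = -det₂ z w := by simp [det₂]; ring
lemma det₂_neg_right (z w : Lattice) : det₂ z (-w) = -det₂ z w := by simp [det₂]; ring
lemma det₂_swap (z w : Lattice) : det₂ z w = -det₂ w z := by simp [det₂]; ring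

/-- The multiplicity of a node can be computed from any pair of primitive vectors. -/
lemma IsNodeWith.nodeMultiplicity_eq {C : Set Plane} {p : Plane} {z w : Lattice}
    (h : IsNodeWith C p z w) : nodeMultiplicity C p = (det₂ z w).natAbs := by
  have : {m | ∃ z w, IsNodeWith C p z w ∧ m = (det₂ z w).natAbs} = {(det₂ z w).natAbs} := by
    ext m
    simp only [Set.mem_ofPred_eq, Set.mem_singleton_iff]
    constructor
    · rintro ⟨z', w', h', rfl⟩
      have h1 : z' ∈ dirs C p := by rw [h'.dirs_eq]; simp
      have h2 : w' ∈ dirs C p := by rw [h'.dirs_eq]; simp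
      have h3 := h'.2.2.1
      rw [h.dirs_eq] at h1 h2
      -- Both vectors are among `±z`, `±w`. Proportional choices have determinant zero, and the
      -- others change it only by a sign.
      rcases h1 with rfl | rfl | rfl | rfl <;> rcases h2 with rfl | rfl | rfl | rfl <;>
        simp only [det₂_neg_left, det₂_neg_right, det₂_self, neg_zero, neg_neg, ne_eq,
          not_true_eq_false, Int.natAbs_neg] at h3 ⊢
      all_goals rw [det₂_swap, Int.natAbs_neg]
    · rintro rfl
      exact ⟨z, w, h, rfl⟩
  rw [nodeMultiplicity, this, csInf_singleton]

/-- The columns of the matrix in `GL₂(ℤ)` are the images of the standard directions, and their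
determinant is a unit. -/
lemma IsSmoothAt.exists_star {C : Set Plane} {p : Plane} (h : IsSmoothAt C p) :
    (∃ d, IsPrimitive d ∧ LocallyEq C (star p {d, -d}) p) ∨
    ∃ d e, IsUnit (det₂ d e) ∧ LocallyEq C (star p {d, e, -(d + e)}) p := by
  obtain ⟨M, S, hS, h⟩ := h
  set d : Lattice := ![M.1 0 0, M.1 1 0] with hd
  set e : Lattice := ![M.1 0 1, M.1 1 1] with he
  have hdet : IsUnit (det₂ d e) := by
    have : det₂ d e = M.1.det := by
      rw [Matrix.det_fin_two]; simp [det₂, hd, he]; ring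
    rw [this]
    exact (Matrix.isUnit_iff_isUnit_det _).mp M.isUnit
  have h1 : ((M : Matrix (Fin 2) (Fin 2) ℤ).map (Int.cast : ℤ → ℝ)) *ᵥ ![1, 0] = toPlane d := by
    ext i; fin_cases i <;> simp [Matrix.mulVec, dotProduct, Fin.sum_univ_two, hd]
  have h2 : ((M : Matrix (Fin 2) (Fin 2) ℤ).map (Int.cast : ℤ → ℝ)) *ᵥ ![0, 1] = toPlane e := by
    ext i; fin_cases i <;> simp [Matrix.mulVec, dotProduct, Fin.sum_univ_two, he]
  have h3 : ((M : Matrix (Fin 2) (Fin 2) ℤ).map (Int.cast : ℤ → ℝ)) *ᵥ ![-1, 0] =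
      toPlane (-d) := by
    ext i; fin_cases i <;> simp [Matrix.mulVec, dotProduct, Fin.sum_univ_two, hd]
  have h4 : ((M : Matrix (Fin 2) (Fin 2) ℤ).map (Int.cast : ℤ → ℝ)) *ᵥ ![-1, -1] =
      toPlane (-(d + e)) := by
    ext i; fin_cases i <;> simp [Matrix.mulVec, dotProduct, Fin.sum_univ_two, hd, he] <;> ring
  have key : ∀ (v : Plane) (z : Lattice),
      ((M : Matrix (Fin 2) (Fin 2) ℤ).map (Int.cast : ℤ → ℝ)) *ᵥ v = toPlane z →
      (fun x => p + ((M : Matrix (Fin 2) (Fin 2) ℤ).map (Int.cast : ℤ → ℝ)) *ᵥ x) '' ray 0 v =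
        star p {z} := by
    intro v z hz
    ext x
    constructor
    · rintro ⟨_, ⟨t, ht, rfl⟩, rfl⟩
      exact ⟨z, rfl, t, ht, by simp [Matrix.mulVec_smul, hz]⟩
    · rintro ⟨_, rfl, t, ht, rfl⟩
      exact ⟨_, ⟨t, ht, rfl⟩, by simp [Matrix.mulVec_smul, hz]⟩
  rcases hS with rfl | rfl
  · left
    refine ⟨d, isPrimitive_of_det₂ hdet, ?_⟩
    rw [smoothModel₂, Set.image_union, key _ _ h1, key _ _ h3, ← star_union] at h
    exact h
  · right
    refine ⟨d, e, hdet, ?_⟩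
    rw [smoothModel₃, Set.image_union, Set.image_union, key _ _ h1, key _ _ h2, key _ _ h4,
      ← star_union, ← star_union] at h
    convert h using 2
    ext; simp; tauto

/-- The local form of a nodal curve at one of its points, in terms of the directions above and
below the level of `lam`. -/
inductive LocalType (C : Set Plane) (p : Plane) (U D : Finset Lattice) : Prop
  | line (d : Lattice) (hd : IsPrimitive d) (pos : 0 < lam (toPlane d)) (hU : U = {d})
      (hD : D = {d}) (hp : p ∉ nodes C) (heq : LocallyEq C (line p (toPlane d)) p)
  | node (d e : Lattice) (hd : IsPrimitive d) (he : IsPrimitive e) (hdpos : 0 < lam (toPlane d))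
      (hepos : 0 < lam (toPlane e)) (hdet : 0 < det₂ d e) (hU : U = {d, e}) (hD : D = {d, e})
      (hp : p ∈ nodes C) (hmul : nodeMultiplicity C p = (det₂ d e).natAbs)
  | merge (d e : Lattice) (hdpos : 0 < lam (toPlane d)) (hepos : 0 < lam (toPlane e))
      (hdet : det₂ d e = 1) (hU : U = {d + e}) (hD : D = {d, e}) (hp : p ∉ nodes C)
  | split (d e : Lattice) (hdpos : 0 < lam (toPlane d)) (hepos : 0 < lam (toPlane e))
      (hdet : det₂ d e = 1) (hU : U = {d, e}) (hD : D = {d + e}) (hp : p ∉ nodes C)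

lemma IsNodeWith.neg_left {C : Set Plane} {p : Plane} {z w : Lattice} (h : IsNodeWith C p z w) :
    IsNodeWith C p (-z) w := by
  obtain ⟨hz, hw, hd, h⟩ := h
  refine ⟨hz.neg, hw, by simpa [det₂_neg_left] using hd, ?_⟩
  have : line p (toPlane (-z)) = line p (toPlane z) := by
    rw [line_eq_star, line_eq_star, neg_neg, Set.pair_comm]
  rwa [this]

lemma IsNodeWith.symm {C : Set Plane} {p : Plane} {z w : Lattice} (h : IsNodeWith C p z w) :
    IsNodeWith C p w z := by
  obtain ⟨hz, hw, hd, h⟩ := h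
  refine ⟨hw, hz, by rw [det₂_swap]; simpa using hd, ?_⟩
  rwa [Set.union_comm]

lemma IsNodeWith.exists_pos {C : Set Plane} {p : Plane} {z w : Lattice} (h : IsNodeWith C p z w) :
    ∃ z w, IsNodeWith C p z w ∧ 0 < lam (toPlane z) ∧ 0 < lam (toPlane w) ∧ 0 < det₂ z w := by
  have step : ∀ z w, IsNodeWith C p z w → ∃ z, IsNodeWith C p z w ∧ 0 < lam (toPlane z) := by
    intro z w h
    rcases (lam_toPlane_ne_zero h.1.ne_zero).lt_or_gt with h1 | h1
    · exact ⟨-z, h.neg_left, by simpa using h1⟩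
    · exact ⟨z, h, h1⟩
  obtain ⟨z, h1, hz⟩ := step _ _ h
  obtain ⟨w, h2, hw⟩ := step _ _ h1.symm
  rcases h2.2.2.1.lt_or_gt with h3 | h3
  · exact ⟨z, w, h2.symm, hz, hw, by rw [det₂_swap]; linarith⟩
  · exact ⟨w, z, h2, hw, hz, h3⟩

/-- Only the trivalent case needs thought. The three directions have sum zero and `lam` vanishes on
none of them, so two lie on the same side of the level line and the third is minus their sum: a
split if the two point up, a merge if they point down. Exchanging the two vectors normalises the
determinant to 1. -/
theorem exists_localType {C : Set Plane} (hC : IsNodalCurve C) {p : Plane} (hp : p ∈ C)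
    {U D : Finset Lattice} (hU : ∀ d, d ∈ U ↔ d ∈ upDirs C p)
    (hD : ∀ d, d ∈ D ↔ d ∈ downDirs C p) : LocalType C p U D := by
  by_cases hnode : p ∈ nodes C
  · obtain ⟨z, w, h⟩ := hnode
    obtain ⟨z, w, h, hz, hw, hdet⟩ := h.exists_pos
    have hd := h.dirs_eq
    refine .node z w h.1 h.2.1 hz hw hdet ?_ ?_ ⟨z, w, h⟩ h.nodeMultiplicity_eq
    · ext d
      simp only [hU, upDirs, hd, Set.mem_ofPred_eq, Set.mem_insert_iff, Set.mem_singleton_iff,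
        Finset.mem_insert, Finset.mem_singleton]
      constructor
      · rintro ⟨h0, rfl | rfl | rfl | rfl⟩
        · simp
        · simp at h0; linarith
        · simp
        · simp at h0; linarith
      · rintro (rfl | rfl) <;> simp [hz, hw]
    · ext d
      simp only [hD, downDirs, hd, Set.mem_ofPred_eq, Set.mem_insert_iff, Set.mem_singleton_iff,
        Finset.mem_insert, Finset.mem_singleton, neg_inj]
      constructor
      · rintro ⟨h0, h1 | rfl | h1 | rfl⟩
        · have : d = -z := by rw [← h1, neg_neg]
          subst this; simp at h0; linarith
        · simp
        · have : d = -w := by rw [← h1, neg_neg]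
          subst this; simp at h0; linarith
        · simp
      · rintro (rfl | rfl) <;> simp [hz, hw]
  · have hsm : IsSmoothAt C p := (hC.2 p hp).resolve_right hnode
    rcases hsm.exists_star with ⟨d, hd, h⟩ | ⟨d, e, hdet, h⟩
    · wlog hpos : 0 < lam (toPlane d) generalizing d
      · refine this (-d) hd.neg ?_ ?_
        · rwa [neg_neg, Set.pair_comm]
        · have := lam_toPlane_ne_zero hd.ne_zero
          simp only [toPlane_neg, lam_neg, Left.neg_pos_iff]
          exact lt_of_le_of_ne (not_lt.mp hpos) this
      have hdirs : dirs C p = {d, -d} := dirs_eq_of_star (by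
        rintro _ (rfl | rfl)
        exacts [hd, hd.neg]) h
      refine .line d hd hpos ?_ ?_ hnode (by rwa [line_eq_star])
      · ext x
        simp only [hU, upDirs, hdirs, Set.mem_ofPred_eq, Set.mem_insert_iff, Set.mem_singleton_iff,
          Finset.mem_singleton]
        constructor
        · rintro ⟨h0, rfl | rfl⟩
          · rfl
          · simp at h0; linarith
        · rintro rfl; simp [hpos]
      · ext x
        simp only [hD, downDirs, hdirs, Set.mem_ofPred_eq, Set.mem_insert_iff,
          Set.mem_singleton_iff, Finset.mem_singleton, neg_inj]
        constructor
        · rintro ⟨h0, h1 | rfl⟩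
          · have : x = -d := by rw [← h1, neg_neg]
            subst this; simp at h0; linarith
          · rfl
        · rintro rfl; simp [hpos]
    · have hde : IsUnit (det₂ e (-(d + e))) := by
        have : det₂ e (-(d + e)) = det₂ d e := by simp [det₂]; ring
        rwa [this]
      have hdirs : dirs C p = {d, e, -(d + e)} := dirs_eq_of_star (by
        have h3 : det₂ (-(d + e)) d = det₂ d e := by simp [det₂]; ring
        rintro _ (rfl | rfl | rfl)
        · exact isPrimitive_of_det₂ hdet
        · exact isPrimitive_of_det₂ hde
        · exact isPrimitive_of_det₂ (h3 ▸ hdet)) h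
      clear h hde
      -- three vectors of sum zero, two of them on the same side
      have up : ∀ a b : Lattice, det₂ a b = 1 → dirs C p = {a, b, -(a + b)} →
          0 < lam (toPlane a) → 0 < lam (toPlane b) → LocalType C p U D := by
        intro a b hab hdirs ha hb
        refine .split a b ha hb hab ?_ ?_ hnode
        · ext x
          simp only [hU, upDirs, hdirs, Set.mem_ofPred_eq, Set.mem_insert_iff,
            Set.mem_singleton_iff, Finset.mem_insert, Finset.mem_singleton]
          constructor
          · rintro ⟨h0, rfl | rfl | rfl⟩
            · simp
            · simp
            · simp at h0; linarith
          · rintro (rfl | rfl) <;> simp [ha, hb]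
        · ext x
          simp only [hD, downDirs, hdirs, Set.mem_ofPred_eq, Set.mem_insert_iff,
            Set.mem_singleton_iff, Finset.mem_singleton, neg_inj]
          constructor
          · rintro ⟨h0, h1 | h1 | h1⟩
            · have : x = -a := by rw [← h1, neg_neg]
              subst this; simp at h0; linarith
            · have : x = -b := by rw [← h1, neg_neg]
              subst this; simp at h0; linarith
            · exact h1
          · rintro rfl; simp; linarith
      have down : ∀ a b : Lattice, det₂ a b = 1 → dirs C p = {-a, -b, a + b} →
          0 < lam (toPlane a) → 0 < lam (toPlane b) → LocalType C p U D := by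
        intro a b hab hdirs ha hb
        refine .merge a b ha hb hab ?_ ?_ hnode
        · ext x
          simp only [hU, upDirs, hdirs, Set.mem_ofPred_eq, Set.mem_insert_iff,
            Set.mem_singleton_iff, Finset.mem_singleton]
          constructor
          · rintro ⟨h0, rfl | rfl | rfl⟩
            · simp at h0; linarith
            · simp at h0; linarith
            · simp
          · rintro rfl; simp; linarith
        · ext x
          simp only [hD, downDirs, hdirs, Set.mem_ofPred_eq, Set.mem_insert_iff,
            Set.mem_singleton_iff, Finset.mem_insert, Finset.mem_singleton, neg_inj]
          constructor
          · rintro ⟨h0, h1 | h1 | h1⟩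
            · exact Or.inl h1
            · exact Or.inr h1
            · have : x = -(a + b) := by rw [← h1, neg_neg]
              subst this; simp at h0; linarith
          · rintro (rfl | rfl) <;> simp [ha, hb]
      have up' : ∀ a b : Lattice, IsUnit (det₂ a b) → dirs C p = {a, b, -(a + b)} →
          0 < lam (toPlane a) → 0 < lam (toPlane b) → LocalType C p U D := by
        intro a b hab hdirs ha hb
        rcases Int.isUnit_iff.mp hab with h1 | h1
        · exact up a b h1 hdirs ha hb
        · refine up b a (by rw [det₂_swap, h1]; rfl) ?_ hb ha
          rw [hdirs, add_comm b a, Set.insert_comm]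
      have down' : ∀ a b : Lattice, IsUnit (det₂ a b) → dirs C p = {a, b, -(a + b)} →
          lam (toPlane a) < 0 → lam (toPlane b) < 0 → LocalType C p U D := by
        intro a b hab hdirs ha hb
        rcases Int.isUnit_iff.mp hab with h1 | h1
        · refine down (-a) (-b) (by rw [det₂_neg_left, det₂_neg_right, neg_neg, h1]) ?_
            (by simpa using ha) (by simpa using hb)
          rw [hdirs, neg_neg, neg_neg, neg_add]
        · refine down (-b) (-a) (by rw [det₂_neg_left, det₂_neg_right, neg_neg, det₂_swap, h1]; rfl)
            ?_ (by simpa using hb) (by simpa using ha)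
          rw [hdirs, neg_neg, neg_neg, neg_add, add_comm (-b), Set.insert_comm]
      have same : ∀ a b : Lattice, IsUnit (det₂ a b) → dirs C p = {a, b, -(a + b)} →
          0 < lam (toPlane a) * lam (toPlane b) → LocalType C p U D := by
        intro a b hab hdirs hpos
        rcases pos_and_pos_or_neg_and_neg_of_mul_pos hpos with ⟨h1, h2⟩ | ⟨h1, h2⟩
        exacts [up' a b hab hdirs h1 h2, down' a b hab hdirs h1 h2]
      have hne1 : lam (toPlane d) ≠ 0 := lam_toPlane_ne_zero (isPrimitive_of_det₂ hdet).ne_zero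
      have hdet' : IsUnit (det₂ e d) := by rw [det₂_swap]; exact hdet.neg
      have hne2 : lam (toPlane e) ≠ 0 := lam_toPlane_ne_zero (isPrimitive_of_det₂ hdet').ne_zero
      by_cases h1 : 0 < lam (toPlane d) * lam (toPlane e)
      · exact same d e hdet hdirs h1
      by_cases h2 : 0 < lam (toPlane d) * lam (toPlane (-(d + e)))
      · refine same d (-(d + e)) ?_ ?_ h2
        · have : det₂ d (-(d + e)) = -det₂ d e := by simp [det₂]; ring
          rw [this]; exact hdet.neg
        · rw [hdirs]
          have : -(d + -(d + e)) = e := by abel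
          rw [this, Set.pair_comm]
      · refine same e (-(d + e)) ?_ ?_ ?_
        · have : det₂ e (-(d + e)) = det₂ d e := by simp [det₂]; ring
          rwa [this]
        · rw [hdirs]
          have : -(e + -(d + e)) = d := by abel
          rw [this]
          ext; simp; tauto
        · simp only [toPlane_neg, toPlane_add, lam_neg, lam_add] at h2 ⊢
          have h4 : 0 < lam (toPlane d) ^ 2 := by positivity
          have h5 : 0 < lam (toPlane e) ^ 2 := by positivity
          rcases lt_or_gt_of_ne hne1 with a1 | a1 <;> rcases lt_or_gt_of_ne hne2 with a2 | a2
          · exact absurd (mul_pos_of_neg_of_neg a1 a2) h1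
          · have : 0 ≤ -(lam (toPlane d) + lam (toPlane e)) := by nlinarith
            have hne : lam (toPlane d) + lam (toPlane e) ≠ 0 := by
              intro h0
              have hz : lam (toPlane (d + e)) = 0 := by simpa using h0
              have hz' : d + e ≠ 0 := by
                intro hz'
                have : det₂ d e = 0 := by
                  rw [eq_neg_of_add_eq_zero_right hz', det₂_neg_right, det₂_self, neg_zero]
                rw [this] at hdet
                exact not_isUnit_zero hdet
              exact lam_toPlane_ne_zero hz' hz
            exact mul_pos a2 (lt_of_le_of_ne this (by intro h; apply hne; linarith))
          · have : 0 ≤ (lam (toPlane d) + lam (toPlane e)) := by nlinarith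
            have hne : lam (toPlane d) + lam (toPlane e) ≠ 0 := by
              intro h0
              have hz : lam (toPlane (d + e)) = 0 := by simpa using h0
              have hz' : d + e ≠ 0 := by
                intro hz'
                have : det₂ d e = 0 := by
                  rw [eq_neg_of_add_eq_zero_right hz', det₂_neg_right, det₂_self, neg_zero]
                rw [this] at hdet
                exact not_isUnit_zero hdet
              exact lam_toPlane_ne_zero hz' hz
            exact mul_pos_of_neg_of_neg a2 (by
              have := lt_of_le_of_ne this (Ne.symm hne); linarith)
          · exact absurd (mul_pos a1 a2) h1

end TropicalPlane

/-! ### The genus as an Euler characteristic, and its invariance under modifications -/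

namespace TropicalPlane
namespace TropicalCurve

variable (Γ : TropicalCurve.{u})

/-- Telescoping along a path from `v` to `w`. The orientation that `Quot.out` selects for an edge
affects only a sign. -/
lemma single_sub_single_mem_range (v w : Γ.V) :
    Finsupp.single w (1 : ℚ) - Finsupp.single v 1 ∈ LinearMap.range Γ.boundary := by
  induction Γ.connected v w with
  | refl => simp
  | @tail a b _ hab ih =>
    obtain ⟨e, he⟩ := hab
    have h1 : Finsupp.single b (1 : ℚ) - Finsupp.single a 1 ∈ LinearMap.range Γ.boundary := by
      have hb : Γ.boundary (Finsupp.single e 1) =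
          Finsupp.single (Quot.out (Γ.ends e)).2 1 - Finsupp.single (Quot.out (Γ.ends e)).1 1 := by
        simp [boundary]
      have hout : s((Quot.out (Γ.ends e)).1, (Quot.out (Γ.ends e)).2) = s(a, b) := by
        rw [← he]; exact Quot.out_eq _
      rcases Sym2.eq_iff.mp hout with ⟨h2, h3⟩ | ⟨h2, h3⟩
      · rw [h2, h3] at hb
        exact ⟨_, hb⟩
      · rw [h2, h3] at hb
        rw [← neg_sub, ← hb]
        exact neg_mem ⟨_, rfl⟩
    have := add_mem ih h1
    rwa [add_comm, sub_add_sub_cancel] at this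

/-- Connectedness enters here: a chain of degree zero is a combination of differences of vertices,
each of which bounds a path. Hence H₀ is one-dimensional. -/
lemma range_boundary :
    LinearMap.range Γ.boundary =
      LinearMap.ker (Finsupp.linearCombination ℚ fun _ : Γ.V => (1 : ℚ)) := by
  apply le_antisymm
  · rw [LinearMap.range_le_ker_iff]
    ext e
    simp [boundary]
  · intro f hf
    obtain ⟨v₀⟩ := Γ.nonempty
    have h0 : f.sum (fun _ c => c) = 0 := by
      simpa [Finsupp.linearCombination_apply] using hf
    have h1 : f = f.sum fun v c => c • (Finsupp.single v (1 : ℚ) - Finsupp.single v₀ 1) := by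
      simp only [smul_sub, Finsupp.smul_single, smul_eq_mul, mul_one, Finsupp.sum_sub]
      rw [Finsupp.sum_single]
      have : f.sum (fun _ c => Finsupp.single v₀ c) = Finsupp.single v₀ (f.sum fun _ c => c) := by
        simp only [Finsupp.sum]
        exact (Finsupp.single_finsetSum _ _ _).symm
      rw [this, h0]; simp
    rw [h1]
    exact Submodule.sum_mem _ fun v _ =>
      Submodule.smul_mem _ _ (Γ.single_sub_single_mem_range v₀ v)

/-- The genus of a connected graph in terms of the numbers of vertices and edges. -/
theorem genus_add_card : Γ.genus + Nat.card Γ.V = Nat.card Γ.E + 1 := by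
  have := Γ.finite_V
  have := Γ.finite_E
  have := Fintype.ofFinite Γ.V
  have := Fintype.ofFinite Γ.E
  obtain ⟨v₀⟩ := Γ.nonempty
  have h1 := LinearMap.finrank_range_add_finrank_ker Γ.boundary
  have h2 := LinearMap.finrank_range_add_finrank_ker
    (Finsupp.linearCombination ℚ fun _ : Γ.V => (1 : ℚ))
  have h3 : LinearMap.range (Finsupp.linearCombination ℚ fun _ : Γ.V => (1 : ℚ)) = ⊤ := by
    rw [LinearMap.range_eq_top]
    intro c
    exact ⟨Finsupp.single v₀ c, by simp⟩
  rw [h3, finrank_top, Module.finrank_self, Module.finrank_finsupp_self] at h2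
  rw [Module.finrank_finsupp_self, range_boundary] at h1
  rw [Nat.card_eq_fintype_card, Nat.card_eq_fintype_card, genus]
  omega

/-- Subdivisions and elementary modifications alike add one vertex and one edge, which cancel in the
Euler characteristic. -/
lemma genus_eq_of_equiv {Γ Γ' : TropicalCurve.{u}} (ν : Option Γ.V ≃ Γ'.V)
    (ε : Option Γ.E ≃ Γ'.E) : Γ'.genus = Γ.genus := by
  have := Γ.finite_V
  have := Γ.finite_E
  have h1 := Γ.genus_add_card
  have h2 := Γ'.genus_add_card
  rw [← Nat.card_congr ν, ← Nat.card_congr ε, Finite.card_option, Finite.card_option] at h2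
  omega

theorem IsModification.genus_eq {Γ Γ' : TropicalCurve.{u}} (h : Γ.IsModification Γ') :
    Γ'.genus = Γ.genus := by
  induction h with
  | refl => rfl
  | tail _ h ih =>
    rw [← ih]
    rcases h with ⟨ν, ε, _⟩ | ⟨ν, ε, _⟩ | ⟨ν, ε, _⟩
    · exact genus_eq_of_equiv ν ε
    · exact genus_eq_of_equiv ν ε
    · exact (genus_eq_of_equiv ν ε).symm

end TropicalCurve
end TropicalPlane

namespace TropicalPlane

lemma eq_smul_of_dt_eq_zero {u y : Plane} (hy : lam y ≠ 0) (h : dt u y = 0) :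
    u = (lam u / lam y) • y := by
  rw [← sub_eq_zero]
  apply eq_zero_of_dt (x := y) (y := kerVec)
  · rw [dt_swap]; simpa using hy
  · simp [h]
  · rw [dt_swap]; simp [hy]

/-! ### Plane nets -/

/-- Finitely many points and line segments (or rays, when one end is missing) with primitive
directions, oriented such that `lam` increases. -/
structure NetData where
  V : Type u
  E : Type u
  finV : Fintype V
  finE : Fintype E
  nonempty : Nonempty V
  pos : V → Plane
  /-- the lower end of an edge -/
  lo : E → Option V
  /-- the upper end of an edge -/
  hi : E → Option V
  d : E → Lattice
  /-- a point on the line that contains the edge -/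
  base : E → Plane
  prim : ∀ e, IsPrimitive (d e)
  lam_pos : ∀ e, 0 < lam (toPlane (d e))
  dt_lo : ∀ e v, lo e = some v → dt (pos v - base e) (toPlane (d e)) = 0
  dt_hi : ∀ e v, hi e = some v → dt (pos v - base e) (toPlane (d e)) = 0
  lt : ∀ e v w, lo e = some v → hi e = some w → lam (pos v) < lam (pos w)
  ends : ∀ e, lo e ≠ none ∨ hi e ≠ none

namespace NetData

attribute [instance] finV finE

/-- The relative interior of an edge. -/
def carrier (N : NetData.{u}) (e : N.E) : Set Plane :=
  {x | dt (x - N.base e) (toPlane (N.d e)) = 0 ∧ (∀ v, N.lo e = some v → lam (N.pos v) < lam x) ∧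
    ∀ v, N.hi e = some v → lam x < lam (N.pos v)}

end NetData

/-- A net that resolves the nodes of a plane curve. -/
structure Net (C : Set Plane) extends NetData.{u} where
  eq : C = Set.range pos ∪ ⋃ e, toNetData.carrier e
  disjoint : ∀ e f, e ≠ f → Disjoint (toNetData.carrier e) (toNetData.carrier f)
  notMem : ∀ v e, pos v ∉ toNetData.carrier e
  fiber_of_mem : ∀ v, pos v ∈ nodes C → {v' | pos v' = pos v}.ncard = 2
  fiber_of_notMem : ∀ v, pos v ∉ nodes C → {v' | pos v' = pos v}.ncard = 1
  nodes_subset : nodes C ⊆ Set.range pos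
  conn : ∀ h : V → ℝ, (∀ e v w, lo e = some v → hi e = some w → h v = h w) → ∀ v w, h v = h w

/-- The description of an edge of a resolution as an edge of a net. -/
structure EdgeShape {Γ : TropicalCurve.{u}} {C : Set Plane} (R : Resolution Γ C) (e : Γ.E) where
  lo : Option {v // ¬ Γ.IsInf v}
  hi : Option {v // ¬ Γ.IsInf v}
  d : Lattice
  base : Plane
  prim : IsPrimitive d
  lam_pos : 0 < lam (toPlane d)
  dt_lo : ∀ v, lo = some v → dt (R.pos v.1 - base) (toPlane d) = 0
  dt_hi : ∀ v, hi = some v → dt (R.pos v.1 - base) (toPlane d) = 0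
  lt : ∀ v w, lo = some v → hi = some w → lam (R.pos v.1) < lam (R.pos w.1)
  ends : lo ≠ none ∨ hi ≠ none
  mem_openEdge : ∀ x, x ∈ openEdge Γ R.pos R.dir e ↔ dt (x - base) (toPlane d) = 0 ∧
    (∀ v, lo = some v → lam (R.pos v.1) < lam x) ∧ ∀ v, hi = some v → lam x < lam (R.pos v.1)
  mem_ends : ∀ v, lo = some v ∨ hi = some v ↔ v.1 ∈ Γ.ends e
  eq_none_iff : lo = none ∨ hi = none ↔ ∃ w ∈ Γ.ends e, Γ.IsInf w

/-! ### The net of a resolution: orientation of the edges and removal of infinite vertices -/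

section Resolution

variable {Γ : TropicalCurve.{u}} {C : Set Plane} (R : Resolution Γ C)

lemma Resolution.mem_openEdge_ray {e : Γ.E} {v w : Γ.V} (he : Γ.ends e = s(v, w))
    (hv : ¬ Γ.IsInf v) (hw : Γ.IsInf w) (x : Plane) :
    x ∈ openEdge Γ R.pos R.dir e ↔ ∃ t : ℝ, 0 < t ∧ x = R.pos v + t • toPlane (R.dir w) := by
  constructor
  · rintro ⟨v', w', he', hv', h⟩
    rw [he] at he'
    rcases Sym2.eq_iff.mp he' with ⟨rfl, rfl⟩ | ⟨rfl, rfl⟩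
    · exact (h.resolve_left fun h => h.1 hw).2
    · exact absurd hw hv'
  · intro h
    exact ⟨v, w, he, hv, Or.inr ⟨hw, h⟩⟩

lemma Resolution.mem_openEdge_segment {e : Γ.E} {v w : Γ.V} (he : Γ.ends e = s(v, w))
    (hv : ¬ Γ.IsInf v) (hw : ¬ Γ.IsInf w) (x : Plane) :
    x ∈ openEdge Γ R.pos R.dir e ↔ x ∈ openSegment ℝ (R.pos v) (R.pos w) := by
  constructor
  · rintro ⟨v', w', he', hv', h⟩
    rw [he] at he'
    rcases Sym2.eq_iff.mp he' with ⟨rfl, rfl⟩ | ⟨rfl, rfl⟩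
    · exact (h.resolve_right fun h => hw h.1).2
    · rw [openSegment_symm]
      exact (h.resolve_right fun h => hv h.1).2
  · intro h
    exact ⟨v, w, he, hv, Or.inl ⟨hw, h⟩⟩

lemma Resolution.nonempty_edgeShape (e : Γ.E) : Nonempty (EdgeShape R e) := by
  obtain ⟨v, hve, hv⟩ := R.exists_finite_end e
  obtain ⟨w, he⟩ := Sym2.mem_iff_exists.mp hve
  by_cases hw : Γ.IsInf w
  · set δ := R.dir w with hδ
    have hprim := R.primitive_dir w hw
    rw [← hδ] at hprim
    have hmem := R.mem_openEdge_ray he hv hw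
    rw [← hδ] at hmem
    have hends : ∃ w ∈ Γ.ends e, Γ.IsInf w := ⟨w, by rw [he]; simp, hw⟩
    have hv' : ∀ u : {v // ¬ Γ.IsInf v}, some (⟨v, hv⟩ : {v // ¬ Γ.IsInf v}) = some u ↔
        u.1 ∈ Γ.ends e := by
      intro u
      rw [he, Sym2.mem_iff, Option.some_inj]
      constructor
      · rintro rfl; exact Or.inl rfl
      · rintro (h | h)
        · exact Subtype.ext h.symm
        · exact absurd (h ▸ hw) u.2
    rcases (lam_toPlane_ne_zero hprim.ne_zero).lt_or_gt with hneg | hpos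
    · refine ⟨⟨none, some ⟨v, hv⟩, -δ, R.pos v, hprim.neg, by simpa using hneg, by simp, ?_,
        by simp, by simp, ?_, by simpa using hv', by simpa using hends⟩⟩
      · rintro u hu
        obtain rfl := Option.some_inj.mp hu
        simp
      · intro x
        rw [hmem]
        simp only [toPlane_neg, reduceCtorEq, false_imp_iff, implies_true, true_and,
          Option.some.injEq, forall_eq']
        constructor
        · rintro ⟨t, ht, rfl⟩
          constructor
          · simp
          · simp; nlinarith
        · rintro ⟨h1, h2⟩
          refine ⟨lam (x - R.pos v) / lam (toPlane δ), div_pos_of_neg_of_neg (by simpa using h2) hneg,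
            ?_⟩
          rw [← eq_smul_of_dt_eq_zero hneg.ne (by simp at h1 ⊢; linarith)]; simp
    · refine ⟨⟨some ⟨v, hv⟩, none, δ, R.pos v, hprim, by simpa using hpos, ?_, by simp,
        by simp, by simp, ?_, by simpa using hv', by simpa using hends⟩⟩
      · rintro u hu
        obtain rfl := Option.some_inj.mp hu
        simp
      · intro x
        rw [hmem]
        simp only [reduceCtorEq, false_imp_iff, implies_true, and_true,
          Option.some.injEq, forall_eq']
        constructor
        · rintro ⟨t, ht, rfl⟩
          constructor
          · simp
          · simp; positivity
        · rintro ⟨h1, h2⟩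
          refine ⟨lam (x - R.pos v) / lam (toPlane δ), div_pos (by simpa using h2) hpos, ?_⟩
          rw [← eq_smul_of_dt_eq_zero hpos.ne' h1]; simp
  · have hL : 0 < (Γ.length e).toReal := by
      refine ENNReal.toReal_pos (Γ.length_pos e).ne' ?_
      rw [ne_eq, Γ.length_eq_top_iff, he]
      rintro ⟨u, hu, hu'⟩
      rcases Sym2.mem_iff.mp hu with rfl | rfl
      exacts [hv hu', hw hu']
    -- choose the orientation
    have main : ∀ v w : Γ.V, Γ.ends e = s(v, w) → ¬ Γ.IsInf v → ¬ Γ.IsInf w →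
        ∀ z, IsPrimitive z → R.pos w - R.pos v = (Γ.length e).toReal • toPlane z →
        0 < lam (toPlane z) → Nonempty (EdgeShape R e) := by
      intro v w he hv hw z hz hvw hpos
      have hw' : R.pos w = R.pos v + (Γ.length e).toReal • toPlane z := by
        rw [← hvw]; simp
      refine ⟨⟨some ⟨v, hv⟩, some ⟨w, hw⟩, z, R.pos v, hz, hpos, ?_, ?_, ?_, by simp, ?_, ?_, ?_⟩⟩
      · rintro u hu
        obtain rfl := Option.some_inj.mp hu
        simp
      · rintro u hu
        obtain rfl := Option.some_inj.mp hu
        simp [hvw]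
      · rintro u u' hu hu'
        obtain rfl := Option.some_inj.mp hu
        obtain rfl := Option.some_inj.mp hu'
        rw [hw']; simp; positivity
      · intro x
        rw [R.mem_openEdge_segment he hv hw, openSegment_eq_image']
        simp only [Option.some.injEq, forall_eq', Set.mem_image, Set.mem_Ioo]
        constructor
        · rintro ⟨t, ⟨ht0, ht1⟩, rfl⟩
          rw [hvw, hw']
          refine ⟨by simp, by simp; positivity, ?_⟩
          simp only [lam_add, lam_smul]
          have : 0 < (Γ.length e).toReal * lam (toPlane z) := by positivity
          nlinarith
        · rintro ⟨h1, h2, h3⟩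
          rw [hw'] at h3
          simp only [lam_add, lam_smul] at h3
          have h4 : 0 < (Γ.length e).toReal * lam (toPlane z) := by positivity
          refine ⟨lam (x - R.pos v) / ((Γ.length e).toReal * lam (toPlane z)),
            ⟨div_pos (by simpa using h2) h4, ?_⟩, ?_⟩
          · rw [div_lt_one h4, lam_sub]; linarith
          · rw [hvw, smul_smul]
            have : lam (x - R.pos v) / ((Γ.length e).toReal * lam (toPlane z)) *
                (Γ.length e).toReal = lam (x - R.pos v) / lam (toPlane z) := by
              field_simp
            rw [this, ← eq_smul_of_dt_eq_zero hpos.ne' h1]; simp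
      · intro u
        rw [he, Sym2.mem_iff, Option.some_inj, Option.some_inj]
        constructor
        · rintro (rfl | rfl) <;> simp
        · rintro (h | h)
          · exact Or.inl (Subtype.ext h.symm)
          · exact Or.inr (Subtype.ext h.symm)
      · simp only [reduceCtorEq, or_self, false_iff, not_exists, not_and, he, Sym2.mem_iff]
        rintro u (rfl | rfl)
        exacts [hv, hw]
    obtain ⟨z, hz, hvw⟩ := R.length_eq e v w he hv hw
    rcases (lam_toPlane_ne_zero hz.ne_zero).lt_or_gt with hneg | hpos
    · refine main w v (by rw [he, Sym2.eq_swap]) hw hv (-z) hz.neg ?_ (by simpa using hneg)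
      rw [← neg_sub, hvw]; simp
    · exact main v w he hv hw z hz hvw hpos

/-- The net underlying a resolution. -/
noncomputable def Resolution.netData : NetData.{u} :=
  let s : ∀ e, EdgeShape R e := fun e => (R.nonempty_edgeShape e).some
  have := Γ.finite_V
  have := Γ.finite_E
  { V := {v // ¬ Γ.IsInf v}
    E := Γ.E
    finV := Fintype.ofFinite _
    finE := Fintype.ofFinite _
    nonempty := by
      obtain ⟨v⟩ := Γ.nonempty
      by_cases hv : Γ.IsInf v
      · have h := Γ.degree_of_isInf v hv
        have : {e | v ∈ Γ.ends e}.Nonempty ∨ {e | Γ.ends e = s(v, v)}.Nonempty := by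
          by_contra! h'
          rw [h'.1, h'.2] at h
          simp at h
        obtain ⟨e, -⟩ | ⟨e, -⟩ := this <;>
        · obtain ⟨w, -, hw⟩ := R.exists_finite_end e
          exact ⟨⟨w, hw⟩⟩
      · exact ⟨⟨v, hv⟩⟩
    pos := fun v => R.pos v.1
    lo := fun e => (s e).lo
    hi := fun e => (s e).hi
    d := fun e => (s e).d
    base := fun e => (s e).base
    prim := fun e => (s e).prim
    lam_pos := fun e => (s e).lam_pos
    dt_lo := fun e => (s e).dt_lo
    dt_hi := fun e => (s e).dt_hi
    lt := fun e => (s e).lt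
    ends := fun e => (s e).ends }

lemma Resolution.netData_mem_ends (e : Γ.E) (v : {v // ¬ Γ.IsInf v}) :
    R.netData.lo e = some v ∨ R.netData.hi e = some v ↔ v.1 ∈ Γ.ends e :=
  (R.nonempty_edgeShape e).some.mem_ends v

lemma Resolution.netData_eq_none_iff (e : Γ.E) :
    R.netData.lo e = none ∨ R.netData.hi e = none ↔ ∃ w ∈ Γ.ends e, Γ.IsInf w :=
  (R.nonempty_edgeShape e).some.eq_none_iff

lemma Resolution.netData_carrier (e : Γ.E) :
    R.netData.carrier e = openEdge Γ R.pos R.dir e := by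
  ext x
  exact ((R.nonempty_edgeShape e).some.mem_openEdge x).symm

lemma TropicalCurve.existsUnique_edge_of_isInf {v : Γ.V} (hv : Γ.IsInf v) :
    ∃! e, v ∈ Γ.ends e := by
  have := Γ.finite_E
  have h := Γ.degree_of_isInf v hv
  have h1 : {e | Γ.ends e = s(v, v)} ⊆ {e | v ∈ Γ.ends e} := by
    intro e (he : Γ.ends e = s(v, v))
    change v ∈ Γ.ends e
    rw [he]; simp
  have h2 := Set.ncard_le_ncard h1 (Set.toFinite _)
  have h3 : {e | v ∈ Γ.ends e}.ncard = 1 := by omega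
  obtain ⟨e, he⟩ := Set.ncard_eq_one.mp h3
  refine ⟨e, ?_, fun f hf => ?_⟩
  · have : e ∈ {e | v ∈ Γ.ends e} := by rw [he]; rfl
    exact this
  · have : f ∈ {e | v ∈ Γ.ends e} := hf
    rw [he] at this; exact this

lemma Resolution.netData_exists_lo_hi {e : Γ.E} {a b : Γ.V} (he : Γ.ends e = s(a, b))
    (ha : ¬ Γ.IsInf a) (hb : ¬ Γ.IsInf b) :
    (R.netData.lo e = some ⟨a, ha⟩ ∧ R.netData.hi e = some ⟨b, hb⟩) ∨
    (R.netData.lo e = some ⟨b, hb⟩ ∧ R.netData.hi e = some ⟨a, ha⟩) := by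
  have h1 : ¬ (R.netData.lo e = none ∨ R.netData.hi e = none) := by
    rw [R.netData_eq_none_iff, he]
    rintro ⟨w, hw, hw'⟩
    rcases Sym2.mem_iff.mp hw with rfl | rfl
    exacts [ha hw', hb hw']
  rw [not_or] at h1
  obtain ⟨v, hv⟩ := Option.ne_none_iff_exists'.mp h1.1
  obtain ⟨w, hw⟩ := Option.ne_none_iff_exists'.mp h1.2
  have hlt := R.netData.lt e v w hv hw
  have hvw : v ≠ w := by rintro rfl; exact lt_irrefl _ hlt
  have hv' := (R.netData_mem_ends e v).mp (Or.inl hv)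
  have hw' := (R.netData_mem_ends e w).mp (Or.inr hw)
  rw [he, Sym2.mem_iff] at hv' hw'
  rw [hv, hw]
  rcases hv' with h | h <;> rcases hw' with h' | h'
  · exact absurd (Subtype.ext (h.trans h'.symm)) hvw
  · exact Or.inl ⟨congrArg some (Subtype.ext h), congrArg some (Subtype.ext h')⟩
  · exact Or.inr ⟨congrArg some (Subtype.ext h), congrArg some (Subtype.ext h')⟩
  · exact absurd (Subtype.ext (h.trans h'.symm)) hvw

/-- Infinite vertices are leaves, so their removal does not disconnect the graph. Concretely, `h`
extends to them by its value at the unique neighbour and is then constant along every path of the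
whole graph. -/
lemma Resolution.netData_conn (h : {v // ¬ Γ.IsInf v} → ℝ)
    (hh : ∀ e v w, R.netData.lo e = some v → R.netData.hi e = some w → h v = h w)
    (v w : {v // ¬ Γ.IsInf v}) : h v = h w := by
  classical
  have hex : ∀ a : Γ.V, Γ.IsInf a → ∃ r : ℝ, ∀ (b : Γ.V) (hb : ¬ Γ.IsInf b) e,
      Γ.ends e = s(a, b) → h ⟨b, hb⟩ = r := by
    intro a ha
    obtain ⟨e, he, huniq⟩ := Γ.existsUnique_edge_of_isInf ha
    obtain ⟨b, hb⟩ := Sym2.mem_iff_exists.mp he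
    by_cases hbi : Γ.IsInf b
    -- The value 0 is arbitrary: there is no finite neighbour in this case.
    · refine ⟨0, fun b' hb' e' he' => ?_⟩
      have := huniq e' (by simp only [he']; simp)
      subst this
      rw [hb] at he'
      rcases Sym2.eq_iff.mp he' with ⟨-, rfl⟩ | ⟨rfl, -⟩
      exacts [absurd hbi hb', absurd ha hb']
    · refine ⟨h ⟨b, hbi⟩, fun b' hb' e' he' => ?_⟩
      have := huniq e' (by simp only [he']; simp)
      subst this
      rw [hb] at he'
      rcases Sym2.eq_iff.mp he' with ⟨-, rfl⟩ | ⟨rfl, -⟩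
      exacts [rfl, absurd ha hb']
  choose r hr using hex
  let k : Γ.V → ℝ := fun a => if ha : Γ.IsInf a then r a ha else h ⟨a, ha⟩
  have key : ∀ a b e, Γ.ends e = s(a, b) → k a = k b := by
    intro a b e he
    by_cases ha : Γ.IsInf a <;> by_cases hb : Γ.IsInf b
    · obtain ⟨v, hv, hv'⟩ := R.exists_finite_end e
      rw [he, Sym2.mem_iff] at hv
      rcases hv with rfl | rfl
      exacts [absurd ha hv', absurd hb hv']
    · simp only [k, dif_pos ha, dif_neg hb]
      exact (hr a ha b hb e he).symm
    · simp only [k, dif_neg ha, dif_pos hb]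
      exact hr b hb a ha e (by rw [he, Sym2.eq_swap])
    · simp only [k, dif_neg ha, dif_neg hb]
      rcases R.netData_exists_lo_hi he ha hb with ⟨h1, h2⟩ | ⟨h1, h2⟩
      · exact hh e _ _ h1 h2
      · exact (hh e _ _ h1 h2).symm
  have hconn : ∀ a b, k a = k b := by
    intro a b
    induction Γ.connected a b with
    | refl => rfl
    | tail _ h ih =>
      obtain ⟨e, he⟩ := h
      exact ih.trans (key _ _ e he)
  have := hconn v.1 w.1
  simpa only [k, dif_neg v.2, dif_neg w.2] using this

/-- The net of a resolution of a plane curve. -/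
noncomputable def Resolution.net : Net.{u} C where
  toNetData := R.netData
  eq := by
    conv_lhs => rw [R.image_eq]
    congr 1
    · ext x
      constructor
      · rintro ⟨v, hv, rfl⟩
        exact ⟨⟨v, hv⟩, rfl⟩
      · rintro ⟨v, rfl⟩
        exact ⟨v.1, v.2, rfl⟩
    · exact Set.iUnion_congr fun e => (R.netData_carrier e).symm
  disjoint := by
    have : ∀ e f : Γ.E, e ≠ f → Disjoint (R.netData.carrier e) (R.netData.carrier f) := by
      intro e f hef
      rw [R.netData_carrier, R.netData_carrier]
      exact R.disjoint_edges e f hef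
    exact this
  notMem := by
    have : ∀ (v : {v // ¬ Γ.IsInf v}) (e : Γ.E), R.netData.pos v ∉ R.netData.carrier e := by
      intro v e
      rw [R.netData_carrier]
      exact R.vertex_notMem_edge v.1 e v.2
    exact this
  fiber_of_mem v hv := by
    obtain ⟨z, w, -, a, b, hab, heq, -⟩ := R.resolves_nodes _ hv
    have ha : a ∈ ({a, b} : Set Γ.V) := by simp
    have hb : b ∈ ({a, b} : Set Γ.V) := by simp
    rw [← heq] at ha hb
    rw [Set.ncard_eq_two]
    refine ⟨⟨a, ha.1⟩, ⟨b, hb.1⟩, fun h => hab (congrArg Subtype.val h), ?_⟩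
    ext u
    constructor
    · intro hu
      have : u.1 ∈ ({a, b} : Set Γ.V) := by rw [← heq]; exact ⟨u.2, hu⟩
      rcases this with h | h
      exacts [Or.inl (Subtype.ext h), Or.inr (Subtype.ext h)]
    · rintro (rfl | rfl)
      exacts [ha.2, hb.2]
  fiber_of_notMem v hv := by
    rw [Set.ncard_eq_one]
    refine ⟨v, ?_⟩
    ext u
    constructor
    · intro hu
      have hu : R.pos u.1 = R.pos v.1 := hu
      exact Subtype.ext (R.vertex_unique u.1 v.1 u.2 v.2 hu (hu ▸ hv))
    · rintro rfl; rfl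
  nodes_subset p hp := by
    obtain ⟨z, w, -, a, b, hab, heq, -⟩ := R.resolves_nodes _ hp
    have ha : a ∈ ({a, b} : Set Γ.V) := by simp
    rw [← heq] at ha
    exact ⟨⟨a, ha.1⟩, ha.2⟩
  conn := R.netData_conn

/-- The genus in terms of the numbers of vertices and edges of the net. -/
lemma Resolution.genus_add_card_net :
    Γ.genus + Nat.card R.net.V + Nat.card {e // R.net.lo e = none} +
      Nat.card {e // R.net.hi e = none} = Nat.card R.net.E + 1 := by
  classical
  have := Γ.finite_V
  have := Γ.finite_E
  have h1 := Γ.genus_add_card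
  have h2 : Nat.card Γ.V = Nat.card {v // Γ.IsInf v} + Nat.card {v // ¬ Γ.IsInf v} := by
    rw [← Nat.card_sum, Nat.card_congr (Equiv.sumCompl Γ.IsInf)]
  -- An infinite vertex corresponds to its only edge. Two of them cannot share an edge, since every
  -- edge of a resolution has a finite end.
  have h3 : Nat.card {v // Γ.IsInf v} =
      Nat.card {e // R.netData.lo e = none ∨ R.netData.hi e = none} := by
    refine Nat.card_congr (Equiv.ofBijective
      (fun v => ⟨(Γ.existsUnique_edge_of_isInf v.2).choose, (R.netData_eq_none_iff _).mpr
        ⟨v.1, (Γ.existsUnique_edge_of_isInf v.2).choose_spec.1, v.2⟩⟩) ⟨?_, ?_⟩)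
    · intro v w hvw
      have hvw := congrArg Subtype.val hvw
      simp only at hvw
      have hv := (Γ.existsUnique_edge_of_isInf v.2).choose_spec.1
      have hw := (Γ.existsUnique_edge_of_isInf w.2).choose_spec.1
      simp only at hv hw
      rw [← hvw] at hw
      generalize (Γ.existsUnique_edge_of_isInf v.2).choose = e at hv hw
      obtain ⟨u, hu, hu'⟩ := R.exists_finite_end e
      obtain ⟨u', he⟩ := Sym2.mem_iff_exists.mp hu
      rw [he, Sym2.mem_iff] at hv hw
      rcases hv with hv | hv
      · exact absurd (hv ▸ v.2) hu'
      rcases hw with hw | hw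
      · exact absurd (hw ▸ w.2) hu'
      exact Subtype.ext (hv.trans hw.symm)
    · rintro ⟨e, he⟩
      obtain ⟨w, hw, hw'⟩ := (R.netData_eq_none_iff e).mp he
      exact ⟨⟨w, hw'⟩, Subtype.ext
        ((Γ.existsUnique_edge_of_isInf hw').choose_spec.2 e hw).symm⟩
  have h4 : Nat.card {e // R.netData.lo e = none ∨ R.netData.hi e = none} =
      Nat.card {e // R.netData.lo e = none} + Nat.card {e // R.netData.hi e = none} := by
    have hdisj : Disjoint (fun e => R.netData.lo e = none) (fun e => R.netData.hi e = none) := by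
      rw [Pi.disjoint_iff]
      intro e
      rw [Prop.disjoint_iff]
      rintro ⟨a, b⟩
      rcases R.netData.ends e with h | h
      exacts [h a, h b]
    rw [← Nat.card_sum]
    exact Nat.card_congr (subtypeOrEquiv _ _ hdisj)
  change Γ.genus + Nat.card {v // ¬ Γ.IsInf v} + Nat.card {e // R.netData.lo e = none} +
    Nat.card {e // R.netData.hi e = none} = Nat.card Γ.E + 1
  omega

end Resolution

end TropicalPlane

/-! ### Edges of a net at a level and at a point; balancing -/

namespace TropicalPlane

@[simp] lemma toPlane_sum {ι : Type*} (s : Finset ι) (f : ι → Lattice) :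
    toPlane (∑ i ∈ s, f i) = ∑ i ∈ s, toPlane (f i) := by
  classical
  induction s using Finset.induction_on with
  | empty => simp
  | insert a s ha ih => rw [Finset.sum_insert ha, Finset.sum_insert ha, toPlane_add, ih]

lemma dt_sum_right {ι : Type*} (s : Finset ι) (f : ι → Plane) (y : Plane) :
    dt y (∑ i ∈ s, f i) = ∑ i ∈ s, dt y (f i) := by
  classical
  induction s using Finset.induction_on with
  | empty => simp
  | insert a s ha ih => rw [Finset.sum_insert ha, Finset.sum_insert ha, dt_add_right, ih]

lemma IsPrimitive.eq_of_dt {d e : Lattice} (hd : IsPrimitive d) (he : IsPrimitive e)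
    (hd' : 0 < lam (toPlane d)) (he' : 0 < lam (toPlane e))
    (h : dt (toPlane d) (toPlane e) = 0) : d = e :=
  hd.eq_of_smul_eq he one_pos (div_pos hd' he').le
    (by rw [one_smul]; exact eq_smul_of_dt_eq_zero he'.ne' h)

lemma sub_eq_smul_kerVec {x q : Plane} (h : lam x = lam q) : x - q = (q 1 - x 1) • kerVec := by
  have := eq_smul_kerVec (v := x - q) (by rw [lam_sub, h, sub_self])
  rw [this]; simp [kerVec]

namespace NetData

variable (N : NetData.{u})

/-- The affine function that vanishes on an edge and is positive to the right of it. -/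
noncomputable def aff (e : N.E) (x : Plane) : ℝ := dt (x - N.base e) (toPlane (N.d e))

/-- The edge meets the level `K` or starts there. -/
def ActUp (e : N.E) (K : ℝ) : Prop :=
  (∀ v, N.lo e = some v → lam (N.pos v) ≤ K) ∧ ∀ v, N.hi e = some v → K < lam (N.pos v)

/-- The edge meets the level `K` or ends there. -/
def ActDown (e : N.E) (K : ℝ) : Prop :=
  (∀ v, N.lo e = some v → lam (N.pos v) < K) ∧ ∀ v, N.hi e = some v → K ≤ lam (N.pos v)

/-- The edge meets the level `K` in its relative interior. -/
def Act (e : N.E) (K : ℝ) : Prop :=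
  (∀ v, N.lo e = some v → lam (N.pos v) < K) ∧ ∀ v, N.hi e = some v → K < lam (N.pos v)

lemma mem_carrier {e : N.E} {x : Plane} : x ∈ N.carrier e ↔ N.aff e x = 0 ∧ N.Act e (lam x) :=
  Iff.rfl

lemma Act.actUp {N : NetData.{u}} {e : N.E} {K : ℝ} (h : N.Act e K) : N.ActUp e K :=
  ⟨fun v hv => (h.1 v hv).le, h.2⟩

lemma Act.actDown {N : NetData.{u}} {e : N.E} {K : ℝ} (h : N.Act e K) : N.ActDown e K :=
  ⟨h.1, fun v hv => (h.2 v hv).le⟩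

lemma aff_add (e : N.E) (x v : Plane) : N.aff e (x + v) = N.aff e x + dt v (toPlane (N.d e)) := by
  simp [aff]; ring

lemma aff_eq_of_aff_eq_zero {e : N.E} {q : Plane} (h : N.aff e q = 0) (x : Plane) :
    N.aff e x = dt (x - q) (toPlane (N.d e)) := by
  have := N.aff_add e q (x - q)
  rw [add_sub_cancel, h, zero_add] at this
  exact this

/-- There are finitely many vertices, so for `K'` near `K` none has its level strictly between the
two. The edges seen just above `K` are those that are active upwards at `K`, and just below `K`
those that are active downwards. -/
lemma eventually_act (K : ℝ) : ∀ᶠ K' in 𝓝 K, ∀ e : N.E,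
    (K ≤ K' → (N.ActUp e K' ↔ N.ActUp e K)) ∧ (K' < K → (N.ActUp e K' ↔ N.ActDown e K)) ∧
    (K < K' → (N.Act e K' ↔ N.ActUp e K)) ∧ (K' < K → (N.Act e K' ↔ N.ActDown e K)) := by
  have h1 : ∀ᶠ K' in 𝓝 K, ∀ v : N.V, (lam (N.pos v) < K → lam (N.pos v) < K') ∧
      (K < lam (N.pos v) → K' < lam (N.pos v)) := by
    rw [Filter.eventually_all]
    intro v
    refine Filter.Eventually.and ?_ ?_
    · by_cases h : lam (N.pos v) < K
      · filter_upwards [lt_mem_nhds h] with K' h' _ using h'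
      · exact Filter.Eventually.of_forall fun _ h' => absurd h' h
    · by_cases h : K < lam (N.pos v)
      · filter_upwards [gt_mem_nhds h] with K' h' _ using h'
      · exact Filter.Eventually.of_forall fun _ h' => absurd h' h
  filter_upwards [h1] with K' h e
  refine ⟨fun hK => ?_, fun hK => ?_, fun hK => ?_, fun hK => ?_⟩
  · refine and_congr (forall₂_congr fun v _ => ?_) (forall₂_congr fun v _ => ?_)
    · exact ⟨fun h' => not_lt.mp fun h2 => absurd h' (not_le.mpr ((h v).2 h2)), fun h' => h'.trans hK⟩
    · exact ⟨fun h' => hK.trans_lt h', (h v).2⟩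
  · refine and_congr (forall₂_congr fun v _ => ?_) (forall₂_congr fun v _ => ?_)
    · exact ⟨fun h' => h'.trans_lt hK, fun h' => ((h v).1 h').le⟩
    · exact ⟨fun h' => not_lt.mp fun h2 => absurd h' (not_lt.mpr ((h v).1 h2).le),
        fun h' => hK.trans_le h'⟩
  · refine and_congr (forall₂_congr fun v _ => ?_) (forall₂_congr fun v _ => ?_)
    · exact ⟨fun h' => not_lt.mp fun h2 => absurd h' (not_lt.mpr ((h v).2 h2).le),
        fun h' => h'.trans_lt hK⟩
    · exact ⟨fun h' => hK.trans h', (h v).2⟩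
  · refine and_congr (forall₂_congr fun v _ => ?_) (forall₂_congr fun v _ => ?_)
    · exact ⟨fun h' => h'.trans hK, fun h' => (h v).1 h'⟩
    · exact ⟨fun h' => not_lt.mp fun h2 => absurd h' (not_lt.mpr ((h v).1 h2).le),
        fun h' => hK.trans_le h'⟩

open Classical in
/-- The edges that leave `x` upwards. -/
noncomputable def upEdges (x : Plane) : Finset N.E :=
  Finset.univ.filter fun e => N.aff e x = 0 ∧ N.ActUp e (lam x)

open Classical in
/-- The edges that leave `x` downwards. -/
noncomputable def downEdges (x : Plane) : Finset N.E :=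
  Finset.univ.filter fun e => N.aff e x = 0 ∧ N.ActDown e (lam x)

open Classical in
/-- The directions of the edges that leave `x` upwards. -/
noncomputable def up (x : Plane) : Finset Lattice := (N.upEdges x).image N.d

open Classical in
/-- The opposites of the directions of the edges that leave `x` downwards. -/
noncomputable def down (x : Plane) : Finset Lattice := (N.downEdges x).image N.d

lemma mem_upEdges {e : N.E} {x : Plane} :
    e ∈ N.upEdges x ↔ N.aff e x = 0 ∧ N.ActUp e (lam x) := by simp [upEdges]

lemma mem_downEdges {e : N.E} {x : Plane} :
    e ∈ N.downEdges x ↔ N.aff e x = 0 ∧ N.ActDown e (lam x) := by simp [downEdges]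

lemma tendsto_lam_add_smul (x v : Plane) :
    Filter.Tendsto (fun t : ℝ => lam (x + t • v)) (𝓝[>] (0 : ℝ)) (𝓝 (lam x)) :=
  (continuous_lam.tendsto x).comp (tendsto_add_smul x v)

lemma eventually_mem_carrier_up {e : N.E} {x : Plane} (h : e ∈ N.upEdges x) :
    ∀ᶠ t in 𝓝[>] (0 : ℝ), x + t • toPlane (N.d e) ∈ N.carrier e := by
  obtain ⟨h1, h2⟩ := N.mem_upEdges.mp h
  filter_upwards [(tendsto_lam_add_smul x (toPlane (N.d e))).eventually (N.eventually_act (lam x)),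
    self_mem_nhdsWithin] with t ht ht0
  rw [mem_carrier]
  refine ⟨by simp [aff_add, h1], ((ht e).2.2.1 ?_).mpr h2⟩
  have : 0 < t * lam (toPlane (N.d e)) := mul_pos ht0 (N.lam_pos e)
  simpa using this

lemma eventually_mem_carrier_down {e : N.E} {x : Plane} (h : e ∈ N.downEdges x) :
    ∀ᶠ t in 𝓝[>] (0 : ℝ), x + t • toPlane (-N.d e) ∈ N.carrier e := by
  obtain ⟨h1, h2⟩ := N.mem_downEdges.mp h
  filter_upwards [(tendsto_lam_add_smul x (toPlane (-N.d e))).eventually (N.eventually_act (lam x)),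
    self_mem_nhdsWithin] with t ht ht0
  rw [mem_carrier]
  refine ⟨by simp [aff_add, h1], ((ht e).2.2.2 ?_).mpr h2⟩
  have : 0 < t * lam (toPlane (N.d e)) := mul_pos ht0 (N.lam_pos e)
  simp; linarith

end NetData

namespace Net

variable {C : Set Plane} (N : Net.{u} C)

lemma mem_iff {x : Plane} : x ∈ C ↔ (∃ v, N.pos v = x) ∨ ∃ e, x ∈ N.carrier e := by
  conv_lhs => rw [N.eq]
  simp

lemma eq_of_mem_carrier {e f : N.E} {x : Plane} (he : x ∈ N.carrier e) (hf : x ∈ N.carrier f) :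
    e = f := by
  by_contra h
  exact Set.disjoint_left.mp (N.disjoint e f h) he hf

/-- Two edges leaving `x` in the same direction would overlap near `x`, against disjointness. Sums
over edges at a point can thus be replaced by sums over directions, which depend on the curve only.
-/
lemma injOn_up (x : Plane) : Set.InjOn N.d (N.upEdges x : Set N.E) := by
  intro e he f hf h
  have h1 := N.eventually_mem_carrier_up (Finset.mem_coe.mp he)
  have h2 := N.eventually_mem_carrier_up (Finset.mem_coe.mp hf)
  rw [h] at h1
  obtain ⟨t, ht1, ht2⟩ := (h1.and h2).exists
  exact N.eq_of_mem_carrier ht1 ht2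

lemma injOn_down (x : Plane) : Set.InjOn N.d (N.downEdges x : Set N.E) := by
  intro e he f hf h
  have h1 := N.eventually_mem_carrier_down (Finset.mem_coe.mp he)
  have h2 := N.eventually_mem_carrier_down (Finset.mem_coe.mp hf)
  rw [h] at h1
  obtain ⟨t, ht1, ht2⟩ := (h1.and h2).exists
  exact N.eq_of_mem_carrier ht1 ht2

/-- A direction in which the curve leaves a point is the direction of an edge. -/
lemma exists_edge_of_mem_dirs {x : Plane} {δ : Lattice} (h : δ ∈ dirs C x) :
    ∃ e, N.aff e x = 0 ∧ dt (toPlane δ) (toPlane (N.d e)) = 0 ∧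
      ∃ᶠ t in 𝓝[>] (0 : ℝ), x + t • toPlane δ ∈ N.carrier e := by
  obtain ⟨hδ, hev⟩ := h
  have h1 : ∀ v : N.V, ∀ᶠ t in 𝓝[>] (0 : ℝ), x + t • toPlane δ ≠ N.pos v := by
    intro v
    by_cases hv : N.pos v = x
    · filter_upwards [self_mem_nhdsWithin] with t ht h
      rw [hv] at h
      have h2 : t • toPlane δ = 0 := by simpa using h
      rcases smul_eq_zero.mp h2 with h3 | h3
      · exact (ne_of_gt ht) h3
      · exact hδ.ne_zero (toPlane_eq_zero.mp h3)
    · exact (tendsto_add_smul x (toPlane δ)).eventually_ne (Ne.symm hv)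
  have h2 : ∃ e, ∃ᶠ t in 𝓝[>] (0 : ℝ), x + t • toPlane δ ∈ N.carrier e := by
    by_contra! h2
    have h3 : ∀ᶠ t in 𝓝[>] (0 : ℝ), ∀ e, x + t • toPlane δ ∉ N.carrier e :=
      Filter.eventually_all.mpr h2
    obtain ⟨t, ht1, ht2, ht3⟩ := (hev.and ((Filter.eventually_all.mpr h1).and h3)).exists
    rcases N.mem_iff.mp ht1 with ⟨v, hv⟩ | ⟨e, he⟩
    · exact ht2 v hv.symm
    · exact ht3 e he
  obtain ⟨e, he⟩ := h2
  have hpos : ∀ᶠ t in 𝓝[>] (0 : ℝ), 0 < t := self_mem_nhdsWithin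
  -- Two distinct points of the ray on the same edge force the ray to be parallel to this edge.
  obtain ⟨t₁, ht₁, h0⟩ := (he.and_eventually hpos).exists
  have hlt : ∀ᶠ t in 𝓝[>] (0 : ℝ), t < t₁ := mem_nhdsWithin_of_mem_nhds (gt_mem_nhds h0)
  obtain ⟨t₂, ht₂, hlt⟩ := (he.and_eventually hlt).exists
  have e1 := (N.mem_carrier.mp ht₁).1
  have e2 := (N.mem_carrier.mp ht₂).1
  rw [N.aff_add, dt_smul_left] at e1 e2
  have h3 : dt (toPlane δ) (toPlane (N.d e)) = 0 := by
    have : (t₁ - t₂) * dt (toPlane δ) (toPlane (N.d e)) = 0 := by linear_combination e1 - e2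
    exact (mul_eq_zero.mp this).resolve_left (by linarith)
  exact ⟨e, by simpa [h3] using e1, h3, he⟩

lemma mem_up (x : Plane) (δ : Lattice) : δ ∈ N.up x ↔ δ ∈ upDirs C x := by
  simp only [NetData.up, Finset.mem_image]
  constructor
  · rintro ⟨e, he, rfl⟩
    refine ⟨N.lam_pos e, N.prim e, ?_⟩
    filter_upwards [N.eventually_mem_carrier_up he] with t ht
    exact N.mem_iff.mpr (Or.inr ⟨e, ht⟩)
  · rintro ⟨hpos, h⟩
    obtain ⟨e, h1, h2, h3⟩ := N.exists_edge_of_mem_dirs h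
    refine ⟨e, N.mem_upEdges.mpr ⟨h1, ?_⟩, ((h.1.eq_of_dt (N.prim e) hpos (N.lam_pos e) h2)).symm⟩
    have h4 : ∀ᶠ t in 𝓝[>] (0 : ℝ), 0 < t := self_mem_nhdsWithin
    obtain ⟨t, ht1, ht2, ht3⟩ := (h3.and_eventually
      (((NetData.tendsto_lam_add_smul x (toPlane δ)).eventually (N.eventually_act (lam x))).and
        h4)).exists
    refine ((ht2 e).2.2.1 ?_).mp (N.mem_carrier.mp ht1).2
    have : 0 < t * lam (toPlane δ) := mul_pos ht3 hpos
    simpa using this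

lemma mem_down (x : Plane) (δ : Lattice) : δ ∈ N.down x ↔ δ ∈ downDirs C x := by
  simp only [NetData.down, Finset.mem_image]
  constructor
  · rintro ⟨e, he, rfl⟩
    refine ⟨N.lam_pos e, (N.prim e).neg, ?_⟩
    filter_upwards [N.eventually_mem_carrier_down he] with t ht
    exact N.mem_iff.mpr (Or.inr ⟨e, ht⟩)
  · rintro ⟨hpos, h⟩
    obtain ⟨e, h1, h2, h3⟩ := N.exists_edge_of_mem_dirs h
    have hδ : IsPrimitive δ := by simpa using h.1.neg
    refine ⟨e, N.mem_downEdges.mpr ⟨h1, ?_⟩,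
      ((hδ.eq_of_dt (N.prim e) hpos (N.lam_pos e) (by simpa using h2))).symm⟩
    have h4 : ∀ᶠ t in 𝓝[>] (0 : ℝ), 0 < t := self_mem_nhdsWithin
    obtain ⟨t, ht1, ht2, ht3⟩ := (h3.and_eventually
      (((NetData.tendsto_lam_add_smul x (toPlane (-δ))).eventually
        (N.eventually_act (lam x))).and h4)).exists
    refine ((ht2 e).2.2.2 ?_).mp (N.mem_carrier.mp ht1).2
    have : 0 < t * lam (toPlane δ) := mul_pos ht3 hpos
    simp; linarith

lemma eq_pos_or_mem_carrier_of_up {e : N.E} {x : Plane} (he : e ∈ N.upEdges x) :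
    (∃ v, N.lo e = some v ∧ N.pos v = x) ∨ x ∈ N.carrier e := by
  obtain ⟨h1, h2⟩ := N.mem_upEdges.mp he
  by_cases h : N.Act e (lam x)
  · exact Or.inr ⟨h1, h⟩
  · left
    have : ∃ v, N.lo e = some v ∧ lam (N.pos v) = lam x := by
      by_contra! h3
      exact h ⟨fun v hv => lt_of_le_of_ne (h2.1 v hv) (h3 v hv), h2.2⟩
    obtain ⟨v, hv, hv'⟩ := this
    refine ⟨v, hv, ?_⟩
    have h4 := N.aff_eq_of_aff_eq_zero h1 (N.pos v)
    rw [show N.aff e (N.pos v) = 0 from N.dt_lo e v hv] at h4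
    have h5 := eq_smul_of_dt_eq_zero (N.lam_pos e).ne' h4.symm
    rw [lam_sub, hv', sub_self, zero_div, zero_smul] at h5
    exact sub_eq_zero.mp h5

lemma eq_pos_or_mem_carrier_of_down {e : N.E} {x : Plane} (he : e ∈ N.downEdges x) :
    (∃ v, N.hi e = some v ∧ N.pos v = x) ∨ x ∈ N.carrier e := by
  obtain ⟨h1, h2⟩ := N.mem_downEdges.mp he
  by_cases h : N.Act e (lam x)
  · exact Or.inr ⟨h1, h⟩
  · left
    have : ∃ v, N.hi e = some v ∧ lam (N.pos v) = lam x := by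
      by_contra! h3
      exact h ⟨h2.1, fun v hv => lt_of_le_of_ne (h2.2 v hv) (h3 v hv).symm⟩
    obtain ⟨v, hv, hv'⟩ := this
    refine ⟨v, hv, ?_⟩
    have h4 := N.aff_eq_of_aff_eq_zero h1 (N.pos v)
    rw [show N.aff e (N.pos v) = 0 from N.dt_hi e v hv] at h4
    have h5 := eq_smul_of_dt_eq_zero (N.lam_pos e).ne' h4.symm
    rw [lam_sub, hv', sub_self, zero_div, zero_smul] at h5
    exact sub_eq_zero.mp h5

lemma up_eq_empty {x : Plane} (hx : x ∉ C) : N.up x = ∅ := by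
  rw [NetData.up, Finset.image_eq_empty, Finset.eq_empty_iff_forall_notMem]
  intro e he
  apply hx
  rw [N.mem_iff]
  rcases N.eq_pos_or_mem_carrier_of_up he with ⟨v, -, hv⟩ | h
  exacts [Or.inl ⟨v, hv⟩, Or.inr ⟨e, h⟩]

lemma down_eq_empty {x : Plane} (hx : x ∉ C) : N.down x = ∅ := by
  rw [NetData.down, Finset.image_eq_empty, Finset.eq_empty_iff_forall_notMem]
  intro e he
  apply hx
  rw [N.mem_iff]
  rcases N.eq_pos_or_mem_carrier_of_down he with ⟨v, -, hv⟩ | h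
  exacts [Or.inl ⟨v, hv⟩, Or.inr ⟨e, h⟩]

lemma up_eq_of_mem_carrier {x : Plane} {e : N.E} (hx : x ∈ N.carrier e) : N.up x = {N.d e} := by
  have : N.upEdges x = {e} := by
    ext f
    rw [Finset.mem_singleton]
    constructor
    · intro hf
      rcases N.eq_pos_or_mem_carrier_of_up hf with ⟨v, -, hv⟩ | h
      · exact absurd hx (hv ▸ N.notMem v e)
      · exact N.eq_of_mem_carrier h hx
    · rintro rfl
      exact N.mem_upEdges.mpr ⟨hx.1, NetData.Act.actUp hx.2⟩
  rw [NetData.up, this, Finset.image_singleton]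

lemma down_eq_of_mem_carrier {x : Plane} {e : N.E} (hx : x ∈ N.carrier e) :
    N.down x = {N.d e} := by
  have : N.downEdges x = {e} := by
    ext f
    rw [Finset.mem_singleton]
    constructor
    · intro hf
      rcases N.eq_pos_or_mem_carrier_of_down hf with ⟨v, -, hv⟩ | h
      · exact absurd hx (hv ▸ N.notMem v e)
      · exact N.eq_of_mem_carrier h hx
    · rintro rfl
      exact N.mem_downEdges.mpr ⟨hx.1, NetData.Act.actDown hx.2⟩
  rw [NetData.down, this, Finset.image_singleton]

lemma localType (hC : IsNodalCurve C) {x : Plane} (hx : x ∈ C) : LocalType C x (N.up x) (N.down x) :=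
  exists_localType hC hx (N.mem_up x) (N.mem_down x)

/-- The balancing condition, visible in each of the four local types; off the curve both sums are
empty. -/
lemma balanced (hC : IsNodalCurve C) (x : Plane) : ∑ δ ∈ N.up x, δ = ∑ δ ∈ N.down x, δ := by
  by_cases hx : x ∈ C
  · have hne : ∀ d e : Lattice, 0 < det₂ d e → d ≠ e := by
      rintro d e h rfl
      rw [det₂_self] at h
      exact lt_irrefl _ h
    cases N.localType hC hx with
    | line d hd pos hU hD => rw [hU, hD]
    | node d e hd he hdpos hepos hdet hU hD => rw [hU, hD]
    | merge d e hdpos hepos hdet hU hD =>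
      rw [hU, hD, Finset.sum_singleton, Finset.sum_pair (hne d e (by omega))]
    | split d e hdpos hepos hdet hU hD =>
      rw [hU, hD, Finset.sum_singleton, Finset.sum_pair (hne d e (by omega))]
  · rw [N.up_eq_empty hx, N.down_eq_empty hx]

end Net

end TropicalPlane

/-! ### Local concavity, and a concave potential with the prescribed kinks -/

namespace TropicalPlane

/-- A continuous function is concave when it is so to second order at each point. -/
theorem concaveOn_of_local {f : Plane → ℝ} (hf : Continuous f)
    (h : ∀ p w, ∀ᶠ ε in 𝓝[>] (0 : ℝ), f (p + ε • w) + f (p - ε • w) ≤ 2 * f p) :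
    ConcaveOn ℝ Set.univ f := by
  have key : ∀ x y : Plane, ∀ t ∈ Set.Icc (0 : ℝ) 1,
      0 ≤ f (x + t • (y - x)) - (f x + t * (f y - f x)) := by
    intro x y
    set g : ℝ → ℝ := fun t => f (x + t • (y - x)) - (f x + t * (f y - f x)) with hg
    have hgc : Continuous g := by fun_prop
    have hg0 : g 0 = 0 := by simp [hg]
    have hg1 : g 1 = 0 := by simp [hg]
    by_contra! hcon
    obtain ⟨c, hc, hgc0⟩ := hcon
    obtain ⟨m, hm, hmin⟩ := (isCompact_Icc (a := (0 : ℝ)) (b := 1)).exists_isMinOn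
      ⟨c, hc⟩ hgc.continuousOn
    have hneg : g m < 0 := (hmin hc).trans_lt hgc0
    -- The deviation `g` from the chord is minimised at the leftmost possible point `s`. The
    -- second-order inequality there forces `g` to be minimal also at `s - ε`, which contradicts the
    -- choice of `s`.
    set A := Set.Icc (0 : ℝ) 1 ∩ g ⁻¹' {g m} with hA
    have hAc : IsCompact A := isCompact_Icc.inter_right (isClosed_singleton.preimage hgc)
    obtain ⟨s, ⟨hs01, hsm⟩, hsmin⟩ := hAc.exists_isLeast ⟨m, hm, rfl⟩
    have hsm : g s = g m := hsm
    have hs0 : 0 < s := by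
      rcases hs01.1.eq_or_lt with h0 | h0
      · rw [← h0, hg0] at hsm; linarith
      · exact h0
    have hs1 : s < 1 := by
      rcases hs01.2.eq_or_lt with h0 | h0
      · rw [h0, hg1] at hsm; linarith
      · exact h0
    have e1 : ∀ᶠ ε in 𝓝[>] (0 : ℝ), ε < s := mem_nhdsWithin_of_mem_nhds (gt_mem_nhds hs0)
    have e2 : ∀ᶠ ε in 𝓝[>] (0 : ℝ), ε < 1 - s :=
      mem_nhdsWithin_of_mem_nhds (gt_mem_nhds (by linarith))
    have e3 : ∀ᶠ ε in 𝓝[>] (0 : ℝ), 0 < ε := self_mem_nhdsWithin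
    obtain ⟨ε, hε, h1, h2, h3⟩ := ((h (x + s • (y - x)) (y - x)).and (e1.and (e2.and e3))).exists
    have hp : g (s + ε) + g (s - ε) ≤ 2 * g s := by
      simp only [hg]
      have a1 : x + (s + ε) • (y - x) = x + s • (y - x) + ε • (y - x) := by
        rw [add_smul, add_assoc]
      have a2 : x + (s - ε) • (y - x) = x + s • (y - x) - ε • (y - x) := by
        rw [sub_smul]; abel
      rw [a1, a2]; linarith
    have b1 : g m ≤ g (s + ε) := hmin (show s + ε ∈ Set.Icc (0 : ℝ) 1 from
      ⟨by linarith, by linarith⟩)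
    have b2' : s - ε ∈ Set.Icc (0 : ℝ) 1 := ⟨by linarith, by linarith⟩
    have b2 : g m ≤ g (s - ε) := hmin b2'
    have b3 : g (s - ε) = g m := by linarith
    have := hsmin (show s - ε ∈ A from ⟨b2', b3⟩)
    linarith
  refine ⟨convex_univ, fun x _ y _ a b ha hb hab => ?_⟩
  have := key x y b ⟨hb, by linarith⟩
  have e : x + b • (y - x) = a • x + b • y := by
    rw [smul_sub, ← sub_eq_of_eq_add hab.symm, sub_smul, one_smul]; abel
  rw [e] at this
  simp only [smul_eq_mul]
  have ha' : a = 1 - b := by linarith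
  rw [ha'] at this ⊢
  linarith

namespace NetData

variable (N : NetData.{u})

/-- The kink of the potential at `x`, a positively homogeneous function. -/
noncomputable def kink (x v : Plane) : ℝ :=
  if 0 ≤ lam v then ∑ δ ∈ N.up x, max 0 (dt v (toPlane δ))
  else ∑ δ ∈ N.down x, max 0 (dt v (toPlane δ))

lemma kink_nonneg (x v : Plane) : 0 ≤ N.kink x v := by
  unfold kink
  split_ifs <;> exact Finset.sum_nonneg fun _ _ => le_max_left _ _

lemma kink_smul (x v : Plane) {t : ℝ} (ht : 0 < t) : N.kink x (t • v) = t * N.kink x v := by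
  unfold kink
  simp only [lam_smul, mul_nonneg_iff_of_pos_left ht, dt_smul_left]
  split_ifs <;>
  · rw [Finset.mul_sum]
    refine Finset.sum_congr rfl fun _ _ => ?_
    rw [mul_max_of_nonneg _ _ ht.le, mul_zero]

lemma lam_pos_of_mem_up {x : Plane} {δ : Lattice} (h : δ ∈ N.up x) : 0 < lam (toPlane δ) := by
  obtain ⟨e, -, rfl⟩ := Finset.mem_image.mp h
  exact N.lam_pos e

lemma kink_kerVec (x : Plane) : N.kink x kerVec = ∑ δ ∈ N.up x, lam (toPlane δ) := by
  simp only [kink, lam_kerVec, le_refl, if_true, dt_kerVec]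
  exact Finset.sum_congr rfl fun δ h => max_eq_right (N.lam_pos_of_mem_up h).le

lemma kink_neg_kerVec (x : Plane) : N.kink x (-kerVec) = 0 := by
  simp only [kink, lam_neg, lam_kerVec, neg_zero, le_refl, if_true, dt_neg_left, dt_kerVec]
  exact Finset.sum_eq_zero fun δ h => max_eq_left (by linarith [N.lam_pos_of_mem_up h])

lemma tendsto_kink (x : Plane) : Filter.Tendsto (N.kink x) (𝓝 0) (𝓝 0) := by
  have h : Filter.Tendsto (fun v => ∑ δ ∈ N.up x, max 0 (dt v (toPlane δ)) +
      ∑ δ ∈ N.down x, max 0 (dt v (toPlane δ))) (𝓝 0) (𝓝 0) := by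
    have : Continuous fun v => ∑ δ ∈ N.up x, max 0 (dt v (toPlane δ)) +
      ∑ δ ∈ N.down x, max 0 (dt v (toPlane δ)) := by fun_prop
    simpa using this.tendsto 0
  refine squeeze_zero (N.kink_nonneg x) (fun v => ?_) h
  unfold kink
  split_ifs
  · exact le_add_of_nonneg_right (Finset.sum_nonneg fun _ _ => le_max_left _ _)
  · exact le_add_of_nonneg_left (Finset.sum_nonneg fun _ _ => le_max_left _ _)

/-- Near `x`, the function `f` is the sum of an affine function with slope `a` and of the kink. -/
def HasForm (f : Plane → ℝ) (x : Plane) (a : Lattice) : Prop :=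
  ∀ᶠ v in 𝓝 (0 : Plane), f (x + v) = f x + toPlane a ⬝ᵥ v - N.kink x v

open Classical in
/-- A concave function whose kinks are those prescribed by the net. -/
noncomputable def pot (x : Plane) : ℝ :=
  -∑ e, if N.ActUp e (lam x) then max 0 (N.aff e x) else 0

end NetData

lemma sum_dotProduct_nrm {ι : Type*} (s : Finset ι) (d : ι → Lattice) (v : Plane) :
    toPlane (∑ i ∈ s, nrm (d i)) ⬝ᵥ v = ∑ i ∈ s, dt v (toPlane (d i)) := by
  rw [toPlane_sum, sum_dotProduct]
  exact Finset.sum_congr rfl fun i _ => toPlane_nrm_dotProduct _ _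

namespace Net

variable {C : Set Plane} (N : Net.{u} C)

lemma kink_of_notMem {x : Plane} (hx : x ∉ C) (v : Plane) : N.kink x v = 0 := by
  simp [NetData.kink, N.up_eq_empty hx, N.down_eq_empty hx]

lemma kink_of_mem_carrier {x : Plane} {e : N.E} (hx : x ∈ N.carrier e) (v : Plane) :
    N.kink x v = max 0 (dt v (toPlane (N.d e))) := by
  simp [NetData.kink, N.up_eq_of_mem_carrier hx, N.down_eq_of_mem_carrier hx]

lemma up_nonempty (hC : IsNodalCurve C) {x : Plane} (hx : x ∈ C) : (N.up x).Nonempty := by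
  cases N.localType hC hx with
  | line d hd pos hU => rw [hU]; simp
  | node d e hd he hdpos hepos hdet hU => rw [hU]; simp
  | merge d e hdpos hepos hdet hU => rw [hU]; simp
  | split d e hdpos hepos hdet hU => rw [hU]; simp

lemma kink_kerVec_pos (hC : IsNodalCurve C) {x : Plane} (hx : x ∈ C) :
    0 < N.kink x kerVec := by
  rw [N.kink_kerVec]
  exact Finset.sum_pos (fun δ h => N.lam_pos_of_mem_up h) (N.up_nonempty hC hx)

open Classical in
-- The edges to the left of `x` either cross the level line of `x` in their interior or have an end
-- at a vertex point `q` of that line. As the second coordinate of `kerVec` is -1, the condition `x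
-- 1 < q 1` means that `q` is to the left of `x`. The predicate `p` stands for activity upwards or
-- downwards.
lemma sum_aff_pos (x y : Plane) (p : N.E → Prop) (hp : ∀ e, N.Act e (lam x) → p e)
    (hp' : ∀ e, p e → N.Act e (lam x) ∨ ∃ v, N.aff e (N.pos v) = 0 ∧ lam (N.pos v) = lam x) :
    ∑ e with p e ∧ 0 < N.aff e x, N.aff e y =
      ∑ e with N.Act e (lam x) ∧ 0 < N.aff e x, N.aff e y +
      ∑ q ∈ (Finset.univ.image N.pos).filter (fun q => lam q = lam x ∧ x 1 < q 1),
        ∑ e with N.aff e q = 0 ∧ p e, N.aff e y := by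
  rw [← Finset.sum_biUnion, ← Finset.sum_union]
  · refine Finset.sum_congr ?_ fun _ _ => rfl
    ext e
    simp only [Finset.mem_filter, Finset.mem_univ, true_and, Finset.mem_union,
      Finset.mem_biUnion, Finset.mem_image]
    constructor
    · rintro ⟨h1, h2⟩
      rcases hp' e h1 with h3 | ⟨v, h3, h4⟩
      · exact Or.inl ⟨h3, h2⟩
      · right
        refine ⟨N.pos v, ⟨⟨v, rfl⟩, h4, ?_⟩, h3, h1⟩
        rw [N.aff_eq_of_aff_eq_zero h3, sub_eq_smul_kerVec h4.symm, dt_smul_left, dt_kerVec] at h2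
        have := pos_of_mul_pos_left h2 (N.lam_pos e).le
        linarith
    · rintro (⟨h1, h2⟩ | ⟨q, ⟨⟨v, rfl⟩, h4, h5⟩, h3, h1⟩)
      · exact ⟨hp e h1, h2⟩
      · refine ⟨h1, ?_⟩
        rw [N.aff_eq_of_aff_eq_zero h3, sub_eq_smul_kerVec h4.symm, dt_smul_left, dt_kerVec]
        exact mul_pos (by linarith) (N.lam_pos e)
  · rw [Finset.disjoint_left]
    intro e he he'
    simp only [Finset.mem_filter, Finset.mem_univ, true_and, Finset.mem_biUnion,
      Finset.mem_image] at he he'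
    obtain ⟨q, ⟨⟨v, rfl⟩, h4, h5⟩, h3, h1⟩ := he'
    exact N.notMem v e ⟨h3, h4 ▸ he.1⟩
  · intro q hq q' hq' hqq'
    rw [Function.onFun, Finset.disjoint_left]
    intro e he he'
    simp only [Finset.coe_filter, Set.mem_ofPred_eq, Finset.mem_filter, Finset.mem_univ,
      true_and] at hq hq' he he'
    apply hqq'
    have h1 := N.aff_eq_of_aff_eq_zero he.1 q'
    rw [he'.1, sub_eq_smul_kerVec (hq'.2.1.trans hq.2.1.symm), dt_smul_left, dt_kerVec] at h1
    have h2 := (mul_eq_zero.mp h1.symm).resolve_right (N.lam_pos e).ne'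
    have h3 := sub_eq_smul_kerVec (hq'.2.1.trans hq.2.1.symm)
    rw [h2, zero_smul] at h3
    exact (sub_eq_zero.mp h3).symm

open Classical in
-- Edges that cross the level contribute equally to both sides. At each vertex point `q` of the
-- level the contributions are determinants with the sum of the upward, respectively downward,
-- directions, and these sums agree by balancing.
lemma sum_aff_up_eq_down (hC : IsNodalCurve C) (x y : Plane) :
    ∑ e with N.ActUp e (lam x) ∧ 0 < N.aff e x, N.aff e y =
      ∑ e with N.ActDown e (lam x) ∧ 0 < N.aff e x, N.aff e y := by
  rw [N.sum_aff_pos x y (fun e => N.ActUp e (lam x)) (fun e h => h.actUp),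
    N.sum_aff_pos x y (fun e => N.ActDown e (lam x)) (fun e h => h.actDown)]
  · congr 1
    refine Finset.sum_congr rfl fun q hq => ?_
    simp only [Finset.mem_filter] at hq
    have h1 : ∑ e ∈ N.upEdges q, N.aff e y = dt (y - q) (toPlane (∑ δ ∈ N.up q, δ)) := by
      rw [NetData.up, Finset.sum_image (N.injOn_up q), toPlane_sum, dt_sum_right]
      exact Finset.sum_congr rfl fun e he => N.aff_eq_of_aff_eq_zero (N.mem_upEdges.mp he).1 y
    have h2 : ∑ e ∈ N.downEdges q, N.aff e y = dt (y - q) (toPlane (∑ δ ∈ N.down q, δ)) := by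
      rw [NetData.down, Finset.sum_image (N.injOn_down q), toPlane_sum, dt_sum_right]
      exact Finset.sum_congr rfl fun e he => N.aff_eq_of_aff_eq_zero (N.mem_downEdges.mp he).1 y
    rw [N.balanced hC q, ← h2] at h1
    simp only [NetData.upEdges, NetData.downEdges, hq.2.1] at h1
    exact h1
  · intro e he
    by_cases h : N.Act e (lam x)
    · exact Or.inl h
    · right
      by_contra! h3
      exact h ⟨he.1, fun v hv => lt_of_le_of_ne (he.2 v hv) (h3 v (N.dt_hi e v hv)).symm⟩
  · intro e he
    by_cases h : N.Act e (lam x)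
    · exact Or.inl h
    · right
      by_contra! h3
      exact h ⟨fun v hv => lt_of_le_of_ne (he.1 v hv) (h3 v (N.dt_lo e v hv)), he.2⟩

open Classical in
-- For small `v` the affine functions that do not vanish at `x` keep their sign: the positive ones
-- contribute linearly, the negative ones nothing, and those that vanish at `x` produce the kink.
lemma sum_max_aff (x v : Plane) (p : N.E → Prop)
    (hv : ∀ e, (0 < N.aff e x → 0 < N.aff e (x + v)) ∧ (N.aff e x < 0 → N.aff e (x + v) < 0)) :
    (∑ e, if p e then max 0 (N.aff e (x + v)) else 0) =
      ∑ e with p e ∧ 0 < N.aff e x, N.aff e (x + v) +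
        ∑ e with N.aff e x = 0 ∧ p e, max 0 (dt v (toPlane (N.d e))) := by
  rw [Finset.sum_filter, Finset.sum_filter, ← Finset.sum_add_distrib]
  refine Finset.sum_congr rfl fun e _ => ?_
  by_cases h : p e
  · rcases lt_trichotomy (N.aff e x) 0 with h1 | h1 | h1
    · simp [h, h1.ne, h1.not_gt, max_eq_left ((hv e).2 h1).le]
    · simp [h, h1, N.aff_add]
    · simp [h, h1, h1.ne', max_eq_right ((hv e).1 h1).le]
  · simp [h]

open Classical in
/-- The local form of the potential. -/
theorem hasForm_pot (hC : IsNodalCurve C) (x : Plane) :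
    N.HasForm N.pot x (-∑ e with N.ActUp e (lam x) ∧ 0 < N.aff e x, nrm (N.d e)) := by
  have haff : ∀ e, Continuous (N.aff e) := fun e => by unfold NetData.aff; fun_prop
  have hadd : Filter.Tendsto (fun v => x + v) (𝓝 0) (𝓝 x) := by
    have : Continuous fun v : Plane => x + v := by fun_prop
    simpa using this.tendsto 0
  have h1 : ∀ᶠ v in 𝓝 (0 : Plane), ∀ e,
      (0 < N.aff e x → 0 < N.aff e (x + v)) ∧ (N.aff e x < 0 → N.aff e (x + v) < 0) := by
    rw [Filter.eventually_all]
    intro e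
    have ht := ((haff e).tendsto x).comp hadd
    refine Filter.Eventually.and ?_ ?_
    · by_cases h : 0 < N.aff e x
      · filter_upwards [ht.eventually (lt_mem_nhds h)] with v hv _ using hv
      · exact Filter.Eventually.of_forall fun _ h' => absurd h' h
    · by_cases h : N.aff e x < 0
      · filter_upwards [ht.eventually (gt_mem_nhds h)] with v hv _ using hv
      · exact Filter.Eventually.of_forall fun _ h' => absurd h' h
  have h2 := ((continuous_lam.tendsto x).comp hadd).eventually (N.eventually_act (lam x))
  have hx : N.pot x = -∑ e with N.ActUp e (lam x) ∧ 0 < N.aff e x, N.aff e x := by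
    have := N.sum_max_aff x 0 (fun e => N.ActUp e (lam x)) (by simp)
    simp only [add_zero] at this
    rw [NetData.pot, this]
    simp
  have hsum : ∀ v, ∑ e with N.ActUp e (lam x) ∧ 0 < N.aff e x, N.aff e (x + v) = -N.pot x -
      toPlane (-∑ e with N.ActUp e (lam x) ∧ 0 < N.aff e x, nrm (N.d e)) ⬝ᵥ v := by
    intro v
    rw [toPlane_neg, neg_dotProduct, sum_dotProduct_nrm, hx, neg_neg, sub_neg_eq_add,
      ← Finset.sum_add_distrib]
    exact Finset.sum_congr rfl fun e _ => N.aff_add e x v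
  filter_upwards [h1, h2] with v hv hv2
  by_cases hlam : 0 ≤ lam v
  · have h3 : ∀ e, N.ActUp e (lam (x + v)) ↔ N.ActUp e (lam x) := fun e =>
      (hv2 e).1 (by simpa using hlam)
    have h4 : N.kink x v =
        ∑ e with N.aff e x = 0 ∧ N.ActUp e (lam x), max 0 (dt v (toPlane (N.d e))) := by
      rw [NetData.kink, if_pos hlam, NetData.up, Finset.sum_image (N.injOn_up x)]
      rfl
    rw [NetData.pot]
    simp only [h3]
    rw [N.sum_max_aff x v _ hv, hsum, ← h4]
    ring
  · have h3 : ∀ e, N.ActUp e (lam (x + v)) ↔ N.ActDown e (lam x) := fun e =>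
      (hv2 e).2.1 (by rw [Function.comp, lam_add]; linarith)
    have h4 : N.kink x v =
        ∑ e with N.aff e x = 0 ∧ N.ActDown e (lam x), max 0 (dt v (toPlane (N.d e))) := by
      rw [NetData.kink, if_neg hlam, NetData.down, Finset.sum_image (N.injOn_down x)]
      rfl
    rw [NetData.pot]
    simp only [h3]
    -- Balancing gives the same affine part below the level of `x` as above it.
    rw [N.sum_max_aff x v _ hv, ← N.sum_aff_up_eq_down hC, hsum, ← h4]
    ring

end Net

end TropicalPlane

/-! ### Functions with the prescribed kinks, and existence of a dual polynomial -/

namespace TropicalPlane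

@[fun_prop] lemma continuous_dotProduct_toPlane (a : Lattice) :
    Continuous fun v : Plane => toPlane a ⬝ᵥ v := by
  unfold dotProduct; fun_prop

lemma differentiable_dotProduct_toPlane (a : Lattice) :
    Differentiable ℝ fun v : Plane => toPlane a ⬝ᵥ v := by
  unfold dotProduct; fun_prop

/-- A lattice vector is determined by the linear form that it defines. -/
lemma exists_nrm_eq (c : Lattice) : ∃ e, nrm e = c :=
  ⟨![-c 1, c 0], by ext i; fin_cases i <;> simp [nrm]⟩

lemma nrm_smul (k : ℤ) (d : Lattice) : nrm (k • d) = k • nrm d := by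
  ext i; fin_cases i <;> simp [nrm]

lemma eq_zero_of_dotProduct_nonpos {c : Lattice} (h : ∀ v : Plane, toPlane c ⬝ᵥ v ≤ 0) : c = 0 := by
  apply eq_zero_of_dotProduct_kerVec
  have h1 := h kerVec
  have h2 := h (-kerVec)
  rw [dotProduct_neg] at h2
  linarith

/-- The vectors `±d` show that `c` annihilates `d`, so that `c` is an integral multiple k of `nrm d`
by primitivity. The vectors `±kerVec` then give 0 ≤ k ≤ 1. Geometrically, a primitive lattice
segment contains only its two ends. -/
lemma eq_or_eq_nrm_of_dotProduct_le {c d : Lattice} (hd : IsPrimitive d)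
    (hpos : 0 < lam (toPlane d)) (h : ∀ v : Plane, toPlane c ⬝ᵥ v ≤ max 0 (dt v (toPlane d))) :
    c = 0 ∨ c = nrm d := by
  obtain ⟨e, rfl⟩ := exists_nrm_eq c
  simp only [toPlane_nrm_dotProduct] at h
  have h1 := h (toPlane d)
  have h2 := h (-toPlane d)
  simp only [dt_self, dt_neg_left, neg_zero, max_self] at h1 h2
  have h3 : det₂ d e = 0 := by
    have : ((det₂ d e : ℤ) : ℝ) = 0 := by rw [det₂_cast]; linarith
    exact_mod_cast this
  obtain ⟨k, rfl⟩ := hd.exists_smul_eq h3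
  have h4 := h kerVec
  have h5 := h (-kerVec)
  simp only [dt_kerVec, dt_neg_left, toPlane_zsmul, lam_smul] at h4 h5
  rw [max_eq_right hpos.le] at h4
  rw [max_eq_left (by linarith)] at h5
  have hk0 : (0 : ℝ) ≤ k := by
    by_contra! hk
    nlinarith
  have hk1 : (k : ℝ) ≤ 1 := by
    by_contra! hk
    nlinarith
  have hk0 : 0 ≤ k := by exact_mod_cast hk0
  have hk1 : k ≤ 1 := by exact_mod_cast hk1
  obtain rfl | rfl : k = 0 ∨ k = 1 := by omega
  · left; rw [nrm_smul, zero_smul]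
  · right; rw [one_smul]

namespace TropicalPolynomial

variable (F : TropicalPolynomial)

lemma term_add (a : Lattice) (x v : Plane) : F.term a (x + v) = F.term a x + toPlane a ⬝ᵥ v := by
  simp [term, dotProduct_add, add_assoc]

lemma eval_le {a : Lattice} (ha : a ∈ F.support) (x : Plane) : F.eval x ≤ F.term a x :=
  Finset.inf'_le _ ha

lemma exists_eval_eq (x : Plane) : ∃ a ∈ F.support, F.eval x = F.term a x :=
  Finset.exists_mem_eq_inf' _ _

@[fun_prop] lemma continuous_term (a : Lattice) : Continuous (F.term a) := by
  unfold term; fun_prop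

@[fun_prop] lemma continuous_eval : Continuous F.eval :=
  Continuous.finset_inf'_apply F.nonempty fun a _ => F.continuous_term a

lemma concaveOn_eval : ConcaveOn ℝ Set.univ F.eval := by
  refine ⟨convex_univ, fun x _ y _ a b ha hb hab => ?_⟩
  obtain ⟨c, hc, h⟩ := F.exists_eval_eq (a • x + b • y)
  have h1 := mul_le_mul_of_nonneg_left (F.eval_le hc x) ha
  have h2 := mul_le_mul_of_nonneg_left (F.eval_le hc y) hb
  rw [h]
  have h3 : F.term c (a • x + b • y) = a * F.term c x + b * F.term c y := by
    simp only [term, dotProduct_add, dotProduct_smul, smul_eq_mul]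
    linear_combination (-F.coeff c) * hab
  rw [h3]
  simp only [smul_eq_mul]
  linarith

end TropicalPolynomial

namespace NetData

variable {N : NetData.{u}} {f : Plane → ℝ} {x : Plane} {a : Lattice}

lemma HasForm.continuousAt (h : N.HasForm f x a) : ContinuousAt f x := by
  have h1 : Filter.Tendsto (fun v => f x + toPlane a ⬝ᵥ v - N.kink x v) (𝓝 0) (𝓝 (f x)) := by
    have h2 : Continuous fun v : Plane => f x + toPlane a ⬝ᵥ v := by fun_prop
    have := (h2.tendsto 0).sub (N.tendsto_kink x)
    simpa using this
  have h3 := h1.congr' (h.mono fun v hv => hv.symm)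
  rw [ContinuousAt, ← map_add_left_nhds_zero, Filter.tendsto_map'_iff]
  exact h3

lemma eventually_pos_right : ∀ᶠ t in 𝓝[>] (0 : ℝ), 0 < t := self_mem_nhdsWithin

lemma tendsto_smul_zero (w : Plane) :
    Filter.Tendsto (fun t : ℝ => t • w) (𝓝[>] (0 : ℝ)) (𝓝 0) := by
  simpa using tendsto_add_smul 0 w

lemma HasForm.eventually_smul (h : N.HasForm f x a) (w : Plane) : ∀ᶠ ε in 𝓝[>] (0 : ℝ),
    f (x + ε • w) = f x + ε * (toPlane a ⬝ᵥ w - N.kink x w) := by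
  filter_upwards [(tendsto_smul_zero w).eventually h, self_mem_nhdsWithin] with ε hε hpos
  rw [hε, N.kink_smul x w hpos, dotProduct_smul, smul_eq_mul]
  ring

lemma HasForm.second_order (h : N.HasForm f x a) (w : Plane) : ∀ᶠ ε in 𝓝[>] (0 : ℝ),
    f (x + ε • w) + f (x - ε • w) ≤ 2 * f x := by
  filter_upwards [h.eventually_smul w, h.eventually_smul (-w), self_mem_nhdsWithin] with ε h1 h2 h3
  rw [smul_neg, ← sub_eq_add_neg] at h2
  have h3 : 0 < ε := h3
  rw [h1, h2, dotProduct_neg]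
  have := mul_nonneg h3.le (N.kink_nonneg x w)
  have := mul_nonneg h3.le (N.kink_nonneg x (-w))
  linarith

lemma HasForm.add_affine (h : N.HasForm f x a) (b : Lattice) (c : ℝ) :
    N.HasForm (fun y => f y + toPlane b ⬝ᵥ y + c) x (a + b) := by
  filter_upwards [h] with v hv
  rw [hv, toPlane_add, add_dotProduct, dotProduct_add]
  ring

lemma HasForm.le_tangent (hf : ConcaveOn ℝ Set.univ f) (h : N.HasForm f x a) (y : Plane) :
    f y ≤ f x + toPlane a ⬝ᵥ (y - x) := by
  by_contra! hlt
  obtain ⟨ε, h1, h2, h3⟩ := ((h.eventually_smul (y - x)).and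
    (eventually_pos_right.and
    (mem_nhdsWithin_of_mem_nhds (gt_mem_nhds one_pos) : ∀ᶠ ε in 𝓝[>] (0 : ℝ), ε < 1))).exists
  have h4 := hf.2 (Set.mem_univ x) (Set.mem_univ y) (show 0 ≤ 1 - ε by linarith) h2.le (by ring)
  have h5 : (1 - ε) • x + ε • y = x + ε • (y - x) := by
    rw [sub_smul, one_smul, smul_sub]; abel
  rw [h5, h1] at h4
  simp only [smul_eq_mul] at h4
  have h6 := mul_nonneg h2.le (N.kink_nonneg x (y - x))
  have h7 : ε * (f x + toPlane a ⬝ᵥ (y - x)) < ε * f y := mul_lt_mul_of_pos_left hlt h2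
  linarith

/-- A point is a maximum of `f - z` precisely when it is so to first order. -/
lemma HasForm.isMax_iff (hf : ConcaveOn ℝ Set.univ f) (h : N.HasForm f x a) (z : Lattice) :
    (∀ y, f y - toPlane z ⬝ᵥ y ≤ f x - toPlane z ⬝ᵥ x) ↔
      ∀ v, toPlane (a - z) ⬝ᵥ v ≤ N.kink x v := by
  have hlin : ∀ v, toPlane (a - z) ⬝ᵥ v = toPlane a ⬝ᵥ v - toPlane z ⬝ᵥ v := fun v => by
    rw [toPlane_sub, sub_dotProduct]
  constructor
  · intro hmax v
    obtain ⟨ε, h1, h2⟩ := ((h.eventually_smul v).and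
      (self_mem_nhdsWithin : ∀ᶠ ε in 𝓝[>] (0 : ℝ), 0 < ε)).exists
    have h3 := hmax (x + ε • v)
    rw [h1, dotProduct_add, dotProduct_smul, smul_eq_mul] at h3
    rw [hlin]
    have h4 : ε * (toPlane a ⬝ᵥ v - toPlane z ⬝ᵥ v - N.kink x v) ≤ 0 := by linarith
    have := nonpos_of_mul_nonpos_right h4 h2
    linarith
  · intro hle y
    by_contra! hlt
    obtain ⟨ε, h1, h2, h3⟩ := ((h.eventually_smul (y - x)).and
      (eventually_pos_right.and
      (mem_nhdsWithin_of_mem_nhds (gt_mem_nhds one_pos) : ∀ᶠ ε in 𝓝[>] (0 : ℝ), ε < 1))).exists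
    have h4 := hf.2 (Set.mem_univ x) (Set.mem_univ y) (show 0 ≤ 1 - ε by linarith) h2.le (by ring)
    have h5 : (1 - ε) • x + ε • y = x + ε • (y - x) := by
      rw [sub_smul, one_smul, smul_sub]; abel
    rw [h5, h1] at h4
    simp only [smul_eq_mul] at h4
    have h6 := hle (y - x)
    rw [hlin, dotProduct_sub (toPlane z)] at h6
    have h7 := mul_le_mul_of_nonneg_left h6 h2.le
    have h8 := mul_lt_mul_of_pos_left hlt h2
    linarith

end NetData

namespace Net

variable {C : Set Plane} (N : Net.{u} C) {f : Plane → ℝ} {x : Plane} {a : Lattice}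

lemma eventually_nhds_of_zero {x : Plane} {p : Plane → Prop}
    (h : ∀ᶠ v in 𝓝 (0 : Plane), p (x + v)) : ∀ᶠ y in 𝓝 x, p y := by
  rw [← map_add_left_nhds_zero, Filter.eventually_map]
  exact h

lemma eventually_zero_of_nhds {x : Plane} {p : Plane → Prop}
    (h : ∀ᶠ y in 𝓝 x, p y) : ∀ᶠ v in 𝓝 (0 : Plane), p (x + v) := by
  rw [← map_add_left_nhds_zero, Filter.eventually_map] at h
  exact h

lemma eventuallyEq_affine_of_notMem (h : N.HasForm f x a) (hx : x ∉ C) :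
    f =ᶠ[𝓝 x] fun y => toPlane a ⬝ᵥ y + (f x - toPlane a ⬝ᵥ x) := by
  apply eventually_nhds_of_zero
  filter_upwards [h] with v hv
  rw [hv, N.kink_of_notMem hx, dotProduct_add]
  ring

/-- At a point of the curve the kink is positive along `kerVec` and zero along `-kerVec`, so the two
one-sided derivatives cannot come from a linear map. -/
lemma differentiableAt_iff (hC : IsNodalCurve C) (h : N.HasForm f x a) :
    DifferentiableAt ℝ f x ↔ x ∉ C := by
  constructor
  · intro hd hx
    have hlim : ∀ w, Filter.Tendsto (fun ε : ℝ => ε⁻¹ • (f (x + ε • w) - f x)) (𝓝[>] 0)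
        (𝓝 (fderiv ℝ f x w)) := fun w =>
      (hd.hasFDerivAt.hasLineDerivAt w).tendsto_slope_zero_right
    have hval : ∀ w, fderiv ℝ f x w = toPlane a ⬝ᵥ w - N.kink x w := by
      intro w
      refine tendsto_nhds_unique (hlim w) (tendsto_const_nhds.congr' ?_)
      filter_upwards [h.eventually_smul w, self_mem_nhdsWithin] with ε h1 h2
      have h2 : 0 < ε := h2
      rw [h1, add_sub_cancel_left, smul_eq_mul, ← mul_assoc, inv_mul_cancel₀ h2.ne', one_mul]
    have h1 := hval kerVec
    have h2 := hval (-kerVec)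
    rw [map_neg, h1, N.kink_neg_kerVec, dotProduct_neg] at h2
    have := N.kink_kerVec_pos hC hx
    linarith
  · intro hx
    refine DifferentiableAt.congr_of_eventuallyEq ?_ (N.eventuallyEq_affine_of_notMem h hx)
    exact ((differentiable_dotProduct_toPlane a) x).add_const _

open Classical in
/-- The slope of the potential in the sector of `x` that contains `-kerVec`. -/
noncomputable def slope (x : Plane) : Lattice :=
  -∑ e with N.ActUp e (lam x) ∧ 0 < N.aff e x, nrm (N.d e)

lemma hasForm_pot_slope (hC : IsNodalCurve C) (x : Plane) : N.HasForm N.pot x (N.slope x) :=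
  N.hasForm_pot hC x

lemma continuous_pot (hC : IsNodalCurve C) : Continuous N.pot :=
  continuous_iff_continuousAt.mpr fun x => (N.hasForm_pot_slope hC x).continuousAt

lemma concaveOn_pot (hC : IsNodalCurve C) : ConcaveOn ℝ Set.univ N.pot :=
  concaveOn_of_local (N.continuous_pot hC) fun x => (N.hasForm_pot_slope hC x).second_order

lemma finite_range_slope : (Set.range N.slope).Finite := by
  classical
  refine ((Finset.univ : Finset (Finset N.E)).image
    fun s => -∑ e ∈ s, nrm (N.d e)).finite_toSet.subset ?_
  rintro _ ⟨x, rfl⟩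
  simp only [Finset.coe_image, Finset.coe_univ, Set.image_univ]
  exact ⟨_, rfl⟩

open Classical in
/-- The potential as a tropical polynomial. -/
noncomputable def potPoly : TropicalPolynomial where
  support := N.finite_range_slope.toFinset
  nonempty := ⟨N.slope 0, by simp⟩
  -- The default value is never attained on the support, which is the range of `slope`.
  coeff a := if h : ∃ x, N.slope x = a then N.pot h.choose - toPlane a ⬝ᵥ h.choose else 0

/-- The coefficient does not depend on the point chosen for a slope: two points with the same slope
each lie on or below the tangent at the other, so their tangents coincide. -/
lemma term_potPoly (hC : IsNodalCurve C) (x y : Plane) :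
    N.potPoly.term (N.slope x) y = N.pot x + toPlane (N.slope x) ⬝ᵥ (y - x) := by
  have h : ∃ x', N.slope x' = N.slope x := ⟨x, rfl⟩
  have h1 := (N.hasForm_pot_slope hC h.choose).le_tangent (N.concaveOn_pot hC) x
  have h2 := (N.hasForm_pot_slope hC x).le_tangent (N.concaveOn_pot hC) h.choose
  simp only [TropicalPolynomial.term, potPoly, dif_pos h]
  rw [h.choose_spec] at h1
  rw [dotProduct_sub] at h1 h2 ⊢
  linarith

/-- A concave function lies below its tangents and touches the one at `x`. -/
lemma eval_potPoly (hC : IsNodalCurve C) (x : Plane) : N.potPoly.eval x = N.pot x := by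
  apply le_antisymm
  · refine (N.potPoly.eval_le (a := N.slope x) (by simp [potPoly]) x).trans ?_
    rw [N.term_potPoly hC]; simp
  · refine Finset.le_inf' _ _ fun a ha => ?_
    obtain ⟨x', rfl⟩ : a ∈ Set.range N.slope := by simpa [potPoly] using ha
    rw [N.term_potPoly hC]
    exact (N.hasForm_pot_slope hC x').le_tangent (N.concaveOn_pot hC) x

/-- The slopes that are attained at a point of the relative interior of an edge. -/
lemma eq_or_eq_of_mem_carrier (hf : ConcaveOn ℝ Set.univ f) {e : N.E} (hx : x ∈ N.carrier e)
    (h : N.HasForm f x a) {z : Lattice}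
    (hz : ∀ y, f y - toPlane z ⬝ᵥ y ≤ f x - toPlane z ⬝ᵥ x) : z = a ∨ z = a - nrm (N.d e) := by
  rw [h.isMax_iff hf] at hz
  simp only [N.kink_of_mem_carrier hx] at hz
  rcases eq_or_eq_nrm_of_dotProduct_le (N.prim e) (N.lam_pos e) hz with h1 | h1
  · exact Or.inl (sub_eq_zero.mp h1).symm
  · exact Or.inr (by rw [← h1]; abel)

lemma eq_of_notMem (hf : ConcaveOn ℝ Set.univ f) (hx : x ∉ C)
    (h : N.HasForm f x a) {z : Lattice}
    (hz : ∀ y, f y - toPlane z ⬝ᵥ y ≤ f x - toPlane z ⬝ᵥ x) : z = a := by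
  rw [h.isMax_iff hf] at hz
  simp only [N.kink_of_notMem hx] at hz
  exact (sub_eq_zero.mp (eq_zero_of_dotProduct_nonpos hz)).symm

end Net

lemma TropicalPolynomial.isMax_of_mem_region {F : TropicalPolynomial} {a : Lattice}
    (ha : a ∈ F.support) {x : Plane} (hx : x ∈ F.region a) (y : Plane) :
    F.eval y - toPlane a ⬝ᵥ y ≤ F.eval x - toPlane a ⬝ᵥ x := by
  have h1 : F.eval x = F.term a x := hx
  have h2 := F.eval_le ha y
  rw [h1]
  simp only [TropicalPolynomial.term] at h2 ⊢
  linarith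

lemma TropicalPolynomial.convex_region (F : TropicalPolynomial) {a : Lattice}
    (ha : a ∈ F.support) : Convex ℝ (F.region a) := by
  intro x hx y hy s t hs ht hst
  have hx : F.eval x = F.term a x := hx
  have hy : F.eval y = F.term a y := hy
  have h1 := F.concaveOn_eval.2 (Set.mem_univ x) (Set.mem_univ y) hs ht hst
  refine le_antisymm (F.eval_le ha _) (le_trans (le_of_eq ?_) h1)
  rw [hx, hy]
  simp only [term, dotProduct_add, dotProduct_smul, smul_eq_mul]
  linear_combination (-F.coeff a) * hst

/-- A tropical polynomial with the local form of a net is dual to the curve. -/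
theorem Net.isDualTo {C : Set Plane} (N : Net.{u} C) (hC : IsNodalCurve C) (F : TropicalPolynomial)
    (hF : ∀ x, ∃ a, N.HasForm F.eval x a) : F.IsDualTo C := by
  constructor
  · ext x
    obtain ⟨a, ha⟩ := hF x
    change x ∈ C ↔ ¬ DifferentiableAt ℝ F.eval x
    rw [N.differentiableAt_iff hC ha, not_not]
  · rintro a ha b hb hab - - ⟨x, hx, y, hy, hxy⟩
    -- The two convex regions share an infinite open segment, which contains a point `m` that is not
    -- a vertex. At most two slopes are attained at `m`, and if there are two they differ by the
    -- primitive normal of an edge.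
    have hinf : (openSegment ℝ x y).Infinite := by
      rw [openSegment_eq_image']
      refine (Set.Ioo_infinite one_pos).image fun s _ t _ hst => ?_
      have h1 : (s - t) • (y - x) = 0 := by
        have hst : x + s • (y - x) = x + t • (y - x) := hst
        rw [sub_smul, add_left_cancel hst, sub_self]
      rcases smul_eq_zero.mp h1 with h2 | h2
      · linarith
      · exact absurd (sub_eq_zero.mp h2).symm hxy
    obtain ⟨m, hm, hmP⟩ := (hinf.sdiff (Set.finite_range N.pos)).nonempty
    have hma : m ∈ F.region a :=
      (F.convex_region ha).openSegment_subset hx.1 hy.1 hm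
    have hmb : m ∈ F.region b :=
      (F.convex_region hb).openSegment_subset hx.2 hy.2 hm
    obtain ⟨c, hc⟩ := hF m
    have h1 := F.isMax_of_mem_region ha hma
    have h2 := F.isMax_of_mem_region hb hmb
    by_cases hmC : m ∈ C
    · obtain ⟨v, hv⟩ | ⟨e, he⟩ := N.mem_iff.mp hmC
      · exact absurd ⟨v, hv⟩ hmP
      · rcases N.eq_or_eq_of_mem_carrier F.concaveOn_eval he hc h1 with rfl | rfl <;>
          rcases N.eq_or_eq_of_mem_carrier F.concaveOn_eval he hc h2 with rfl | rfl
        · exact absurd rfl hab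
        · rw [sub_sub_cancel]; exact (N.prim e).nrm
        · rw [sub_sub_cancel_left]; exact (N.prim e).nrm.neg
        · exact absurd rfl hab
    · exact absurd ((N.eq_of_notMem F.concaveOn_eval hmC hc h1).trans
        (N.eq_of_notMem F.concaveOn_eval hmC hc h2).symm) hab

theorem Net.exists_isDualTo {C : Set Plane} (N : Net.{u} C) (hC : IsNodalCurve C) :
    ∃ F : TropicalPolynomial, F.IsDualTo C := by
  refine ⟨N.potPoly, N.isDualTo hC _ fun x => ⟨N.slope x, ?_⟩⟩
  have : N.potPoly.eval = N.pot := funext (N.eval_potPoly hC)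
  rw [this]
  exact N.hasForm_pot_slope hC x

end TropicalPlane

/-! ### Uniqueness of dual functions up to an integral affine function -/

namespace TropicalPlane

lemma eq_of_affine_eventuallyEq {a b : Lattice} {c d : ℝ} {x : Plane}
    (h : (fun y => toPlane a ⬝ᵥ y + c) =ᶠ[𝓝 x] fun y => toPlane b ⬝ᵥ y + d) : a = b ∧ c = d := by
  have h0 := h.self_of_nhds
  have hab : a = b := by
    rw [← sub_eq_zero]
    apply eq_zero_of_dotProduct_kerVec
    obtain ⟨t, ht, hpos⟩ := (((tendsto_add_smul x kerVec).eventually h).and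
      NetData.eventually_pos_right).exists
    simp only [dotProduct_add, dotProduct_smul, smul_eq_mul] at ht h0
    rw [toPlane_sub, sub_dotProduct]
    have : t * (toPlane a ⬝ᵥ kerVec - toPlane b ⬝ᵥ kerVec) = 0 := by linarith
    exact (mul_eq_zero.mp this).resolve_left hpos.ne'
  subst hab
  exact ⟨rfl, by linarith⟩

/-- A function that is locally integral affine on a connected set is integral affine there. -/
lemma affine_of_isPreconnected {O : Set Plane} (hO : IsPreconnected O) {H : Plane → ℝ}
    (h : ∀ x ∈ O, ∃ (a : Lattice) (c : ℝ), H =ᶠ[𝓝 x] fun y => toPlane a ⬝ᵥ y + c)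
    {x₀ : Plane} (hx₀ : x₀ ∈ O) {a : Lattice} {c : ℝ}
    (h₀ : H =ᶠ[𝓝 x₀] fun y => toPlane a ⬝ᵥ y + c) {x : Plane} (hx : x ∈ O) :
    H =ᶠ[𝓝 x] fun y => toPlane a ⬝ᵥ y + c := by
  set U : Lattice × ℝ → Set Plane := fun α => {x | ∀ᶠ y in 𝓝 x, H y = toPlane α.1 ⬝ᵥ y + α.2} with hU
  have hopen : ∀ α, IsOpen (U α) := fun α => isOpen_setOfPred_eventually_nhds
  have hdisj : Disjoint (U (a, c)) (⋃ α ∈ {α | α ≠ (a, c)}, U α) := by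
    rw [Set.disjoint_left]
    intro y hy hy'
    simp only [Set.mem_iUnion] at hy'
    obtain ⟨α, hα, hy'⟩ := hy'
    have hy : H =ᶠ[𝓝 y] fun y => toPlane a ⬝ᵥ y + c := hy
    have hy' : H =ᶠ[𝓝 y] fun y => toPlane α.1 ⬝ᵥ y + α.2 := hy'
    obtain ⟨e1, e2⟩ := eq_of_affine_eventuallyEq (hy'.symm.trans hy)
    exact hα (Prod.ext e1 e2)
  have hcov : O ⊆ U (a, c) ∪ ⋃ α ∈ {α | α ≠ (a, c)}, U α := by
    intro y hy
    obtain ⟨b, d, hbd⟩ := h y hy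
    by_cases hα : (b, d) = (a, c)
    · left; rw [← hα]; exact hbd
    · right
      simp only [Set.mem_iUnion]
      exact ⟨(b, d), hα, hbd⟩
  exact hO.subset_left_of_subset_union (hopen _)
    (isOpen_biUnion fun α _ => hopen α) hdisj hcov ⟨x₀, hx₀, h₀⟩ hx

/-- All terms that attain the minimum at `y` have the derivative of `F` there, hence the same slope.
A single term is therefore minimal at `y`, and by continuity also near `y`. -/
lemma TropicalPolynomial.exists_eventuallyEq_term {F : TropicalPolynomial} {y : Plane}
    (hd : DifferentiableAt ℝ F.eval y) : ∃ a ∈ F.support, F.eval =ᶠ[𝓝 y] F.term a := by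
  have hdt : ∀ b, DifferentiableAt ℝ (F.term b) y := fun b =>
    ((differentiable_dotProduct_toPlane b) y).const_add (F.coeff b)
  have hder : ∀ b ∈ F.support, F.eval y = F.term b y →
      fderiv ℝ F.eval y = fderiv ℝ (F.term b) y := by
    intro b hb hby
    have hmax : IsLocalMax (fun z => F.eval z - F.term b z) y :=
      Filter.Eventually.of_forall fun z => by
        have := F.eval_le hb z
        simp only [hby, sub_self]; linarith
    have := hmax.fderiv_eq_zero
    rw [fderiv_fun_sub hd (hdt b)] at this
    exact sub_eq_zero.mp this
  have hval : ∀ b v, fderiv ℝ (F.term b) y v = toPlane b ⬝ᵥ v := by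
    intro b v
    have h1 := (hdt b).hasFDerivAt.hasLineDerivAt v
    refine tendsto_nhds_unique h1.tendsto_slope_zero_right (tendsto_const_nhds.congr' ?_)
    filter_upwards [NetData.eventually_pos_right] with t ht
    rw [F.term_add, add_sub_cancel_left, dotProduct_smul, smul_smul, inv_mul_cancel₀ ht.ne',
      one_smul]
  obtain ⟨a, ha, hay⟩ := F.exists_eval_eq y
  refine ⟨a, ha, ?_⟩
  have huniq : ∀ b ∈ F.support, b ≠ a → F.eval y < F.term b y := by
    intro b hb hba
    refine lt_of_le_of_ne (F.eval_le hb y) fun hby => hba ?_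
    have h1 := (hder b hb hby).symm.trans (hder a ha hay)
    rw [← sub_eq_zero]
    apply eq_zero_of_dotProduct_kerVec
    rw [toPlane_sub, sub_dotProduct, ← hval, ← hval, h1, sub_self]
  have hev : ∀ᶠ z in 𝓝 y, ∀ b ∈ F.support, b ≠ a → F.eval z < F.term b z := by
    rw [Filter.eventually_all_finset]
    intro b hb
    by_cases hba : b = a
    · exact Filter.Eventually.of_forall fun _ h => absurd hba h
    · filter_upwards [F.continuous_eval.continuousAt.eventually_lt
        (F.continuous_term b).continuousAt (huniq b hb hba)] with z hz _ using hz
  filter_upwards [hev] with z hz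
  obtain ⟨b, hb, hbz⟩ := F.exists_eval_eq z
  by_cases hba : b = a
  · rw [hbz, hba]
  · exact absurd hbz (hz b hb hba).ne

namespace Net

variable {C : Set Plane} (N : Net.{u} C)

/-- Inside an edge there is only one direction up and one down, which leaves only the type of a
line. -/
lemma locallyEq_line (hC : IsNodalCurve C) {x : Plane} {e : N.E} (hx : x ∈ N.carrier e) :
    LocallyEq C (line x (toPlane (N.d e))) x := by
  have hlt := N.localType hC (N.mem_iff.mpr (Or.inr ⟨e, hx⟩))
  rw [N.up_eq_of_mem_carrier hx, N.down_eq_of_mem_carrier hx] at hlt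
  have hne : ∀ d d' : Lattice, 0 < det₂ d d' → ({N.d e} : Finset Lattice) ≠ {d, d'} := by
    intro d d' h h'
    have h1 : d ∈ ({N.d e} : Finset Lattice) := by rw [h']; simp
    have h2 : d' ∈ ({N.d e} : Finset Lattice) := by rw [h']; simp
    rw [Finset.mem_singleton] at h1 h2
    rw [h1, h2, det₂_self] at h
    exact lt_irrefl _ h
  cases hlt with
  | line d hd pos hU hD hp heq =>
    rw [Finset.singleton_inj] at hU
    rwa [hU]
  | node d d' hd he hdpos hepos hdet hU => exact absurd hU (hne d d' hdet)
  | merge d d' hdpos hepos hdet hU hD => exact absurd hD (hne d d' (by omega))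
  | split d d' hdpos hepos hdet hU hD => exact absurd hU (hne d d' (by omega))

lemma hasForm_of_notMem {F : TropicalPolynomial} (hF : F.IsDualTo C)
    {x : Plane} (hx : x ∉ C) : ∃ a, N.HasForm F.eval x a := by
  have hd : DifferentiableAt ℝ F.eval x := by
    by_contra h
    exact hx (hF.1 ▸ h)
  obtain ⟨a, -, h⟩ := TropicalPolynomial.exists_eventuallyEq_term hd
  refine ⟨a, ?_⟩
  filter_upwards [eventually_zero_of_nhds h] with v hv
  rw [hv, h.self_of_nhds, F.term_add, N.kink_of_notMem hx, sub_zero]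

/-- A dual polynomial is affine on either side of an edge. -/
lemma exists_region_of_side {F : TropicalPolynomial} (hF : F.IsDualTo C)
    {x : Plane} {d : Lattice} {r : ℝ} (hr : 0 < r)
    (hline : ∀ y ∈ Metric.ball x r, y ∈ C → dt (y - x) (toPlane d) = 0)
    (w : Plane) (hw : 0 < dt w (toPlane d)) :
    ∃ a ∈ F.support, (interior (F.region a)).Nonempty ∧
      ∀ v, ‖v‖ < r → 0 ≤ dt v (toPlane d) → F.eval (x + v) = F.term a (x + v) := by
  set O := Metric.ball x r ∩ {y | 0 < dt (y - x) (toPlane d)} with hO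
  have hOopen : IsOpen O := by
    refine Metric.isOpen_ball.inter (isOpen_lt continuous_const ?_)
    exact (continuous_dt _).comp (continuous_id.sub continuous_const)
  have hOconv : Convex ℝ O := by
    refine (convex_ball x r).inter ?_
    intro y hy z hz s t hs ht hst
    have hy : 0 < dt (y - x) (toPlane d) := hy
    have hz : 0 < dt (z - x) (toPlane d) := hz
    have h1 : s • y + t • z - x = s • (y - x) + t • (z - x) := by
      rw [smul_sub, smul_sub, sub_add_sub_comm, ← add_smul, hst, one_smul]
    change 0 < dt (s • y + t • z - x) (toPlane d)
    rw [h1, dt_add_left, dt_smul_left, dt_smul_left]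
    rcases hs.eq_or_lt with rfl | hs
    · have : t = 1 := by linarith
      subst this; linarith
    · have := mul_pos hs hy
      have := mul_nonneg ht hz.le
      linarith
  have hmem : ∀ v, ‖v‖ < r → 0 ≤ dt v (toPlane d) → ∀ᶠ t in 𝓝[>] (0 : ℝ), x + v + t • w ∈ O := by
    intro v hv hv'
    have h1 : ∀ᶠ t in 𝓝[>] (0 : ℝ), x + v + t • w ∈ Metric.ball x r :=
      (tendsto_add_smul (x + v) w).eventually
        (Metric.isOpen_ball.mem_nhds (by simpa [Metric.mem_ball, dist_eq_norm] using hv))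
    filter_upwards [h1, NetData.eventually_pos_right] with t ht ht0
    refine ⟨ht, ?_⟩
    change 0 < dt (x + v + t • w - x) (toPlane d)
    have h2 : x + v + t • w - x = v + t • w := by abel
    rw [h2, dt_add_left, dt_smul_left]
    have := mul_pos ht0 hw
    linarith
  have hdiff : ∀ y ∈ O, DifferentiableAt ℝ F.eval y := by
    intro y hy
    by_contra h
    have hyC : y ∈ C := by rw [hF.1]; exact h
    have := hline y hy.1 hyC
    have h2 : 0 < dt (y - x) (toPlane d) := hy.2
    linarith
  have hterm : ∀ a, F.term a = fun y => toPlane a ⬝ᵥ y + F.coeff a := fun a => by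
    funext y; simp [TropicalPolynomial.term, add_comm]
  obtain ⟨t₀, ht₀⟩ := (hmem 0 (by simpa using hr) (by simp)).exists
  obtain ⟨a, ha, haeq⟩ := TropicalPolynomial.exists_eventuallyEq_term (hdiff _ ht₀)
  have hall : O ⊆ F.region a := by
    intro y hy
    rw [hterm] at haeq
    have := affine_of_isPreconnected hOconv.isPreconnected (H := F.eval) (fun z hz => by
      obtain ⟨b, -, hb⟩ := TropicalPolynomial.exists_eventuallyEq_term (hdiff z hz)
      rw [hterm] at hb
      exact ⟨b, _, hb⟩) ht₀ haeq hy
    have := this.self_of_nhds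
    change F.eval y = F.term a y
    rw [hterm]; exact this
  refine ⟨a, ha, ⟨_, interior_maximal hall hOopen ht₀⟩, fun v hv hv' => ?_⟩
  have hclosed : IsClosed (F.region a) := isClosed_eq F.continuous_eval (F.continuous_term a)
  exact hclosed.mem_of_tendsto (tendsto_add_smul (x + v) w)
    ((hmem v hv hv').mono fun t ht => hall ht)

/-- On the two sides of the edge `F` is affine with slopes `a` and `b`. They differ, since `F` is
not differentiable at `x`; the difference annihilates the direction of the edge because the two
terms agree along it, and it is primitive by duality. It is thus plus or minus the primitive normal,
and minimality of `F` among its terms fixes the sign. -/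
lemma hasForm_of_mem_carrier (hC : IsNodalCurve C) {F : TropicalPolynomial} (hF : F.IsDualTo C)
    {x : Plane} {e : N.E} (hx : x ∈ N.carrier e) : ∃ a, N.HasForm F.eval x a := by
  set d := N.d e with hd
  have hpos : 0 < lam (toPlane d) := N.lam_pos e
  obtain ⟨r, hr, hball⟩ := Metric.eventually_nhds_iff_ball.mp (N.locallyEq_line hC hx)
  have hline : ∀ y ∈ Metric.ball x r, y ∈ C → dt (y - x) (toPlane d) = 0 := by
    intro y hy hyC
    obtain ⟨t, rfl⟩ := (hball y hy).mp hyC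
    rw [add_sub_cancel_left, dt_smul_left, dt_self, mul_zero]
  obtain ⟨a, ha, haint, haeq⟩ := exists_region_of_side hF hr hline kerVec (by simpa using hpos)
  have hline' : ∀ y ∈ Metric.ball x r, y ∈ C → dt (y - x) (toPlane (-d)) = 0 := by
    intro y hy hyC
    rw [toPlane_neg, dt_neg_right, hline y hy hyC, neg_zero]
  obtain ⟨b, hb, hbint, hbeq⟩ := exists_region_of_side hF hr hline' (-kerVec)
    (by simpa using hpos)
  simp only [toPlane_neg, dt_neg_right, neg_nonneg] at hbeq
  have hxa := haeq 0 (by simpa using hr) (by simp)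
  have hxb := hbeq 0 (by simpa using hr) (by simp)
  rw [add_zero] at hxa hxb
  have hnorm : ∀ w : Plane, ∀ᶠ t in 𝓝[>] (0 : ℝ), ‖t • w‖ < r := fun w => by
    have := (NetData.tendsto_smul_zero w).eventually (Metric.ball_mem_nhds 0 hr)
    simpa using this
  have hev : ∀ᶠ v in 𝓝 (0 : Plane), ‖v‖ < r := by
    filter_upwards [Metric.ball_mem_nhds (0 : Plane) hr] with v hv using by simpa using hv
  have hxC : x ∈ C := N.mem_iff.mpr (Or.inr ⟨e, hx⟩)
  have hab : a ≠ b := by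
    rintro rfl
    have hd : ¬ DifferentiableAt ℝ F.eval x := by
      have : x ∈ {x | ¬ DifferentiableAt ℝ F.eval x} := hF.1 ▸ hxC
      exact this
    apply hd
    have : F.eval =ᶠ[𝓝 x] F.term a := by
      apply eventually_nhds_of_zero
      filter_upwards [hev] with v hv
      rcases le_total 0 (dt v (toPlane d)) with h | h
      exacts [haeq v hv h, hbeq v hv h]
    exact DifferentiableAt.congr_of_eventuallyEq
      (((differentiable_dotProduct_toPlane a) x).const_add (F.coeff a)) this
  obtain ⟨t, ht, ht0⟩ := ((hnorm (toPlane d)).and NetData.eventually_pos_right).exists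
  have hta := haeq _ ht (by simp)
  have htb := hbeq _ ht (by simp)
  have hprim : IsPrimitive (a - b) := by
    refine hF.2 a ha b hb hab haint hbint ⟨x, ⟨hxa, hxb⟩, x + t • toPlane d, ⟨hta, htb⟩, ?_⟩
    intro h
    have h1 : t • toPlane d = 0 := by simpa using h
    rcases smul_eq_zero.mp h1 with h2 | h2
    · exact ht0.ne' h2
    · exact (N.prim e).ne_zero (toPlane_eq_zero.mp h2)
  obtain ⟨c, hc⟩ := exists_nrm_eq (a - b)
  have hdot : ∀ v, toPlane a ⬝ᵥ v - toPlane b ⬝ᵥ v = dt v (toPlane c) := by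
    intro v
    rw [← sub_dotProduct, ← toPlane_sub, ← hc, toPlane_nrm_dotProduct]
  have hdc : dt (toPlane d) (toPlane c) = 0 := by
    rw [F.term_add, dotProduct_smul, smul_eq_mul] at hta htb
    rw [← hdot]
    have : t * (toPlane a ⬝ᵥ toPlane d - toPlane b ⬝ᵥ toPlane d) = 0 := by linarith
    exact (mul_eq_zero.mp this).resolve_left ht0.ne'
  obtain ⟨k, rfl⟩ := (N.prim e).exists_smul_eq (e := c) (by
    have : ((det₂ d c : ℤ) : ℝ) = 0 := by rw [det₂_cast, hdc]
    exact_mod_cast this)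
  have hk : IsUnit k := by
    rw [← hc, nrm_smul] at hprim
    obtain ⟨p, q, hpq⟩ := hprim
    refine IsUnit.of_mul_eq_one (p * (nrm (N.d e)) 0 + q * (nrm (N.d e)) 1) ?_
    simp at hpq; linear_combination hpq
  obtain ⟨s, hs, hs0⟩ := ((hnorm kerVec).and NetData.eventually_pos_right).exists
  have hsa := haeq _ hs (by rw [dt_smul_left, dt_kerVec]; positivity)
  have hsb := F.eval_le hb (x + s • kerVec)
  rw [hsa, F.term_add, F.term_add, dotProduct_smul, dotProduct_smul, smul_eq_mul, smul_eq_mul]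
    at hsb
  have hk' : k = -1 := by
    rcases Int.isUnit_iff.mp hk with rfl | rfl
    · exfalso
      have h1 := hdot kerVec
      rw [dt_kerVec, one_smul] at h1
      have h2 : 0 < s * (toPlane a ⬝ᵥ kerVec - toPlane b ⬝ᵥ kerVec) := by
        rw [h1]; exact mul_pos hs0 hpos
      linarith
    · rfl
  subst hk'
  refine ⟨b, ?_⟩
  filter_upwards [hev] with v hv
  rw [N.kink_of_mem_carrier hx]
  have hdv := hdot v
  rw [neg_smul, one_smul, toPlane_neg, dt_neg_right] at hdv
  rcases le_total 0 (dt v (toPlane d)) with h | h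
  · rw [haeq v hv h, F.term_add, max_eq_right h]
    linarith
  · rw [hbeq v hv h, F.term_add, max_eq_left h]
    linarith

/-- A dual polynomial differs from the potential by an integral affine function. -/
theorem exists_eval_eq_pot_add (hC : IsNodalCurve C) {F : TropicalPolynomial}
    (hF : F.IsDualTo C) :
    ∃ (b : Lattice) (c : ℝ), ∀ x, F.eval x = N.pot x + toPlane b ⬝ᵥ x + c := by
  set O := (Set.range N.pos)ᶜ with hO
  -- The local form of `F` is known only away from the vertices. Their complement is connected, so
  -- one affine function serves there, and density with continuity extends the identity to the
  -- vertices.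
  have hcount : (Set.range N.pos).Countable := (Set.finite_range N.pos).countable
  have hconn : IsConnected O := by
    refine (hcount.isPathConnected_compl_of_one_lt_rank ?_).isConnected
    rw [rank_fin_fun]; norm_num
  have hloc : ∀ x ∈ O, ∃ (a : Lattice) (c : ℝ),
      (fun y => F.eval y - N.pot y) =ᶠ[𝓝 x] fun y => toPlane a ⬝ᵥ y + c := by
    intro x hx
    have h1 : ∃ a, N.HasForm F.eval x a := by
      by_cases hxC : x ∈ C
      · rcases N.mem_iff.mp hxC with ⟨v, hv⟩ | ⟨e, he⟩
        · exact absurd ⟨v, hv⟩ hx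
        · exact N.hasForm_of_mem_carrier hC hF he
      · exact N.hasForm_of_notMem hF hxC
    obtain ⟨a, ha⟩ := h1
    refine ⟨a - N.slope x, F.eval x - N.pot x - toPlane (a - N.slope x) ⬝ᵥ x, ?_⟩
    apply eventually_nhds_of_zero
    filter_upwards [ha, N.hasForm_pot_slope hC x] with v h1 h2
    simp only [h1, h2, dotProduct_add, toPlane_sub, sub_dotProduct]
    ring
  obtain ⟨x₀, hx₀⟩ := hconn.nonempty
  obtain ⟨b, c, h₀⟩ := hloc x₀ hx₀
  refine ⟨b, c, fun x => ?_⟩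
  have hdense : Dense O := hcount.dense_compl ℝ
  have heq : (fun y => F.eval y - N.pot y) = fun y => toPlane b ⬝ᵥ y + c := by
    refine Continuous.ext_on hdense (F.continuous_eval.sub (N.continuous_pot hC)) (by fun_prop) ?_
    intro y hy
    exact (affine_of_isPreconnected hconn.isPreconnected hloc hx₀ h₀ hy).self_of_nhds
  have h2 : F.eval x - N.pot x = toPlane b ⬝ᵥ x + c := congrFun heq x
  linarith

theorem hasForm_of_isDualTo (hC : IsNodalCurve C) {F : TropicalPolynomial} (hF : F.IsDualTo C)
    (x : Plane) : ∃ a, N.HasForm F.eval x a := by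
  obtain ⟨b, c, h⟩ := N.exists_eval_eq_pot_add hC hF
  refine ⟨N.slope x + b, ?_⟩
  have : F.eval = fun y => N.pot y + toPlane b ⬝ᵥ y + c := funext h
  rw [this]
  exact (N.hasForm_pot_slope hC x).add_affine b c

end Net

end TropicalPlane

namespace TropicalPlane

/-! ### Lattice points counted at a point of the curve -/

/-- The points at which `F - z` is maximal. -/
def TropicalPolynomial.argmax (F : TropicalPolynomial) (z : Lattice) : Set Plane :=
  {x | ∀ y, F.eval y - toPlane z ⬝ᵥ y ≤ F.eval x - toPlane z ⬝ᵥ x}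

/-- The point `p` is the lowest one at which `F - z` is maximal. -/
def TropicalPolynomial.IsLowest (F : TropicalPolynomial) (z : Lattice) (p : Plane) : Prop :=
  p ∈ F.argmax z ∧ ∀ x ∈ F.argmax z, lam x ≤ lam p → x = p

lemma TropicalPolynomial.convex_argmax (F : TropicalPolynomial) (z : Lattice) :
    Convex ℝ (F.argmax z) := by
  intro x hx y hy s t hs ht hst w
  have h1 := F.concaveOn_eval.2 (Set.mem_univ x) (Set.mem_univ y) hs ht hst
  have h2 := mul_le_mul_of_nonneg_left (hx w) hs
  have h3 := mul_le_mul_of_nonneg_left (hy w) ht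
  simp only [smul_eq_mul] at h1
  rw [dotProduct_add, dotProduct_smul, dotProduct_smul, smul_eq_mul, smul_eq_mul]
  have h4 : (s + t) * (F.eval w - toPlane z ⬝ᵥ w) = F.eval w - toPlane z ⬝ᵥ w := by
    rw [hst, one_mul]
  linarith

namespace NetData

variable (N : NetData.{u})

/-- The lattice vectors that describe the slopes whose lowest maximum is at `p`. -/
def lowVectors (p : Plane) : Set Lattice :=
  {e | ∀ v : Plane, dt v (toPlane e) ≤ N.kink p v ∧
    (v ≠ 0 → lam v ≤ 0 → dt v (toPlane e) < N.kink p v)}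

lemma nrm_injective : Function.Injective nrm := fun a b h => by
  have h0 := congrFun h 0
  have h1 := congrFun h 1
  simp only [nrm, Matrix.cons_val_zero, Matrix.cons_val_one, neg_inj] at h0 h1
  ext i; fin_cases i
  exacts [h1, h0]

variable {N} in
-- The set of maxima is convex, so a point of it that is lowest locally is lowest globally.
-- Strictness in the directions `v` with `lam v ≤ 0` says that no maximum other than `p` is as low.
lemma HasForm.isLowest_iff {F : TropicalPolynomial} {p : Plane} {a : Lattice}
    (h : N.HasForm F.eval p a) (e : Lattice) :
    F.IsLowest (a - nrm e) p ↔ e ∈ N.lowVectors p := by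
  have hmax := h.isMax_iff F.concaveOn_eval (a - nrm e)
  simp only [sub_sub_cancel, toPlane_nrm_dotProduct] at hmax
  constructor
  · rintro ⟨h1, h2⟩ v
    have h3 := hmax.mp h1
    refine ⟨h3 v, fun hv hlam => lt_of_le_of_ne (h3 v) fun heq => ?_⟩
    obtain ⟨ε, hε, hpos⟩ := ((h.eventually_smul v).and eventually_pos_right).exists
    have hmem : p + ε • v ∈ F.argmax (a - nrm e) := by
      intro y
      refine (h1 y).trans (le_of_eq ?_)
      rw [hε, dotProduct_add, dotProduct_smul, smul_eq_mul, ← heq, toPlane_sub, sub_dotProduct,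
        sub_dotProduct, toPlane_nrm_dotProduct, toPlane_nrm_dotProduct]
      ring
    have h4 := h2 _ hmem (by
      rw [lam_add, lam_smul]
      have := mul_nonpos_of_nonneg_of_nonpos hpos.le hlam
      linarith)
    have h5 : ε • v = 0 := by simpa using h4
    rcases smul_eq_zero.mp h5 with h6 | h6
    exacts [hpos.ne' h6, hv h6]
  · intro he
    have h1 : p ∈ F.argmax (a - nrm e) := hmax.mpr fun v => (he v).1
    refine ⟨h1, fun x hx hlam => ?_⟩
    by_contra hxp
    obtain ⟨ε, hε, hpos, hlt⟩ := ((h.eventually_smul (x - p)).and (eventually_pos_right.and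
      (mem_nhdsWithin_of_mem_nhds (gt_mem_nhds one_pos) :
        ∀ᶠ ε in 𝓝[>] (0 : ℝ), ε < 1))).exists
    have h2 := (he (x - p)).2 (sub_ne_zero.mpr hxp) (by rw [lam_sub]; linarith)
    have hmem : p + ε • (x - p) ∈ F.argmax (a - nrm e) := by
      have h3 := F.convex_argmax _ h1 hx (show 0 ≤ 1 - ε by linarith) hpos.le (by ring)
      have h5 : (1 - ε) • p + ε • x = p + ε • (x - p) := by
        rw [sub_smul, one_smul, smul_sub]; abel
      rwa [h5] at h3
    have h4 := hmem p
    rw [hε, dotProduct_add, dotProduct_smul, smul_eq_mul, toPlane_sub, sub_dotProduct,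
      sub_dotProduct, toPlane_nrm_dotProduct, toPlane_nrm_dotProduct] at h4
    have h6 := mul_lt_mul_of_pos_left h2 hpos
    linarith

variable {N} in
lemma HasForm.setOf_isLowest {F : TropicalPolynomial} {p : Plane} {a : Lattice}
    (h : N.HasForm F.eval p a) :
    {z | F.IsLowest z p} = (fun e => a - nrm e) '' N.lowVectors p := by
  ext z
  constructor
  · intro hz
    obtain ⟨e, he⟩ := exists_nrm_eq (a - z)
    refine ⟨e, (h.isLowest_iff e).mp ?_, ?_⟩
    · rw [he, sub_sub_cancel]; exact hz
    · simp [he]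
  · rintro ⟨e, he, rfl⟩
    exact (h.isLowest_iff e).mpr he

/-- The only candidates are the slopes on the two sides of the edge. Each is maximal along the whole
germ of a half-plane, which contains one of the level directions `±kerVec`, so `p` is not lowest. -/
lemma lowVectors_eq_empty_of_kink {p : Plane} {d : Lattice} (hd : IsPrimitive d)
    (hpos : 0 < lam (toPlane d)) (h : ∀ v, N.kink p v = max 0 (dt v (toPlane d))) :
    N.lowVectors p = ∅ := by
  rw [Set.eq_empty_iff_forall_notMem]
  intro e he
  have h1 := (he kerVec).2 kerVec_ne_zero (by simp)
  have h2 := (he (-kerVec)).2 (neg_ne_zero.mpr kerVec_ne_zero) (by simp)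
  have h3 : nrm e = 0 ∨ nrm e = nrm d := by
    refine eq_or_eq_nrm_of_dotProduct_le hd hpos fun v => ?_
    rw [toPlane_nrm_dotProduct, ← h]
    exact (he v).1
  rw [h, ← toPlane_nrm_dotProduct] at h1 h2
  rw [dt_kerVec, max_eq_right hpos.le] at h1
  rw [dt_neg_left, dt_kerVec, max_eq_left (by linarith)] at h2
  rcases h3 with h3 | h3
  · rw [h3] at h2; simp at h2
  · rw [h3, toPlane_nrm_dotProduct] at h1; simp at h1

lemma cramer (d e f v : Plane) :
    dt d e * dt v f = -dt e f * dt v d + dt d f * dt v e := by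
  simp only [dt]; ring

/-- The four inequalities are the conditions at `±d` and `±e`, strict for the downward vectors.
Conversely, `cramer` expresses m f in terms of `d` and `e` with coefficients in [0, m) and (0, m],
where m is the determinant. Equality would need `dt v d ≤ 0 ≤ dt v e`, which for `lam v ≤ 0` forces
`v = 0` by `plucker`. -/
lemma lowVectors_node {p : Plane} {d e : Lattice} (hdpos : 0 < lam (toPlane d))
    (hepos : 0 < lam (toPlane e)) (hdet : 0 < det₂ d e)
    (h : ∀ v, N.kink p v = max 0 (dt v (toPlane d)) + max 0 (dt v (toPlane e))) :
    N.lowVectors p = {f | (0 < det₂ d f ∧ det₂ d f ≤ det₂ d e) ∧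
      (-det₂ d e < det₂ e f ∧ det₂ e f ≤ 0)} := by
  have hm : (0 : ℝ) < dt (toPlane d) (toPlane e) := by rw [← det₂_cast]; exact_mod_cast hdet
  have hm' := dt_swap (toPlane e) (toPlane d)
  have hdne : toPlane d ≠ 0 := by rintro h0; rw [h0] at hdpos; simp at hdpos
  have hene : toPlane e ≠ 0 := by rintro h0; rw [h0] at hepos; simp at hepos
  ext f
  have hcast : f ∈ {f | (0 < det₂ d f ∧ det₂ d f ≤ det₂ d e) ∧
      (-det₂ d e < det₂ e f ∧ det₂ e f ≤ 0)} ↔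
      (0 < dt (toPlane d) (toPlane f) ∧ dt (toPlane d) (toPlane f) ≤ dt (toPlane d) (toPlane e)) ∧
      (-dt (toPlane d) (toPlane e) < dt (toPlane e) (toPlane f) ∧
        dt (toPlane e) (toPlane f) ≤ 0) := by
    simp only [← det₂_cast]; norm_cast
  rw [hcast]
  constructor
  · intro hf
    have h1 := (hf (toPlane d)).1
    have h2 := (hf (-toPlane d)).2 (neg_ne_zero.mpr hdne) (by rw [lam_neg]; linarith)
    have h3 := (hf (toPlane e)).1
    have h4 := (hf (-toPlane e)).2 (neg_ne_zero.mpr hene) (by rw [lam_neg]; linarith)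
    simp only [h, dt_neg_left, dt_self, neg_zero, max_self, zero_add, add_zero, hm', neg_neg]
      at h1 h2 h3 h4
    rw [max_eq_right hm.le] at h1 h4
    rw [max_eq_left (by linarith)] at h2 h3
    exact ⟨⟨by linarith, h1⟩, by linarith, h3⟩
  · rintro ⟨⟨h1, h2⟩, h3, h4⟩ v
    have hc := cramer (toPlane d) (toPlane e) (toPlane f) v
    have hp := plucker v (toPlane d) (toPlane e)
    rw [h]
    have b1 : -dt (toPlane e) (toPlane f) * dt v (toPlane d) ≤
        dt (toPlane d) (toPlane e) * max 0 (dt v (toPlane d)) := by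
      rcases le_total 0 (dt v (toPlane d)) with h5 | h5
      · rw [max_eq_right h5]; exact mul_le_mul_of_nonneg_right (by linarith) h5
      · rw [max_eq_left h5, mul_zero]; exact mul_nonpos_of_nonneg_of_nonpos (by linarith) h5
    have b2 : dt (toPlane d) (toPlane f) * dt v (toPlane e) ≤
        dt (toPlane d) (toPlane e) * max 0 (dt v (toPlane e)) := by
      rcases le_total 0 (dt v (toPlane e)) with h5 | h5
      · rw [max_eq_right h5]; exact mul_le_mul_of_nonneg_right h2 h5
      · rw [max_eq_left h5, mul_zero]; exact mul_nonpos_of_nonneg_of_nonpos h1.le h5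
    refine ⟨le_of_mul_le_mul_left (by rw [hc, mul_add]; linarith) hm, fun hv hlam => ?_⟩
    refine lt_of_mul_lt_mul_left ?_ hm.le
    rw [hc, mul_add]
    by_cases c1 : 0 < dt v (toPlane d)
    · have : -dt (toPlane e) (toPlane f) * dt v (toPlane d) <
          dt (toPlane d) (toPlane e) * max 0 (dt v (toPlane d)) := by
        rw [max_eq_right c1.le]; exact mul_lt_mul_of_pos_right (by linarith) c1
      linarith
    by_cases c2 : dt v (toPlane e) < 0
    · have : dt (toPlane d) (toPlane f) * dt v (toPlane e) <
          dt (toPlane d) (toPlane e) * max 0 (dt v (toPlane e)) := by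
        rw [max_eq_left c2.le, mul_zero]; exact mul_neg_of_pos_of_neg h1 c2
      linarith
    exfalso
    have c1 : dt v (toPlane d) ≤ 0 := not_lt.mp c1
    have c2 : 0 ≤ dt v (toPlane e) := not_lt.mp c2
    have e1 := mul_nonpos_of_nonpos_of_nonneg c1 hepos.le
    have e2 := mul_nonneg c2 hdpos.le
    have e3 := mul_nonneg (neg_nonneg.mpr hlam) hm.le
    have e4 : dt v (toPlane d) * lam (toPlane e) = 0 := by linarith
    have e5 : dt v (toPlane e) * lam (toPlane d) = 0 := by linarith
    exact hv (eq_zero_of_dt hm.ne' ((mul_eq_zero.mp e4).resolve_right hepos.ne')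
      ((mul_eq_zero.mp e5).resolve_right hdpos.ne'))

lemma det₂_add_right (a b c : Lattice) : det₂ a (b + c) = det₂ a b + det₂ a c := by
  simp [det₂]; ring

lemma det₂_sub_right (a b c : Lattice) : det₂ a (b - c) = det₂ a b - det₂ a c := by
  simp [det₂]; ring

lemma det₂_zsmul_right (k : ℤ) (a b : Lattice) : det₂ a (k • b) = k * det₂ a b := by
  simp [det₂]; ring

/-- The number of lattice points of a half-open parallelogram. -/
lemma ncard_parallelogram {d e : Lattice} (hd : IsPrimitive d) (hdet : 0 < det₂ d e) :
    {f | (0 < det₂ d f ∧ det₂ d f ≤ det₂ d e) ∧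
      (-det₂ d e < det₂ e f ∧ det₂ e f ≤ 0)}.Finite ∧
    {f | (0 < det₂ d f ∧ det₂ d f ≤ det₂ d e) ∧
      (-det₂ d e < det₂ e f ∧ det₂ e f ≤ 0)}.ncard = (det₂ d e).natAbs := by
  set A := {f | (0 < det₂ d f ∧ det₂ d f ≤ det₂ d e) ∧
      (-det₂ d e < det₂ e f ∧ det₂ e f ≤ 0)} with hA
  have hinj : Set.InjOn (det₂ d) A := by
    -- Two points with the same determinant with `d` differ by a multiple k of `d`. This changes the
    -- determinant with `e` by -k times the side of the parallelogram, and the half-open range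
    -- admits only k = 0.
    rintro f ⟨-, hf1, hf2⟩ g ⟨-, hg1, hg2⟩ hfg
    obtain ⟨k, hk⟩ := hd.exists_smul_eq (e := f - g) (by rw [det₂_sub_right, hfg, sub_self])
    have h1 : det₂ e (f - g) = -(k * det₂ d e) := by
      rw [hk, det₂_zsmul_right, det₂_swap e d]; ring
    rw [det₂_sub_right] at h1
    have h2 : k * det₂ d e < 1 * det₂ d e := by linarith
    have h3 : (-1) * det₂ d e < k * det₂ d e := by linarith
    have h4 := lt_of_mul_lt_mul_right h2 hdet.le
    have h5 := lt_of_mul_lt_mul_right h3 hdet.le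
    obtain rfl : k = 0 := by omega
    rw [zero_smul] at hk
    exact sub_eq_zero.mp hk
  have himage : det₂ d '' A = Set.Ioc 0 (det₂ d e) := by
    ext y
    constructor
    · rintro ⟨f, hf, rfl⟩
      exact hf.1
    · intro hy
      obtain ⟨f, hf⟩ := hd.exists_det₂_eq y
      -- Adding a multiple of `d` preserves the determinant with `d`; Euclidean division brings the
      -- one with `e` into the half-open range.
      refine ⟨f + (-((-det₂ e f) / det₂ d e)) • d, ⟨⟨?_, ?_⟩, ?_, ?_⟩, ?_⟩
      · rw [det₂_add_right, det₂_zsmul_right, det₂_self, hf]; simpa using hy.1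
      · rw [det₂_add_right, det₂_zsmul_right, det₂_self, hf]; simpa using hy.2
      · rw [det₂_add_right, det₂_zsmul_right, det₂_swap e d]
        have h1 := Int.emod_lt_of_pos (-det₂ e f) hdet
        have h2 := Int.mul_ediv_add_emod (-det₂ e f) (det₂ d e)
        linarith
      · rw [det₂_add_right, det₂_zsmul_right, det₂_swap e d]
        have h1 := Int.emod_nonneg (-det₂ e f) hdet.ne'
        have h2 := Int.mul_ediv_add_emod (-det₂ e f) (det₂ d e)
        linarith
      · rw [det₂_add_right, det₂_zsmul_right, det₂_self, hf]; simp
  have hfin : A.Finite := Set.Finite.of_finite_image (himage ▸ Set.finite_Ioc _ _) hinj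
  refine ⟨hfin, ?_⟩
  rw [← hinj.ncard_image, himage, ← Finset.coe_Ioc, Set.ncard_coe_finset,
    Int.card_Ioc]
  omega

/-- For an integral vector `f`, the strict conditions at `-d` and `-e` give determinants at least 1
and at least 0, whereas the condition at `d + e` bounds their sum by 0. -/
lemma lowVectors_merge {p : Plane} {d e : Lattice} (hdpos : 0 < lam (toPlane d))
    (hepos : 0 < lam (toPlane e)) (hdet : det₂ d e = 1)
    (h1 : ∀ v, 0 ≤ lam v → N.kink p v = max 0 (dt v (toPlane (d + e))))
    (h2 : ∀ v, lam v < 0 → N.kink p v = max 0 (dt v (toPlane d)) + max 0 (dt v (toPlane e))) :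
    N.lowVectors p = ∅ := by
  have hm : dt (toPlane d) (toPlane e) = 1 := by rw [← det₂_cast, hdet]; simp
  have hm' := dt_swap (toPlane e) (toPlane d)
  have hdne : toPlane d ≠ 0 := by rintro h0; rw [h0] at hdpos; simp at hdpos
  have hene : toPlane e ≠ 0 := by rintro h0; rw [h0] at hepos; simp at hepos
  rw [Set.eq_empty_iff_forall_notMem]
  intro f hf
  have b1 := (hf (-toPlane d)).2 (neg_ne_zero.mpr hdne) (by rw [lam_neg]; linarith)
  have b2 := (hf (-toPlane e)).2 (neg_ne_zero.mpr hene) (by rw [lam_neg]; linarith)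
  have b3 := (hf (toPlane d + toPlane e)).1
  rw [h2 _ (by rw [lam_neg]; linarith)] at b1 b2
  rw [h1 _ (by rw [lam_add]; linarith)] at b3
  simp only [dt_neg_left, dt_self, hm', hm, toPlane_add, dt_add_left] at b1 b2 b3
  norm_num at b1 b2 b3
  rw [← det₂_cast] at b1 b2 b3
  rw [← det₂_cast] at b3
  norm_cast at b1 b2 b3
  have b2' : -(det₂ e f) < 1 := by exact_mod_cast b2
  omega

/-- The conditions at `-(d + e)`, `d` and `e` force the determinants of `d` and `e` with `f` to be 1
and 0, which `e` alone satisfies. This is the slope of the sector that opens between the two upward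
edges. -/
lemma lowVectors_split {p : Plane} {d e : Lattice} (hdpos : 0 < lam (toPlane d))
    (hepos : 0 < lam (toPlane e)) (hdet : det₂ d e = 1)
    (h1 : ∀ v, 0 ≤ lam v → N.kink p v = max 0 (dt v (toPlane d)) + max 0 (dt v (toPlane e)))
    (h2 : ∀ v, lam v < 0 → N.kink p v = max 0 (dt v (toPlane (d + e)))) :
    N.lowVectors p = {e} := by
  have hm : dt (toPlane d) (toPlane e) = 1 := by rw [← det₂_cast, hdet]; simp
  have hm' := dt_swap (toPlane e) (toPlane d)
  ext f
  rw [Set.mem_singleton_iff]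
  constructor
  · intro hf
    have hlam : lam (-(toPlane d + toPlane e)) < 0 := by rw [lam_neg, lam_add]; linarith
    have b1 := (hf (-(toPlane d + toPlane e))).2 (by
      intro h0; rw [h0, lam_zero] at hlam; exact lt_irrefl _ hlam) hlam.le
    have b2 := (hf (toPlane d)).1
    have b3 := (hf (toPlane e)).1
    rw [h2 _ hlam] at b1
    rw [h1 _ hdpos.le] at b2
    rw [h1 _ hepos.le] at b3
    simp only [dt_neg_left, dt_self, hm', hm, toPlane_add, dt_add_left, dt_add_right] at b1 b2 b3
    norm_num at b1 b2 b3
    rw [← det₂_cast] at b1 b2 b3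
    rw [← det₂_cast] at b1
    have b1' : 0 < det₂ d f + det₂ e f := by
      have : (0 : ℝ) < det₂ d f + det₂ e f := by linarith
      exact_mod_cast this
    have b2' : det₂ d f ≤ 1 := by exact_mod_cast b2
    have b3' : det₂ e f ≤ 0 := by exact_mod_cast b3
    have c1 : det₂ d f = 1 := by omega
    have c2 : det₂ e f = 0 := by omega
    have he : IsPrimitive e := isPrimitive_of_det₂ (e := d) (by
      rw [det₂_swap, hdet]; exact isUnit_one.neg)
    obtain ⟨k, rfl⟩ := he.exists_smul_eq c2
    rw [det₂_zsmul_right, hdet, mul_one] at c1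
    rw [c1, one_smul]
  · rintro rfl v
    have hp := plucker v (toPlane d) (toPlane f)
    rw [hm, mul_one] at hp
    have hstrict : v ≠ 0 → lam v ≤ 0 → dt v (toPlane f) < N.kink p v := by
      intro hv hlam
      rcases hlam.eq_or_lt with h0 | h0
      · rw [h1 _ h0.ge]
        rw [h0, neg_zero, sub_eq_zero] at hp
        rcases lt_trichotomy (dt v (toPlane f)) 0 with c | c | c
        · exact c.trans_le (add_nonneg (le_max_left _ _) (le_max_left _ _))
        · exfalso
          rw [c, zero_mul] at hp
          exact hv (eq_zero_of_dt (by rw [hm]; norm_num)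
            ((mul_eq_zero.mp hp).resolve_right hepos.ne') c)
        · have c' : 0 < dt v (toPlane d) := by
            have := mul_pos c hdpos
            rw [← hp] at this
            exact pos_of_mul_pos_left this hepos.le
          rw [max_eq_right c.le, max_eq_right c'.le]; linarith
      · rw [h2 _ h0, toPlane_add, dt_add_right]
        by_cases c : 0 < dt v (toPlane d)
        · exact lt_max_of_lt_right (by linarith)
        · refine lt_max_of_lt_left ?_
          by_contra! c'
          have e1 := mul_nonpos_of_nonpos_of_nonneg (not_lt.mp c) hepos.le
          have e2 := mul_nonneg c' hdpos.le
          linarith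
    refine ⟨?_, hstrict⟩
    by_cases hlam : 0 ≤ lam v
    · rw [h1 _ hlam]
      have := le_max_left 0 (dt v (toPlane d))
      have := le_max_right 0 (dt v (toPlane f))
      linarith
    · refine (hstrict ?_ (not_le.mp hlam).le).le
      rintro rfl
      simp at hlam

end NetData

namespace Net

variable {C : Set Plane} (N : Net.{u} C)

lemma lowVectors_of_notMem {p : Plane} (hp : p ∉ C) : N.lowVectors p = ∅ := by
  rw [Set.eq_empty_iff_forall_notMem]
  intro e he
  have h1 := (he kerVec).2 kerVec_ne_zero (by simp)
  have h2 := (he (-kerVec)).2 (neg_ne_zero.mpr kerVec_ne_zero) (by simp)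
  rw [N.kink_of_notMem hp] at h1 h2
  simp only [dt_neg_left] at h2
  linarith

lemma lowVectors_of_mem_carrier {p : Plane} {e : N.E} (hp : p ∈ N.carrier e) :
    N.lowVectors p = ∅ :=
  N.lowVectors_eq_empty_of_kink (N.prim e) (N.lam_pos e) (N.kink_of_mem_carrier hp)

open Classical in
-- The one formula valid for all local types, arranged so that it can be summed: the 2 or 1 on the
-- left becomes the number of vertices of the net over `p`.
lemma ncard_lowVectors (hC : IsNodalCurve C) {p : Plane} (hp : p ∈ C) :
    (N.lowVectors p).Finite ∧ (N.lowVectors p).ncard + (if p ∈ nodes C then 2 else 1) =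
      (N.up p).card + if p ∈ nodes C then nodeMultiplicity C p else 0 := by
  have hne : ∀ d e : Lattice, 0 < det₂ d e → d ≠ e := by
    rintro d e h rfl
    rw [det₂_self] at h
    exact lt_irrefl _ h
  cases N.localType hC hp with
  | line d hd pos hU hD hp' =>
    rw [N.lowVectors_eq_empty_of_kink hd pos (fun v => by simp [NetData.kink, hU, hD]),
      if_neg hp', if_neg hp', hU]
    simp
  | node d e hd he hdpos hepos hdet hU hD hp' hmul =>
    rw [N.lowVectors_node hdpos hepos hdet (fun v => by
      simp [NetData.kink, hU, hD, Finset.sum_pair (hne d e hdet)]), if_pos hp', if_pos hp', hU,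
      Finset.card_pair (hne d e hdet), hmul, (NetData.ncard_parallelogram hd hdet).2]
    exact ⟨(NetData.ncard_parallelogram hd hdet).1, add_comm _ _⟩
  | merge d e hdpos hepos hdet hU hD hp' =>
    rw [N.lowVectors_merge hdpos hepos hdet (fun v hv => by simp [NetData.kink, hU, hv])
      (fun v hv => by
        simp [NetData.kink, hD, hv.not_ge, Finset.sum_pair (hne d e (by omega))]),
      if_neg hp', if_neg hp', hU]
    simp
  | split d e hdpos hepos hdet hU hD hp' =>
    rw [N.lowVectors_split hdpos hepos hdet (fun v hv => by
        simp [NetData.kink, hU, hv, Finset.sum_pair (hne d e (by omega))])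
      (fun v hv => by simp [NetData.kink, hD, hv.not_ge]),
      if_neg hp', if_neg hp', hU, Finset.card_pair (hne d e (by omega))]
    simp

open Classical in
/-- The vertices of the curve as points of the plane. -/
noncomputable def points : Finset Plane := Finset.univ.image N.pos

lemma mem_points {p : Plane} : p ∈ N.points ↔ ∃ v, N.pos v = p := by simp [points]

/-- Off the curve and inside an edge a maximum can be moved without rising, so lowest points are
vertices and the count is a finite sum. -/
lemma IsLowest.mem_points {F : TropicalPolynomial} (hF : ∀ x, ∃ a, N.HasForm F.eval x a)
    {z : Lattice} {p : Plane} (h : F.IsLowest z p) : p ∈ N.points := by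
  obtain ⟨a, ha⟩ := hF p
  have h1 : z ∈ {z | F.IsLowest z p} := h
  rw [ha.setOf_isLowest] at h1
  obtain ⟨e, he, -⟩ := h1
  by_contra hp
  by_cases hpC : p ∈ C
  · rcases N.mem_iff.mp hpC with hv | ⟨f, hf⟩
    · exact hp (N.mem_points.mpr hv)
    · rw [N.lowVectors_of_mem_carrier hf] at he
      exact he
  · rw [N.lowVectors_of_notMem hpC] at he
    exact he

open Classical in
lemma card_V_eq : Nat.card N.V = ∑ p ∈ N.points, if p ∈ nodes C then 2 else 1 := by
  rw [Nat.card_eq_fintype_card, ← Finset.card_univ,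
    Finset.card_eq_sum_card_image N.pos Finset.univ]
  refine Finset.sum_congr rfl fun p hp => ?_
  obtain ⟨v, rfl⟩ := N.mem_points.mp hp
  have h : ((Finset.univ.filter fun v' => N.pos v' = N.pos v : Finset N.V) : Set N.V) =
      {v' | N.pos v' = N.pos v} := by ext; simp
  rw [← Set.ncard_coe_finset, h]
  split_ifs with h1
  · exact N.fiber_of_mem v h1
  · exact N.fiber_of_notMem v h1

lemma finite_nodes {C : Set Plane} (N : Net.{u} C) : (nodes C).Finite := (Set.finite_range N.pos).subset N.nodes_subset

open Classical in
lemma nodeCount_eq :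
    nodeCount C = ∑ p ∈ N.points, if p ∈ nodes C then nodeMultiplicity C p else 0 := by
  have h : nodes C = ((N.points.filter fun p => p ∈ nodes C : Finset Plane) : Set Plane) := by
    ext p
    simp only [Finset.coe_filter, Set.mem_ofPred_eq, N.mem_points]
    exact ⟨fun hp => ⟨N.nodes_subset hp, hp⟩, fun hp => hp.2⟩
  rw [nodeCount, ← Finset.sum_filter, ← finsum_mem_coe_finset, ← h]

open Classical in
-- Each edge with a lower end is counted once, at the position of that end.
lemma sum_card_up : ∑ p ∈ N.points, (N.up p).card + Nat.card {e // N.lo e = none} =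
    Nat.card N.E := by
  have h1 : ∀ p, (N.up p).card = (N.upEdges p).card := fun p =>
    Finset.card_image_of_injOn (N.injOn_up p)
  have h2 : ∀ p ∈ N.points, ∀ e, e ∈ N.upEdges p ↔ ∃ v, N.lo e = some v ∧ N.pos v = p := by
    intro p hp e
    constructor
    · intro he
      refine (N.eq_pos_or_mem_carrier_of_up he).resolve_right fun h => ?_
      obtain ⟨v, rfl⟩ := N.mem_points.mp hp
      exact N.notMem v e h
    · rintro ⟨v, hv, rfl⟩
      refine N.mem_upEdges.mpr ⟨N.dt_lo e v hv, fun v' hv' => ?_, fun w hw => N.lt e v w hv hw⟩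
      rw [hv, Option.some_inj] at hv'
      rw [hv']
  simp only [h1]
  rw [← Finset.card_biUnion]
  · have h3 : N.points.biUnion N.upEdges = Finset.univ.filter fun e => ¬ N.lo e = none := by
      ext e
      simp only [Finset.mem_biUnion, Finset.mem_filter, Finset.mem_univ, true_and]
      constructor
      · rintro ⟨p, hp, he⟩
        obtain ⟨v, hv, -⟩ := (h2 p hp e).mp he
        rw [hv]; simp
      · intro he
        obtain ⟨v, hv⟩ := Option.ne_none_iff_exists'.mp he
        have hp : N.pos v ∈ N.points := N.mem_points.mpr ⟨v, rfl⟩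
        exact ⟨N.pos v, hp, (h2 _ hp e).mpr ⟨v, hv, rfl⟩⟩
    rw [h3, Nat.card_eq_fintype_card, Nat.card_eq_fintype_card, Fintype.card_subtype, add_comm,
      Finset.card_filter_add_card_filter_not, Finset.card_univ]
  · intro p hp q hq hpq
    rw [Function.onFun, Finset.disjoint_left]
    intro e he he'
    obtain ⟨v, hv, rfl⟩ := (h2 p hp e).mp he
    obtain ⟨w, hw, rfl⟩ := (h2 q hq e).mp he'
    rw [hv, Option.some_inj] at hw
    exact hpq (by rw [hw])

lemma pos_mem (v : N.V) : N.pos v ∈ C := N.mem_iff.mpr (Or.inl ⟨v, rfl⟩)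

open Classical in
/-- The number of lattice points `z` such that `F - z` has a lowest maximum. -/
theorem ncard_exists_isLowest (hC : IsNodalCurve C) {F : TropicalPolynomial}
    (hF : ∀ x, ∃ a, N.HasForm F.eval x a) :
    {z | ∃ p, F.IsLowest z p}.Finite ∧ {z | ∃ p, F.IsLowest z p}.ncard + Nat.card N.V =
      ∑ p ∈ N.points, (N.up p).card + nodeCount C := by
  have hmem : ∀ p ∈ N.points, p ∈ C := by
    intro p hp
    obtain ⟨v, rfl⟩ := N.mem_points.mp hp
    exact N.pos_mem v
  have hinj : ∀ a : Lattice, Function.Injective fun e => a - nrm e := fun a e f h =>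
    NetData.nrm_injective (sub_right_injective h)
  have hfin : ∀ p, {z | F.IsLowest z p}.Finite := by
    intro p
    obtain ⟨a, ha⟩ := hF p
    rw [ha.setOf_isLowest]
    by_cases hp : p ∈ C
    · exact (N.ncard_lowVectors hC hp).1.image _
    · rw [N.lowVectors_of_notMem hp, Set.image_empty]; exact Set.finite_empty
  have hcard : ∀ p, {z | F.IsLowest z p}.ncard = (N.lowVectors p).ncard := by
    intro p
    obtain ⟨a, ha⟩ := hF p
    rw [ha.setOf_isLowest, Set.ncard_image_of_injective _ (hinj a)]
  have hS : {z | ∃ p, F.IsLowest z p} =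
      ((N.points.biUnion fun p => (hfin p).toFinset : Finset Lattice) : Set Lattice) := by
    ext z
    simp only [Set.mem_ofPred_eq, Finset.coe_biUnion, Set.Finite.coe_toFinset, Set.mem_iUnion,
      Finset.mem_coe, exists_prop]
    constructor
    · rintro ⟨p, hp⟩
      exact ⟨p, IsLowest.mem_points N hF hp, hp⟩
    · rintro ⟨p, -, hp⟩
      exact ⟨p, hp⟩
  rw [hS]
  refine ⟨Finset.finite_toSet _, ?_⟩
  rw [Set.ncard_coe_finset, Finset.card_biUnion, N.card_V_eq, N.nodeCount_eq,
    ← Finset.sum_add_distrib, ← Finset.sum_add_distrib]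
  · refine Finset.sum_congr rfl fun p hp => ?_
    rw [← Set.ncard_eq_toFinset_card _ (hfin p), hcard]
    exact (N.ncard_lowVectors hC (hmem p hp)).2
  · intro p hp q hq hpq
    rw [Function.onFun, Finset.disjoint_left]
    intro z hz hz'
    rw [Set.Finite.mem_toFinset] at hz hz'
    rcases le_total (lam p) (lam q) with h | h
    · exact hpq (hz'.2 p hz.1 h)
    · exact hpq (hz.2 q hz'.1 h).symm

end Net

end TropicalPlane

namespace TropicalPlane

/-! ### Lattice points of the Newton polygon and maxima -/

lemma dotProduct_self_pos {u : Plane} (hu : u ≠ 0) : 0 < u ⬝ᵥ u := by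
  refine lt_of_le_of_ne ?_ (fun h => hu (dotProduct_self_eq_zero.mp h.symm))
  simp only [dotProduct, Fin.sum_univ_two]
  exact add_nonneg (mul_self_nonneg _) (mul_self_nonneg _)

lemma abs_dotProduct_le (x y : Plane) : |x ⬝ᵥ y| ≤ 2 * (‖x‖ * ‖y‖) := by
  have h : ∀ i, |x i * y i| ≤ ‖x‖ * ‖y‖ := fun i => by
    rw [abs_mul]
    exact mul_le_mul (norm_le_pi_norm x i) (norm_le_pi_norm y i) (abs_nonneg _) (norm_nonneg _)
  simp only [dotProduct, Fin.sum_univ_two]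
  linarith [abs_add_le (x 0 * y 0) (x 1 * y 1), h 0, h 1]

/-- A uniform version of the statement that finitely many linear forms are nowhere all
non-negative. -/
lemma exists_uniform_neg (s : Finset Plane) (hs : ∀ u : Plane, u ≠ 0 → ∃ y ∈ s, y ⬝ᵥ u < 0) :
    ∃ δ : ℝ, 0 < δ ∧ ∀ u : Plane, ∃ y ∈ s, y ⬝ᵥ u ≤ -δ * ‖u‖ := by
  have hne : s.Nonempty := by
    obtain ⟨y, hy, -⟩ := hs kerVec kerVec_ne_zero
    exact ⟨y, hy⟩
  set Φ : Plane → ℝ := fun u => s.inf' hne fun y => y ⬝ᵥ u with hΦ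
  have hcont : Continuous Φ := Continuous.finset_inf'_apply hne fun y _ => by
    unfold dotProduct; fun_prop
  have hsph : (Metric.sphere (0 : Plane) 1).Nonempty := NormedSpace.sphere_nonempty.mpr zero_le_one
  -- The least of the forms is continuous and negative on the unit sphere; its maximum there is -δ,
  -- and homogeneity does the rest.
  obtain ⟨u₀, hu₀, hmax⟩ := (isCompact_sphere (0 : Plane) 1).exists_isMaxOn hsph hcont.continuousOn
  have hu₀' : u₀ ≠ 0 := by
    rintro rfl
    simp at hu₀
  have hneg : Φ u₀ < 0 := by
    obtain ⟨y, hy, h⟩ := hs u₀ hu₀'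
    exact (Finset.inf'_le _ hy).trans_lt h
  refine ⟨-Φ u₀, by linarith, fun u => ?_⟩
  by_cases hu : u = 0
  · obtain ⟨y, hy⟩ := hne
    exact ⟨y, hy, by simp [hu]⟩
  · have hnorm : 0 < ‖u‖ := norm_pos_iff.mpr hu
    have hmem : ‖u‖⁻¹ • u ∈ Metric.sphere (0 : Plane) 1 := by
      simp [norm_smul, hnorm.ne']
    obtain ⟨y, hy, h⟩ := Finset.exists_mem_eq_inf' hne fun y => y ⬝ᵥ (‖u‖⁻¹ • u)
    refine ⟨y, hy, ?_⟩
    have h1 : y ⬝ᵥ (‖u‖⁻¹ • u) ≤ Φ u₀ := by rw [← h]; exact hmax hmem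
    rw [dotProduct_smul, smul_eq_mul, inv_mul_le_iff₀ hnorm] at h1
    linarith

namespace TropicalPolynomial

variable {F : TropicalPolynomial} {z : Lattice}

lemma exists_linear_eq (f : Plane →L[ℝ] ℝ) : ∃ u : Plane, ∀ y, f y = y ⬝ᵥ u := by
  refine ⟨fun i => f (Pi.single i 1), fun y => ?_⟩
  have h : y = ∑ i, y i • (Pi.single i (1 : ℝ) : Plane) := by
    ext j; fin_cases j <;> simp
  conv_lhs => rw [h]
  rw [map_sum]
  simp [dotProduct]

/-- A point is interior precisely when no linear form attains its minimum over the polygon there.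
One direction uses a supporting half-plane; the other separates a nearby point from the polygon and
contradicts the uniform bound. -/
theorem mem_interior_newtonPolygon_iff : toPlane z ∈ interior F.newtonPolygon ↔
    ∀ u : Plane, u ≠ 0 → ∃ a ∈ F.support, toPlane (a - z) ⬝ᵥ u < 0 := by
  classical
  constructor
  · intro hz u hu
    by_contra! hcon
    have hsub : F.newtonPolygon ⊆ {y | toPlane z ⬝ᵥ u ≤ y ⬝ᵥ u} := by
      refine convexHull_min ?_ ?_
      · rintro _ ⟨a, ha, rfl⟩
        have := hcon a ha
        rw [toPlane_sub, sub_dotProduct] at this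
        change toPlane z ⬝ᵥ u ≤ toPlane a ⬝ᵥ u
        linarith
      · intro x hx y hy s t hs ht hst
        have h1 := mul_le_mul_of_nonneg_left (show toPlane z ⬝ᵥ u ≤ x ⬝ᵥ u from hx) hs
        have h2 := mul_le_mul_of_nonneg_left (show toPlane z ⬝ᵥ u ≤ y ⬝ᵥ u from hy) ht
        change toPlane z ⬝ᵥ u ≤ (s • x + t • y) ⬝ᵥ u
        rw [add_dotProduct, smul_dotProduct, smul_dotProduct, smul_eq_mul, smul_eq_mul]
        have h3 : (s + t) * (toPlane z ⬝ᵥ u) = toPlane z ⬝ᵥ u := by rw [hst, one_mul]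
        linarith
    obtain ⟨t, ht, hpos⟩ := (((tendsto_add_smul (toPlane z) (-u)).eventually
      (isOpen_interior.mem_nhds hz)).and NetData.eventually_pos_right).exists
    have h1 : toPlane z ⬝ᵥ u ≤ (toPlane z + t • -u) ⬝ᵥ u := hsub (interior_subset ht)
    rw [add_dotProduct, smul_dotProduct, neg_dotProduct, smul_eq_mul] at h1
    have := mul_pos hpos (dotProduct_self_pos hu)
    linarith
  · intro h
    obtain ⟨δ, hδ, huni⟩ := exists_uniform_neg (F.support.image fun a => toPlane (a - z))
      fun u hu => by
        obtain ⟨a, ha, hau⟩ := h u hu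
        exact ⟨_, Finset.mem_image_of_mem _ ha, hau⟩
    have hclosed : IsClosed F.newtonPolygon :=
      ((F.support.finite_toSet.image toPlane).isCompact_convexHull (𝕜 := ℝ)).isClosed
    rw [mem_interior_iff_mem_nhds, Metric.mem_nhds_iff]
    -- The 2 compensates the constant in `abs_dotProduct_le`, which compares the pairing with the
    -- sup norm.
    refine ⟨δ / 2, by positivity, fun y hy => ?_⟩
    by_contra hyn
    obtain ⟨f, c, hf1, hf2⟩ := geometric_hahn_banach_point_closed (convex_convexHull ℝ _) hclosed hyn
    obtain ⟨u, hu⟩ := exists_linear_eq f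
    obtain ⟨_, hmem, hle⟩ := huni u
    obtain ⟨a, ha, rfl⟩ := Finset.mem_image.mp hmem
    have h1 := hf1.trans (hf2 (toPlane a) (subset_convexHull ℝ _ ⟨a, ha, rfl⟩))
    rw [hu, hu] at h1
    have h2 := neg_abs_le ((y - toPlane z) ⬝ᵥ u)
    have h3 := abs_dotProduct_le (y - toPlane z) u
    rw [Metric.mem_ball, dist_eq_norm] at hy
    rw [toPlane_sub, sub_dotProduct] at hle
    rw [sub_dotProduct] at h2 h3
    have h4 := mul_le_mul_of_nonneg_right hy.le (norm_nonneg u)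
    linarith

lemma isClosed_argmax (F : TropicalPolynomial) (z : Lattice) : IsClosed (F.argmax z) := by
  have : F.argmax z = ⋂ y, {x | F.eval y - toPlane z ⬝ᵥ y ≤ F.eval x - toPlane z ⬝ᵥ x} := by
    ext x; simp [argmax]
  rw [this]
  refine isClosed_iInter fun y => isClosed_le continuous_const ?_
  exact F.continuous_eval.sub (continuous_dotProduct_toPlane z)

lemma add_mem_argmax {x u : Plane} (hx : x ∈ F.argmax z)
    (hu : ∀ a ∈ F.support, 0 ≤ toPlane (a - z) ⬝ᵥ u) : x + u ∈ F.argmax z := by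
  intro y
  refine (hx y).trans ?_
  obtain ⟨a, ha, hau⟩ := F.exists_eval_eq (x + u)
  rw [hau, F.term_add, dotProduct_add]
  have h1 := hu a ha
  have h2 := F.eval_le ha x
  rw [toPlane_sub, sub_dotProduct] at h1
  linarith

lemma eval_sub_eq {x y : Plane} (hx : x ∈ F.argmax z) (hy : y ∈ F.argmax z) :
    F.eval x - toPlane z ⬝ᵥ x = F.eval y - toPlane z ⬝ᵥ y := le_antisymm (hy x) (hx y)

/-- A bound for the points of a superlevel set in the directions where `F - z` decreases. -/
lemma mul_norm_le {δ : ℝ} {x₀ x : Plane}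
    (hx : F.eval x₀ - toPlane z ⬝ᵥ x₀ ≤ F.eval x - toPlane z ⬝ᵥ x) {a : Lattice}
    (ha : a ∈ F.support) (hle : toPlane (a - z) ⬝ᵥ (x - x₀) ≤ -δ * ‖x - x₀‖) :
    δ * ‖x - x₀‖ ≤ ∑ a ∈ F.support, |F.term a x₀ - F.eval x₀| := by
  have h1 := F.eval_le ha x
  have h2 : F.term a x = F.term a x₀ + toPlane a ⬝ᵥ (x - x₀) := by
    rw [← F.term_add, add_sub_cancel]
  have h3 := Finset.single_le_sum (f := fun a => |F.term a x₀ - F.eval x₀|)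
    (fun _ _ => abs_nonneg _) ha
  have h4 := le_abs_self (F.term a x₀ - F.eval x₀)
  rw [toPlane_sub, sub_dotProduct, dotProduct_sub (toPlane z)] at hle
  linarith

/-- The uniform bound makes `F - z` decrease at least linearly at infinity, so its superlevel sets
are compact. -/
lemma nonempty_argmax (h : ∀ u : Plane, u ≠ 0 → ∃ a ∈ F.support, toPlane (a - z) ⬝ᵥ u < 0) :
    (F.argmax z).Nonempty := by
  classical
  obtain ⟨δ, hδ, huni⟩ := exists_uniform_neg (F.support.image fun a => toPlane (a - z))
    fun u hu => by
      obtain ⟨a, ha, hau⟩ := h u hu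
      exact ⟨_, Finset.mem_image_of_mem _ ha, hau⟩
  set B : Set Plane := {x | F.eval 0 - toPlane z ⬝ᵥ 0 ≤ F.eval x - toPlane z ⬝ᵥ x} with hB
  have hcont : Continuous fun x => F.eval x - toPlane z ⬝ᵥ x :=
    F.continuous_eval.sub (continuous_dotProduct_toPlane z)
  have hclosed : IsClosed B := isClosed_le continuous_const hcont
  have hbdd : Bornology.IsBounded B := by
    refine Metric.isBounded_iff_subset_closedBall 0 |>.mpr
      ⟨(∑ a ∈ F.support, |F.term a 0 - F.eval 0|) / δ, fun x hx => ?_⟩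
    obtain ⟨_, hmem, hle⟩ := huni (x - 0)
    obtain ⟨a, ha, rfl⟩ := Finset.mem_image.mp hmem
    have := mul_norm_le hx ha hle
    rw [sub_zero] at this
    rw [mem_closedBall_zero_iff, le_div_iff₀ hδ]
    linarith
  obtain ⟨x, hx, hmax⟩ := (Metric.isCompact_of_isClosed_isBounded hclosed hbdd).exists_isMaxOn
    ⟨0, le_refl (F.eval 0 - toPlane z ⬝ᵥ 0)⟩ hcont.continuousOn
  refine ⟨x, fun y => ?_⟩
  by_cases hy : y ∈ B
  · exact hmax hy
  · exact (not_le.mp (show ¬ F.eval 0 - toPlane z ⬝ᵥ 0 ≤ F.eval y - toPlane z ⬝ᵥ y from hy)).le.trans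
      (show F.eval 0 - toPlane z ⬝ᵥ 0 ≤ F.eval x - toPlane z ⬝ᵥ x from hx)

end TropicalPolynomial

namespace NetData

variable {N : NetData.{u}} {F : TropicalPolynomial} {z : Lattice} {x : Plane} {a : Lattice}

/-- Along a segment in the set of maxima the kink is determined by the slopes. -/
lemma HasForm.dotProduct_eq_kink (h : N.HasForm F.eval x a) (hx : x ∈ F.argmax z) {v : Plane}
    {t : ℝ} (ht : 0 < t) (hv : x + t • v ∈ F.argmax z) : toPlane (a - z) ⬝ᵥ v = N.kink x v := by
  obtain ⟨ε, hε, hpos, hlt⟩ := ((h.eventually_smul v).and (eventually_pos_right.and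
    (mem_nhdsWithin_of_mem_nhds (gt_mem_nhds ht) : ∀ᶠ ε in 𝓝[>] (0 : ℝ), ε < t))).exists
  have hmem : x + ε • v ∈ F.argmax z := by
    have h1 : 0 ≤ 1 - ε / t := by
      have := (div_le_one ht).mpr hlt.le
      linarith
    have h2 := F.convex_argmax z hx hv h1 (div_nonneg hpos.le ht.le) (by ring)
    have h3 : (1 - ε / t) • x + (ε / t) • (x + t • v) = x + ε • v := by
      rw [sub_smul, one_smul, smul_add, smul_smul, div_mul_cancel₀ _ ht.ne']; abel
    rwa [h3] at h2
  have h1 := TropicalPolynomial.eval_sub_eq hx hmem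
  rw [hε, dotProduct_add, dotProduct_smul, smul_eq_mul] at h1
  rw [toPlane_sub, sub_dotProduct]
  have h2 : ε * (toPlane a ⬝ᵥ v - toPlane z ⬝ᵥ v - N.kink x v) = 0 := by linarith
  have := (mul_eq_zero.mp h2).resolve_left hpos.ne'
  linarith

lemma HasForm.eventually_mem_argmax (h : N.HasForm F.eval x a) (hx : x ∈ F.argmax z) {v : Plane}
    (hv : toPlane (a - z) ⬝ᵥ v = N.kink x v) : ∀ᶠ ε in 𝓝[>] (0 : ℝ), x + ε • v ∈ F.argmax z := by
  filter_upwards [h.eventually_smul v] with ε hε y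
  refine (hx y).trans (le_of_eq ?_)
  rw [hε, dotProduct_add, dotProduct_smul, smul_eq_mul, ← hv, toPlane_sub, sub_dotProduct]
  ring

end NetData

namespace Net

variable {C : Set Plane} (N : Net.{u} C) {F : TropicalPolynomial} {z : Lattice}

/-- The set of maxima contains no horizontal segment through a point of the curve. -/
lemma notMem_of_segment (hC : IsNodalCurve C) (hF : ∀ x, ∃ a, N.HasForm F.eval x a) {m : Plane}
    (hm : m ∈ F.argmax z) {s t : ℝ} (hs : 0 < s) (ht : 0 < t)
    (h1 : m + s • kerVec ∈ F.argmax z) (h2 : m + t • -kerVec ∈ F.argmax z) :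
    m ∉ C ∧ N.HasForm F.eval m z := by
  obtain ⟨a, ha⟩ := hF m
  have e1 := ha.dotProduct_eq_kink hm hs h1
  have e2 := ha.dotProduct_eq_kink hm ht h2
  rw [N.kink_neg_kerVec, dotProduct_neg] at e2
  have e3 := eq_zero_of_dotProduct_kerVec (z := a - z) (by linarith)
  rw [sub_eq_zero] at e3
  subst e3
  refine ⟨fun hmC => ?_, ha⟩
  have := N.kink_kerVec_pos hC hmC
  linarith

/-- The maxima below a given level form a compact set, so `lam` has a minimum on all maxima. Two
minimisers would span a level segment whose midpoint is off the curve by `notMem_of_segment`; all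
points near it would be maxima, including lower ones. -/
theorem exists_isLowest (hC : IsNodalCurve C) (hF : ∀ x, ∃ a, N.HasForm F.eval x a)
    (hne : (F.argmax z).Nonempty)
    (h : ∀ u : Plane, u ≠ 0 → lam u ≤ 0 → ∃ a ∈ F.support, toPlane (a - z) ⬝ᵥ u < 0) :
    ∃ p, F.IsLowest z p := by
  classical
  have hlamdot : ∀ u : Plane, (![-1, -√2] : Plane) ⬝ᵥ u = -lam u := fun u => by
    simp [dotProduct, Fin.sum_univ_two, lam]; ring
  -- The added vector represents `-lam`, negative on the directions that go up; the hypothesis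
  -- covers the others.
  obtain ⟨δ, hδ, huni⟩ := exists_uniform_neg
    (insert ![-1, -√2] (F.support.image fun a => toPlane (a - z))) fun u hu => by
      by_cases hlam : lam u ≤ 0
      · obtain ⟨a, ha, hau⟩ := h u hu hlam
        exact ⟨_, Finset.mem_insert_of_mem (Finset.mem_image_of_mem _ ha), hau⟩
      · exact ⟨_, Finset.mem_insert_self _ _, by rw [hlamdot]; linarith⟩
  obtain ⟨x₀, hx₀⟩ := hne
  set B : Set Plane := F.argmax z ∩ {x | lam x ≤ lam x₀} with hB
  have hclosed : IsClosed B :=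
    (F.isClosed_argmax z).inter (isClosed_le continuous_lam continuous_const)
  have hbdd : Bornology.IsBounded B := by
    refine Metric.isBounded_iff_subset_closedBall x₀ |>.mpr
      ⟨(∑ a ∈ F.support, |F.term a x₀ - F.eval x₀|) / δ, fun x hx => ?_⟩
    obtain ⟨_, hmem, hle⟩ := huni (x - x₀)
    rw [Metric.mem_closedBall, dist_eq_norm, le_div_iff₀ hδ]
    rcases Finset.mem_insert.mp hmem with rfl | hmem
    · rw [hlamdot, lam_sub] at hle
      have h1 : lam x ≤ lam x₀ := hx.2
      have h2 : 0 ≤ ∑ a ∈ F.support, |F.term a x₀ - F.eval x₀| :=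
        Finset.sum_nonneg fun _ _ => abs_nonneg _
      linarith
    · obtain ⟨a, ha, rfl⟩ := Finset.mem_image.mp hmem
      have := TropicalPolynomial.mul_norm_le (hx.1 x₀) ha hle
      linarith
  obtain ⟨p, hp, hmin⟩ := (Metric.isCompact_of_isClosed_isBounded hclosed hbdd).exists_isMinOn
    ⟨x₀, hx₀, le_refl (lam x₀)⟩ continuous_lam.continuousOn
  have hlow : ∀ x ∈ F.argmax z, lam p ≤ lam x := by
    intro x hx
    by_cases hxB : lam x ≤ lam x₀
    · exact hmin (show x ∈ B from ⟨hx, hxB⟩)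
    · exact le_trans hp.2 (not_le.mp hxB).le
  refine ⟨p, hp.1, fun x hx hle => ?_⟩
  by_contra hxp
  have hlam := le_antisymm hle (hlow x hx)
  have key : ∀ x p : Plane, x ∈ F.argmax z → p ∈ F.argmax z → (∀ y ∈ F.argmax z, lam p ≤ lam y) →
      lam x = lam p → x 1 < p 1 → False := by
    intro x p hx hp hlow hlam hlt
    have hxp : x = p + (p 1 - x 1) • kerVec := by rw [← sub_eq_smul_kerVec hlam]; abel
    set t := (p 1 - x 1) / 2 with ht
    have ht0 : 0 < t := by rw [ht]; linarith
    have hx' : x = p + t • kerVec + t • kerVec := by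
      rw [add_assoc, ← add_smul, show t + t = p 1 - x 1 by rw [ht]; ring]; exact hxp
    have hp' : p = p + t • kerVec + t • -kerVec := by rw [smul_neg]; abel
    have hm : p + t • kerVec ∈ F.argmax z := by
      have h2 := F.convex_argmax z hp hx (show (0 : ℝ) ≤ 1 / 2 by norm_num)
        (show (0 : ℝ) ≤ 1 / 2 by norm_num) (by norm_num)
      have h3 : (1 / 2 : ℝ) • p + (1 / 2 : ℝ) • x = p + t • kerVec := by
        rw [hxp, smul_add, smul_smul, ← add_assoc, ← add_smul, ht]
        congr 2
        · norm_num
        · ring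
      rwa [h3] at h2
    -- At the midpoint `F - z` is locally constant, so a small step along `-![1, 0]`, which lowers
    -- `lam`, stays among the maxima.
    obtain ⟨h1, h2⟩ := N.notMem_of_segment hC hF hm ht0 ht0 (hx' ▸ hx) (hp' ▸ hp)
    have h3 := h2.eventually_mem_argmax hm (v := -![1, 0]) (by
      rw [sub_self, toPlane_zero, zero_dotProduct, N.kink_of_notMem h1])
    obtain ⟨ε, hε, hpos⟩ := (h3.and NetData.eventually_pos_right).exists
    have h4 := hlow _ hε
    have h5 : lam (![1, 0] : Plane) = 1 := by simp [lam]
    rw [lam_add, lam_add, lam_smul, lam_smul, lam_neg, lam_kerVec, h5] at h4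
    linarith
  rcases lt_trichotomy (x 1) (p 1) with h1 | h1 | h1
  · exact key x p hx hp.1 hlow hlam h1
  · have := sub_eq_smul_kerVec hlam
    rw [h1, sub_self, zero_smul, sub_eq_zero] at this
    exact hxp this
  · exact key p x hp.1 hx (fun y hy => hlam ▸ hlow y hy) hlam.symm h1

end Net

/-- Otherwise `u` would be a recession direction of the set of maxima, and `p + u` another maximum
at most as high. -/
lemma TropicalPolynomial.IsLowest.exists_neg {F : TropicalPolynomial} {z : Lattice} {p : Plane}
    (h : F.IsLowest z p) (u : Plane) (hu : u ≠ 0) (hlam : lam u ≤ 0) :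
    ∃ a ∈ F.support, toPlane (a - z) ⬝ᵥ u < 0 := by
  by_contra! hcon
  have h1 := h.2 _ (TropicalPolynomial.add_mem_argmax h.1 hcon) (by rw [lam_add]; linarith)
  exact hu (by simpa using h1)

end TropicalPlane

namespace TropicalPlane

/-! ### The unbounded regions -/

namespace Net

variable {C : Set Plane} (N : Net.{u} C) {F : TropicalPolynomial} {z : Lattice}

lemma exists_level : ∃ K, ∀ v, lam (N.pos v) < K := by
  obtain ⟨M, hM⟩ := (Set.finite_range fun v => lam (N.pos v)).bddAbove
  refine ⟨M + 1, fun v => ?_⟩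
  have : lam (N.pos v) ≤ M := hM (Set.mem_range_self v)
  linarith

/-- The point of the line of an edge at the level `K`. -/
noncomputable def atLevel (K : ℝ) (e : N.E) : Plane :=
  N.base e + ((K - lam (N.base e)) / lam (toPlane (N.d e))) • toPlane (N.d e)

lemma lam_atLevel (K : ℝ) (e : N.E) : lam (N.atLevel K e) = K := by
  have := (N.lam_pos e).ne'
  rw [atLevel, lam_add, lam_smul, div_mul_cancel₀ _ this]; ring

lemma atLevel_mem_carrier {K : ℝ} {e : N.E} (h : N.Act e K) : N.atLevel K e ∈ N.carrier e := by
  refine ⟨?_, ?_⟩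
  · rw [atLevel, add_sub_cancel_left, dt_smul_left, dt_self, mul_zero]
  · rw [N.lam_atLevel]; exact h

lemma eq_atLevel {x : Plane} {e : N.E} (hx : x ∈ N.carrier e) : x = N.atLevel (lam x) e := by
  have h1 := eq_smul_of_dt_eq_zero (N.lam_pos e).ne' hx.1
  rw [lam_sub] at h1
  rw [atLevel, ← h1]; abel

lemma carrier_nonempty (e : N.E) : (N.carrier e).Nonempty := by
  suffices ∃ K, N.Act e K by
    obtain ⟨K, hK⟩ := this
    exact ⟨_, N.atLevel_mem_carrier hK⟩
  rcases hlo : N.lo e with _ | v <;> rcases hhi : N.hi e with _ | w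
  · exact ⟨0, by simp [NetData.Act, hlo, hhi]⟩
  · exact ⟨lam (N.pos w) - 1, by simp [NetData.Act, hlo, hhi]⟩
  · exact ⟨lam (N.pos v) + 1, by simp [NetData.Act, hlo, hhi]⟩
  · have := N.lt e v w hlo hhi
    refine ⟨(lam (N.pos v) + lam (N.pos w)) / 2, ?_, ?_⟩
    · intro v' hv'
      rw [hlo, Option.some_inj] at hv'
      subst hv'; linarith
    · intro w' hw'
      rw [hhi, Option.some_inj] at hw'
      subst hw'; linarith

/-- The curve at a level above all vertices. -/
lemma exists_edge_of_level {K : ℝ} (hK : ∀ v, lam (N.pos v) < K) {x : Plane} (hx : x ∈ C)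
    (hxK : lam x = K) : ∃ e, x ∈ N.carrier e ∧ N.hi e = none := by
  rcases N.mem_iff.mp hx with ⟨v, rfl⟩ | ⟨e, he⟩
  · exact absurd hxK (hK v).ne
  · refine ⟨e, he, ?_⟩
    by_contra h
    obtain ⟨v, hv⟩ := Option.ne_none_iff_exists'.mp h
    have h1 := he.2.2 v hv
    have h2 := hK v
    linarith

lemma act_of_level {K : ℝ} (hK : ∀ v, lam (N.pos v) < K) {e : N.E} (he : N.hi e = none) :
    N.Act e K := ⟨fun v _ => hK v, fun v hv => by rw [he] at hv; cases hv⟩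

/-- Above all vertices only edges without an upper end remain. Each of them meets the level exactly
once, and disjointness keeps the points distinct. -/
lemma ncard_level {K : ℝ} (hK : ∀ v, lam (N.pos v) < K) :
    {x | x ∈ C ∧ lam x = K}.Finite ∧
      {x | x ∈ C ∧ lam x = K}.ncard = Nat.card {e // N.hi e = none} := by
  have himage : {x | x ∈ C ∧ lam x = K} = N.atLevel K '' {e | N.hi e = none} := by
    ext x
    constructor
    · rintro ⟨hx, hxK⟩
      obtain ⟨e, he, hhi⟩ := N.exists_edge_of_level hK hx hxK
      exact ⟨e, hhi, by rw [← hxK]; exact (N.eq_atLevel he).symm⟩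
    · rintro ⟨e, he, rfl⟩
      exact ⟨N.mem_iff.mpr (Or.inr ⟨e, N.atLevel_mem_carrier (N.act_of_level hK he)⟩),
        N.lam_atLevel K e⟩
  have hinj : Set.InjOn (N.atLevel K) {e | N.hi e = none} := by
    intro e he f hf hef
    have h1 := N.atLevel_mem_carrier (N.act_of_level hK he)
    have h2 := N.atLevel_mem_carrier (N.act_of_level hK hf)
    rw [hef] at h1
    exact N.eq_of_mem_carrier h1 h2
  rw [himage]
  exact ⟨(Set.toFinite _).image _, by rw [hinj.ncard_image]; rfl⟩

/-- Every point of the curve has an edge going up; at a highest vertex this edge has no upper end.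
-/
lemma exists_hi_eq_none (hC : IsNodalCurve C) : ∃ e, N.hi e = none := by
  by_contra! hcon
  have := N.nonempty
  obtain ⟨v, hv⟩ := Finite.exists_max fun v => lam (N.pos v)
  obtain ⟨δ, hδ⟩ := N.up_nonempty hC (N.pos_mem v)
  obtain ⟨e, he, -⟩ := Finset.mem_image.mp hδ
  obtain ⟨w, hw⟩ := Option.ne_none_iff_exists'.mp (hcon e)
  have h1 := (N.mem_upEdges.mp he).2.2 w hw
  have h2 := hv w
  linarith

/-- A maximum on an edge that is unbounded above persists along the edge. -/
lemma add_smul_mem_argmax (hF : ∀ x, ∃ a, N.HasForm F.eval x a) {x : Plane} {e : N.E}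
    (hx : x ∈ N.carrier e) (he : N.hi e = none) (hmax : x ∈ F.argmax z) {t : ℝ} (ht : 0 ≤ t) :
    x + t • toPlane (N.d e) ∈ F.argmax z := by
  have hcar : ∀ s : ℝ, 0 ≤ s → x + s • toPlane (N.d e) ∈ N.carrier e := by
    intro s hs
    have h1 := mul_nonneg hs (N.lam_pos e).le
    refine ⟨?_, fun v hv => ?_, fun v hv => by rw [he] at hv; cases hv⟩
    · have := N.aff_add e x (s • toPlane (N.d e))
      rw [dt_smul_left, dt_self, mul_zero, add_zero] at this
      exact this.trans hx.1
    · rw [lam_add, lam_smul]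
      have := hx.2.1 v hv
      linarith
  set s : Set ℝ := {t | x + t • toPlane (N.d e) ∈ F.argmax z} with hs
  have hclosed : IsClosed s := (F.isClosed_argmax z).preimage (by fun_prop)
  -- Continuation along the interval: the set of good parameters is closed, and it extends to the
  -- right because the kink of an edge vanishes along its own direction.
  have hsub : Set.Icc 0 t ⊆ s := by
    refine IsClosed.Icc_subset_of_forall_mem_nhdsWithin (hclosed.inter isClosed_Icc) ?_ ?_
    · change x + (0 : ℝ) • toPlane (N.d e) ∈ F.argmax z
      simpa using hmax
    · rintro r ⟨hr, hr0, -⟩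
      have hr : x + r • toPlane (N.d e) ∈ F.argmax z := hr
      obtain ⟨a, ha⟩ := hF (x + r • toPlane (N.d e))
      have hle := (ha.isMax_iff F.concaveOn_eval z).mp hr
      have h1 := hle (toPlane (N.d e))
      have h2 := hle (-toPlane (N.d e))
      rw [N.kink_of_mem_carrier (hcar r hr0), dt_self, max_self] at h1
      rw [N.kink_of_mem_carrier (hcar r hr0), dt_neg_left, dt_self, neg_zero, max_self,
        dotProduct_neg] at h2
      have h3 := ha.eventually_mem_argmax hr (v := toPlane (N.d e)) (by
        rw [N.kink_of_mem_carrier (hcar r hr0), dt_self, max_self]; linarith)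
      have h4 : Filter.Tendsto (fun y : ℝ => y - r) (𝓝[>] r) (𝓝[>] 0) := by
        refine tendsto_nhdsWithin_iff.mpr ⟨?_, ?_⟩
        · have : Continuous fun y : ℝ => y - r := by fun_prop
          simpa using (this.tendsto r).mono_left nhdsWithin_le_nhds
        · filter_upwards [self_mem_nhdsWithin] with y hy
          exact sub_pos.mpr (show r < y from hy)
      filter_upwards [h4.eventually h3] with y hy
      change x + y • toPlane (N.d e) ∈ F.argmax z
      rw [add_assoc, ← add_smul, add_sub_cancel] at hy
      exact hy
  exact hsub ⟨ht, le_refl t⟩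

lemma nonneg_of_forall_mem_argmax {x u : Plane}
    (h : ∀ t : ℝ, 0 ≤ t → x + t • u ∈ F.argmax z) {a : Lattice} (ha : a ∈ F.support) :
    0 ≤ toPlane (a - z) ⬝ᵥ u := by
  by_contra! hneg
  set c := F.term a x - F.eval x with hc
  have hc0 : 0 ≤ c := sub_nonneg.mpr (F.eval_le ha x)
  have h0 : x ∈ F.argmax z := by simpa using h 0 le_rfl
  have key : ∀ t : ℝ, 0 ≤ t → 0 ≤ c + t * (toPlane (a - z) ⬝ᵥ u) := by
    intro t ht
    have h1 := TropicalPolynomial.eval_sub_eq h0 (h t ht)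
    have h2 := F.eval_le ha (x + t • u)
    rw [F.term_add, dotProduct_smul, smul_eq_mul] at h2
    rw [dotProduct_add, dotProduct_smul, smul_eq_mul] at h1
    rw [toPlane_sub, sub_dotProduct]
    linarith
  -- At this parameter the affine lower bound has the value -1.
  have h3 := key ((c + 1) / -(toPlane (a - z) ⬝ᵥ u)) (div_nonneg (by linarith) (by linarith))
  have h4 : (c + 1) / -(toPlane (a - z) ⬝ᵥ u) * (toPlane (a - z) ⬝ᵥ u) = -(c + 1) := by
    rw [div_neg, neg_mul, div_mul_cancel₀ _ hneg.ne]
  rw [h4] at h3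
  linarith

/-- When all slopes lie on a line, the curve lies on a line. -/
lemma dt_eq_of_forall_dotProduct_eq_zero (hF : ∀ x, ∃ a, N.HasForm F.eval x a) {w : Plane}
    (h : ∀ a ∈ F.support, toPlane (a - z) ⬝ᵥ w = 0) {x y : Plane} (hx : x ∈ C) (hy : y ∈ C) :
    dt x w = dt y w := by
  have hinv : ∀ (x : Plane) (s : ℝ), F.eval (x + s • w) = F.eval x + s * (toPlane z ⬝ᵥ w) := by
    have hle : ∀ (x : Plane) (s : ℝ), F.eval x + s * (toPlane z ⬝ᵥ w) ≤ F.eval (x + s • w) := by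
      intro x s
      obtain ⟨a, ha, hax⟩ := F.exists_eval_eq (x + s • w)
      have h1 := h a ha
      have h2 := F.eval_le ha x
      rw [toPlane_sub, sub_dotProduct, sub_eq_zero] at h1
      rw [hax, F.term_add, dotProduct_smul, smul_eq_mul, h1]
      linarith
    intro x s
    refine le_antisymm ?_ (hle x s)
    have h1 := hle (x + s • w) (-s)
    rw [add_assoc, ← add_smul, add_neg_cancel, zero_smul, add_zero] at h1
    linarith
  -- As `F` is affine along `w`, the non-negative kinks in the directions `w` and `-w` both vanish,
  -- so every edge is parallel to `w`.
  have hedge : ∀ e, dt w (toPlane (N.d e)) = 0 := by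
    intro e
    obtain ⟨y, hy⟩ := N.carrier_nonempty e
    obtain ⟨a, ha⟩ := hF y
    obtain ⟨ε, h1, h2, hpos⟩ := ((ha.eventually_smul w).and ((ha.eventually_smul (-w)).and
      NetData.eventually_pos_right)).exists
    rw [hinv] at h1
    rw [smul_neg, ← neg_smul, hinv] at h2
    rw [N.kink_of_mem_carrier hy] at h1 h2
    rw [dotProduct_neg, dt_neg_left] at h2
    have h3 : ε * (max 0 (dt w (toPlane (N.d e))) + max 0 (-dt w (toPlane (N.d e)))) = 0 := by
      linarith
    have h4 := (mul_eq_zero.mp h3).resolve_left hpos.ne'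
    have h5 := le_max_left 0 (dt w (toPlane (N.d e)))
    have h6 := le_max_right 0 (dt w (toPlane (N.d e)))
    have h7 := le_max_left 0 (-dt w (toPlane (N.d e)))
    have h8 := le_max_right 0 (-dt w (toPlane (N.d e)))
    linarith
  have hon : ∀ e x y, N.aff e x = 0 → N.aff e y = 0 → dt x w = dt y w := by
    intro e x y hx hy
    rw [N.aff_eq_of_aff_eq_zero hy] at hx
    have h1 := eq_smul_of_dt_eq_zero (N.lam_pos e).ne' hx
    have h2 : dt (x - y) w = 0 := by
      rw [h1, dt_smul_left, dt_swap, hedge, neg_zero, mul_zero]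
    rw [dt_sub_left] at h2
    linarith
  -- The parallel edges lie on one line because the resolved graph is connected.
  have hconn := N.conn (fun v => dt (N.pos v) w) fun e v v' hv hv' =>
    hon e _ _ (N.dt_lo e v hv) (N.dt_hi e v' hv')
  have hvert : ∀ x ∈ C, ∃ v, dt x w = dt (N.pos v) w := by
    intro x hx
    rcases N.mem_iff.mp hx with ⟨v, rfl⟩ | ⟨e, he⟩
    · exact ⟨v, rfl⟩
    · rcases N.ends e with h | h <;> obtain ⟨v, hv⟩ := Option.ne_none_iff_exists'.mp h
      · exact ⟨v, hon e _ _ he.1 (N.dt_lo e v hv)⟩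
      · exact ⟨v, hon e _ _ he.1 (N.dt_hi e v hv)⟩
  obtain ⟨v, hv⟩ := hvert x hx
  obtain ⟨v', hv'⟩ := hvert y hy
  rw [hv, hv']
  exact hconn v v'

/-- The slope of `F` to the right of `x`, in the direction of `kerVec`. -/
noncomputable def rightSlope (hF : ∀ x, ∃ a, N.HasForm F.eval x a) (x : Plane) : Lattice :=
  (hF x).choose - ∑ δ ∈ N.up x, nrm δ

variable (hF : ∀ x, ∃ a, N.HasForm F.eval x a)

lemma rightSlope_eq {x : Plane} {e : N.E} (hx : x ∈ N.carrier e) :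
    N.rightSlope hF x = (hF x).choose - nrm (N.d e) := by
  rw [rightSlope, N.up_eq_of_mem_carrier hx, Finset.sum_singleton]

lemma mem_argmax_rightSlope {x : Plane} {e : N.E} (hx : x ∈ N.carrier e) :
    x ∈ F.argmax (N.rightSlope hF x) := by
  refine ((hF x).choose_spec.isMax_iff F.concaveOn_eval _).mpr fun v => ?_
  rw [N.rightSlope_eq hF hx, sub_sub_cancel, toPlane_nrm_dotProduct, N.kink_of_mem_carrier hx]
  exact le_max_right _ _

lemma eventually_mem_argmax_rightSlope {x : Plane} {e : N.E} (hx : x ∈ N.carrier e) :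
    ∀ᶠ ε in 𝓝[>] (0 : ℝ), x + ε • kerVec ∈ F.argmax (N.rightSlope hF x) := by
  refine (hF x).choose_spec.eventually_mem_argmax (N.mem_argmax_rightSlope hF hx) ?_
  rw [N.rightSlope_eq hF hx, sub_sub_cancel, toPlane_nrm_dotProduct, N.kink_of_mem_carrier hx,
    dt_kerVec, max_eq_right (N.lam_pos e).le]

lemma notMem_argmax_rightSlope {x : Plane} {e : N.E} (hx : x ∈ N.carrier e) {t : ℝ} (ht : 0 < t) :
    x + t • -kerVec ∉ F.argmax (N.rightSlope hF x) := by
  intro h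
  have h1 := (hF x).choose_spec.dotProduct_eq_kink (N.mem_argmax_rightSlope hF hx) ht h
  rw [N.rightSlope_eq hF hx, sub_sub_cancel, toPlane_nrm_dotProduct, N.kink_neg_kerVec,
    dt_neg_left, dt_kerVec] at h1
  linarith [N.lam_pos e]

/-- A point of the level is the left end of the set of maxima for its right slope, and so is
determined by that slope. -/
lemma rightSlope_injOn {K : ℝ} (hK : ∀ v, lam (N.pos v) < K) :
    Set.InjOn (N.rightSlope hF) {x | x ∈ C ∧ lam x = K} := by
  have key : ∀ x y : Plane, x ∈ C → y ∈ C → lam x = K → lam y = K → x 1 < y 1 →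
      N.rightSlope hF x ≠ N.rightSlope hF y := by
    intro x y hx hy hxK hyK hlt heq
    obtain ⟨e, he, -⟩ := N.exists_edge_of_level hK hx hxK
    obtain ⟨f, hf, -⟩ := N.exists_edge_of_level hK hy hyK
    have h1 := N.mem_argmax_rightSlope hF hf
    rw [← heq] at h1
    have h2 : y = x + (y 1 - x 1) • -kerVec := by
      have := sub_eq_smul_kerVec (x := y) (q := x) (hyK.trans hxK.symm)
      rw [smul_neg, ← neg_smul, neg_sub, ← this]; abel
    rw [h2] at h1
    exact N.notMem_argmax_rightSlope hF he (by linarith) h1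
  rintro x ⟨hx, hxK⟩ y ⟨hy, hyK⟩ heq
  rcases lt_trichotomy (x 1) (y 1) with h | h | h
  · exact absurd heq (key x y hx hy hxK hyK h)
  · have := sub_eq_smul_kerVec (x := x) (q := y) (hxK.trans hyK.symm)
    rw [h, sub_self, zero_smul, sub_eq_zero] at this
    exact this
  · exact absurd heq.symm (key y x hy hx hyK hxK h)

/-- The region between two consecutive rays is bounded below, and its slope is on the boundary of
the Newton polygon. -/
lemma rightSlope_mem (hC : IsNodalCurve C) {K : ℝ} (hK : ∀ v, lam (N.pos v) < K) {x y : Plane}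
    (hx : x ∈ C) (hy : y ∈ C) (hxK : lam x = K) (hyK : lam y = K) (hlt : y 1 < x 1) :
    (∃ p, F.IsLowest (N.rightSlope hF x) p) ∧
      toPlane (N.rightSlope hF x) ∉ interior F.newtonPolygon := by
  obtain ⟨e, he, hhi⟩ := N.exists_edge_of_level hK hx hxK
  set z := N.rightSlope hF x with hz
  have hxmax := N.mem_argmax_rightSlope hF he
  rw [← hz] at hxmax
  set t := x 1 - y 1 with ht
  have ht0 : 0 < t := by rw [ht]; linarith
  have hyx : y = x + t • kerVec := by
    rw [ht, ← sub_eq_smul_kerVec (hyK.trans hxK.symm)]; abel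
  have hd : ∀ a ∈ F.support, 0 ≤ toPlane (a - z) ⬝ᵥ toPlane (N.d e) := fun a ha =>
    nonneg_of_forall_mem_argmax (fun s hs => N.add_smul_mem_argmax hF he hhi hxmax hs) ha
  have hpos := N.lam_pos e
  refine ⟨N.exists_isLowest hC hF ⟨x, hxmax⟩ fun u hu hlam => ?_, ?_⟩
  · by_contra! hcon
    -- A non-negative combination of `u` and the edge direction, chosen to be level. It is again a
    -- recession direction of the set of maxima, and equals `c • kerVec`.
    set c := -(lam (toPlane (N.d e)) • u - lam u • toPlane (N.d e)) 1 with hc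
    have hker : lam (toPlane (N.d e)) • u - lam u • toPlane (N.d e) = c • kerVec :=
      eq_smul_kerVec (by rw [lam_sub, lam_smul, lam_smul]; ring)
    have hrec : ∀ a ∈ F.support, 0 ≤ toPlane (a - z) ⬝ᵥ (c • kerVec) := by
      intro a ha
      rw [← hker, dotProduct_sub, dotProduct_smul, dotProduct_smul, smul_eq_mul, smul_eq_mul]
      have h1 := mul_nonneg hpos.le (hcon a ha)
      have h2 := mul_nonneg (neg_nonneg.mpr hlam) (hd a ha)
      linarith
    -- If c < 0, the maxima extend to the left of `x`, across the edge. If c = 0, `u` is a negative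
    -- multiple of the edge direction, so the curve lies on one line and cannot meet the level
    -- twice. If c > 0, the maxima contain a level ray that has `y`, a point of the curve, in its
    -- interior.
    rcases lt_trichotomy c 0 with hc0 | hc0 | hc0
    · have h1 := TropicalPolynomial.add_mem_argmax hxmax hrec
      have h2 : c • kerVec = (-c) • -kerVec := by rw [smul_neg, neg_smul, neg_neg]
      rw [h2] at h1
      exact N.notMem_argmax_rightSlope hF he (by linarith) h1
    · rw [hc0, zero_smul, sub_eq_zero] at hker
      have hlam0 : lam u ≠ 0 := by
        intro h0
        rw [h0, zero_smul] at hker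
        exact hu ((smul_eq_zero.mp hker).resolve_left hpos.ne')
      have hlt0 : lam u < 0 := lt_of_le_of_ne hlam hlam0
      have hzero : ∀ a ∈ F.support, toPlane (a - z) ⬝ᵥ toPlane (N.d e) = 0 := by
        intro a ha
        refine le_antisymm ?_ (hd a ha)
        have h1 := mul_nonneg hpos.le (hcon a ha)
        rw [← smul_eq_mul, ← dotProduct_smul, hker, dotProduct_smul, smul_eq_mul] at h1
        by_contra! h2
        have := mul_neg_of_neg_of_pos hlt0 h2
        linarith
      have h3 := N.dt_eq_of_forall_dotProduct_eq_zero hF hzero hx hy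
      rw [hyx, dt_add_left, dt_smul_left, dt_kerVec] at h3
      have := mul_pos ht0 hpos
      linarith
    · have hrec' : ∀ s : ℝ, 0 ≤ s → ∀ a ∈ F.support, 0 ≤ toPlane (a - z) ⬝ᵥ (s • kerVec) := by
        intro s hs a ha
        have h1 := hrec a ha
        rw [dotProduct_smul, smul_eq_mul] at h1 ⊢
        exact mul_nonneg hs (nonneg_of_mul_nonneg_right h1 hc0)
      have hymax : y ∈ F.argmax z := by
        rw [hyx]; exact TropicalPolynomial.add_mem_argmax hxmax (hrec' t ht0.le)
      have hymax' : y + (1 : ℝ) • kerVec ∈ F.argmax z :=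
        TropicalPolynomial.add_mem_argmax hymax (hrec' 1 zero_le_one)
      have hx' : y + t • -kerVec ∈ F.argmax z := by
        rw [hyx, smul_neg, add_neg_cancel_right]; exact hxmax
      exact (N.notMem_of_segment hC hF hymax one_pos ht0 hymax' hx').1 hy
  · rw [TropicalPolynomial.mem_interior_newtonPolygon_iff]
    push Not
    refine ⟨toPlane (N.d e), fun h => ?_, hd⟩
    rw [h, lam_zero] at hpos
    exact lt_irrefl _ hpos

/-- Every slope with a lowest maximum on the boundary of the Newton polygon belongs to a region
between two rays. -/
lemma exists_rightSlope_eq {K : ℝ} (hK : ∀ v, lam (N.pos v) < K) {z : Lattice} {p : Plane}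
    (hp : F.IsLowest z p) (hz : toPlane z ∉ interior F.newtonPolygon) :
    ∃ x y, x ∈ C ∧ y ∈ C ∧ lam x = K ∧ lam y = K ∧ y 1 < x 1 ∧ N.rightSlope hF x = z := by
  rw [TropicalPolynomial.mem_interior_newtonPolygon_iff] at hz
  push Not at hz
  obtain ⟨u, hu, hrec⟩ := hz
  have hlam : 0 < lam u := by
    by_contra! h
    obtain ⟨a, ha, hneg⟩ := hp.exists_neg u hu h
    exact absurd (hrec a ha) (not_le.mpr hneg)
  obtain ⟨v, hv⟩ := N.mem_points.mp (IsLowest.mem_points N hF hp)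
  have hpK : lam p < K := hv ▸ hK v
  -- The lowest point is moved along the recession direction `u` up to the level `K`.
  obtain ⟨q, hq⟩ : ∃ q, q = p + ((K - lam p) / lam u) • u := ⟨_, rfl⟩
  have hqK : lam q = K := by
    rw [hq, lam_add, lam_smul, div_mul_cancel₀ _ hlam.ne']; ring
  have hqmax : q ∈ F.argmax z := by
    rw [hq]
    refine TropicalPolynomial.add_mem_argmax hp.1 fun a ha => ?_
    rw [dotProduct_smul, smul_eq_mul]
    exact mul_nonneg (div_nonneg (by linarith) hlam.le) (hrec a ha)
  set A : Set ℝ := {t | q + t • kerVec ∈ F.argmax z} with hA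
  have hclosed : IsClosed A := (F.isClosed_argmax z).preimage (by fun_prop)
  have hbound : ∀ w : Plane, w ≠ 0 → lam w ≤ 0 → ∃ M, ∀ t : ℝ, q + t • w ∈ F.argmax z → t ≤ M := by
    intro w hw hwl
    obtain ⟨a, ha, hneg⟩ := hp.exists_neg w hw hwl
    refine ⟨(F.term a q - F.eval q) / -(toPlane (a - z) ⬝ᵥ w), fun t ht => ?_⟩
    rw [le_div_iff₀ (by linarith)]
    have h1 := TropicalPolynomial.eval_sub_eq hqmax ht
    have h2 := F.eval_le ha (q + t • w)
    rw [F.term_add, dotProduct_smul, smul_eq_mul] at h2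
    rw [dotProduct_add (toPlane z) q, dotProduct_smul, smul_eq_mul] at h1
    rw [toPlane_sub, sub_dotProduct]
    linarith
  obtain ⟨M₁, hM₁⟩ := hbound kerVec kerVec_ne_zero (by simp)
  obtain ⟨M₂, hM₂⟩ := hbound (-kerVec) (neg_ne_zero.mpr kerVec_ne_zero) (by simp)
  have hcpt : IsCompact A := by
    refine (isCompact_Icc (a := -M₂) (b := M₁)).of_isClosed_subset hclosed fun t ht => ?_
    refine ⟨?_, hM₁ t ht⟩
    have := hM₂ (-t) (by rw [smul_neg, neg_smul, neg_neg]; exact ht)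
    linarith
  have hne : A.Nonempty := ⟨0, by change q + (0 : ℝ) • kerVec ∈ F.argmax z; simpa using hqmax⟩
  -- The maxima at level `K` form a bounded interval, since a level recession direction is excluded
  -- by the lowest point. Its ends are on the curve, and the slope to the right of the left end is
  -- `z`.
  obtain ⟨t₁, ht₁, hmin⟩ := hcpt.exists_isLeast hne
  obtain ⟨t₂, ht₂, hmax⟩ := hcpt.exists_isGreatest hne
  have hlev : ∀ t : ℝ, lam (q + t • kerVec) = K := by simp [hqK]
  have hx1 : q + t₁ • kerVec ∈ F.argmax z := ht₁
  have hx2 : q + t₂ • kerVec ∈ F.argmax z := ht₂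
  have hend1 : ¬ ∀ᶠ ε in 𝓝[>] (0 : ℝ), q + t₁ • kerVec + ε • -kerVec ∈ F.argmax z := by
    intro h
    obtain ⟨ε, hε, hpos⟩ := (h.and NetData.eventually_pos_right).exists
    have : t₁ - ε ∈ A := by
      change q + (t₁ - ε) • kerVec ∈ F.argmax z
      convert hε using 1
      rw [sub_smul, smul_neg]; abel
    have := hmin this
    linarith
  have hend2 : ¬ ∀ᶠ ε in 𝓝[>] (0 : ℝ), q + t₂ • kerVec + ε • kerVec ∈ F.argmax z := by
    intro h
    obtain ⟨ε, hε, hpos⟩ := (h.and NetData.eventually_pos_right).exists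
    have : t₂ + ε ∈ A := by
      change q + (t₂ + ε) • kerVec ∈ F.argmax z
      rw [add_smul, ← add_assoc]; exact hε
    have := hmax this
    linarith
  have hmemC : ∀ x, x ∈ F.argmax z → ∀ w, ¬ (∀ᶠ ε in 𝓝[>] (0 : ℝ), x + ε • w ∈ F.argmax z) →
      x ∈ C := by
    intro x hx w hw
    by_contra hxC
    obtain ⟨a, ha⟩ := hF x
    have := N.eq_of_notMem F.concaveOn_eval hxC ha hx
    subst this
    exact hw (ha.eventually_mem_argmax hx (by
      rw [sub_self, toPlane_zero, zero_dotProduct, N.kink_of_notMem hxC]))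
  have hxC := hmemC _ hx1 _ hend1
  have hyC := hmemC _ hx2 _ hend2
  obtain ⟨e, he, -⟩ := N.exists_edge_of_level hK hxC (hlev t₁)
  have heq : N.rightSlope hF (q + t₁ • kerVec) = z := by
    rw [N.rightSlope_eq hF he]
    rcases N.eq_or_eq_of_mem_carrier F.concaveOn_eval he (hF _).choose_spec hx1 with h1 | h1
    · exfalso
      refine hend1 ((hF _).choose_spec.eventually_mem_argmax hx1 ?_)
      rw [← h1, sub_self, toPlane_zero, zero_dotProduct, N.kink_neg_kerVec]
    · exact h1.symm
  refine ⟨_, _, hxC, hyC, hlev _, hlev _, ?_, heq⟩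
  have hlt : t₁ < t₂ := by
    refine lt_of_le_of_ne (hmin ht₂) fun h => ?_
    have := N.eventually_mem_argmax_rightSlope hF he
    rw [heq, h] at this
    exact hend2 this
  simp [kerVec]
  linarith

/-- A high level line meets the curve in as many points as there are edges without an upper end. The
bounded intervals between these points, one fewer in number, are labelled by their left ends, and
their slopes are the required lattice points. -/
theorem ncard_isLowest_boundary (hF : ∀ x, ∃ a, N.HasForm F.eval x a) (hC : IsNodalCurve C) :
    {z | (∃ p, F.IsLowest z p) ∧ toPlane z ∉ interior F.newtonPolygon}.ncard + 1 =
      Nat.card {e // N.hi e = none} := by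
  obtain ⟨K, hK⟩ := N.exists_level
  obtain ⟨hfin, hcard⟩ := N.ncard_level hK
  set X := {x | x ∈ C ∧ lam x = K} with hX
  have hne : X.Nonempty := by
    obtain ⟨e, he⟩ := N.exists_hi_eq_none hC
    exact ⟨N.atLevel K e, N.mem_iff.mpr
      (Or.inr ⟨e, N.atLevel_mem_carrier (N.act_of_level hK he)⟩), N.lam_atLevel K e⟩
  -- The least second coordinate belongs to the rightmost point, the only one that is not the left
  -- end of a bounded interval.
  obtain ⟨m, hm, hmin⟩ := Set.exists_min_image X (fun x => x 1) hfin hne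
  have himage : {z | (∃ p, F.IsLowest z p) ∧ toPlane z ∉ interior F.newtonPolygon} =
      N.rightSlope hF '' (X \ {m}) := by
    ext z
    constructor
    · rintro ⟨⟨p, hp⟩, hz⟩
      obtain ⟨x, y, hx, hy, hxK, hyK, hlt, rfl⟩ := N.exists_rightSlope_eq hF hK hp hz
      refine ⟨x, ⟨⟨hx, hxK⟩, ?_⟩, rfl⟩
      rintro rfl
      have := hmin y ⟨hy, hyK⟩
      linarith
    · rintro ⟨x, ⟨⟨hx, hxK⟩, hxm⟩, rfl⟩
      refine N.rightSlope_mem hF hC hK hx hm.1 hxK hm.2 ?_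
      refine lt_of_le_of_ne (hmin x ⟨hx, hxK⟩) fun h => hxm ?_
      have := sub_eq_smul_kerVec (x := x) (q := m) (hxK.trans hm.2.symm)
      rw [h, sub_self, zero_smul, sub_eq_zero] at this
      exact this
  rw [himage, ((N.rightSlope_injOn hF hK).mono Set.sdiff_subset).ncard_image, ← hcard,
    Set.ncard_sdiff_singleton_add_one hm hfin]

end Net

end TropicalPlane

/-! ### The proposition -/

theorem mainTheorem5 (Γ : TropicalPlane.TropicalCurve.{u}) (C : Set TropicalPlane.Plane)
    (hC : TropicalPlane.IsImmersion Γ C) :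
    (TropicalPlane.nodes C).Finite ∧
    (∃ F : TropicalPlane.TropicalPolynomial, F.IsDualTo C) ∧
    ∀ F : TropicalPlane.TropicalPolynomial, F.IsDualTo C →
      {z : TropicalPlane.Lattice |
          TropicalPlane.toPlane z ∈ interior F.newtonPolygon}.encard =
        ((Γ.genus + TropicalPlane.nodeCount C : ℕ) : ℕ∞) := by
  obtain ⟨hcurve, Γ', hmod, ⟨R⟩⟩ := hC
  refine ⟨R.net.finite_nodes, R.net.exists_isDualTo hcurve, fun F hF => ?_⟩
  have hform := R.net.hasForm_of_isDualTo hcurve hF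
  obtain ⟨hfin, hS⟩ := R.net.ncard_exists_isLowest hcurve hform
  have hT := R.net.ncard_isLowest_boundary hform hcurve
  have hg := R.genus_add_card_net
  have hE := R.net.sum_card_up
  rw [hmod.genus_eq] at hg
  set I := {z : TropicalPlane.Lattice | TropicalPlane.toPlane z ∈ interior F.newtonPolygon} with hI
  set S := {z : TropicalPlane.Lattice | ∃ p, F.IsLowest z p} with hSdef
  -- For an interior lattice point the negativity condition holds in all directions, which gives
  -- both the existence of a maximum and of a lowest one.
  have hIS : I ⊆ S := fun z hz => by
    have h := TropicalPlane.TropicalPolynomial.mem_interior_newtonPolygon_iff.mp hz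
    exact R.net.exists_isLowest hcurve hform
      (TropicalPlane.TropicalPolynomial.nonempty_argmax h) fun u hu _ => h u hu
  have hsdiff : {z : TropicalPlane.Lattice | (∃ p, F.IsLowest z p) ∧
      TropicalPlane.toPlane z ∉ interior F.newtonPolygon} = S \ I := rfl
  rw [hsdiff] at hT
  have hsum := Set.ncard_sdiff_add_ncard_of_subset hIS hfin
  rw [← (hfin.subset hIS).cast_ncard_eq]
  congr 1
  -- Eliminates V, E and the numbers of unbounded edges: |S| + V = Σ + n, Σ + r₋ = E, g + V + r₋ +
  -- r₊ = E + 1 and |S \ I| + 1 = r₊, where Σ counts the edges with a lower end.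
  omega
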